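/- Let $k\ge 1$ be odd, let $M$ be a smooth manifold of dimension $k+1$, let $E\to M$ be a smooth real vector bundle of rank $2$, and let $TM\simeq S^k(E)$ be an isomorphism of smooth vector bundles (a $GL(2)$-structure on $M$). Let $B(E)\to M$ be the principal $GL(2)$-bundle of bases $(x,y)$ of the fibres of $E$, a basis $(x,y)$ being identified with the frame $(x^k,x^{k-1}y,\ldots,y^k)$ of $TM$; $g\in GL(2)$ acts on the right by $(x,y)\mapsto(x,y)g$. Let $\omega=(\omega^0,\ldots,\omega^k)^t$ be the soldering form on $B(E)$ (the coordinates in this frame of the projection of a tangent vector to $M$), and let $\phi=\left(\begin{smallmatrix}\phi^1_1&\phi^2_1\\ \phi^1_2&\phi^2_2\end{smallmatrix}\right)$ be a smooth $\mathfrak{gl}(2)$-valued connection form on $B(E)$. Let $\Phi$ be the image of $\phi$ under the representation of $\mathfrak{gl}(2)$ on the homogeneous polynomials of degree $k$ in $x,y$ (in the basis $x^k,x^{k-1}y,\ldots,y^k$) obtained by differentiating $V(x,y)\mapsto V((x,y)g)$. The torsion and the curvature of $\phi$ are the horizontal $2$-forms $\Theta=d\omega+\Phi\wedge\omega$ and $\Omega=d\phi+\phi\wedge\phi$.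 For $0\le j\le\lfloor k/2\rfloor$ let $V^{even}_{k,j}$ and $V^{odd}_{k,j}$ be the real and the imaginary part of $(x^2+y^2)^j(x+iy)^{k-2j}$. They form a basis of the space of real homogeneous polynomials of degree $k$; let $(\xi^{k,j}_{even},\xi^{k,j}_{odd})_j$ be the dual basis. Regarding linear forms on this space as $1$-forms on $B(E)$ by means of $\omega$, put $\xi^{k,j}=\xi^{k,j}_{even}+i\,\xi^{k,j}_{odd}$, and put $\zeta=(\phi^1_2+\phi^2_1)+i(\phi^2_2-\phi^1_1)$. Let $CO(2)=\left\{\left(\begin{smallmatrix}u&-v\\ v&u\end{smallmatrix}\right): u^2+v^2\neq0\right\}\subset GL(2)$. There is exactly one almost-complex structure $\mathfrak{J}_\phi$ on the quotient manifold $B(E)/CO(2)$ whose $(1,0)$-forms are those complex-valued forms whose pullbacks to $B(E)$ are linear combinations of $\xi^{k,0},\ldots,\xi^{k,\lfloor k/2\rfloor}$ and $\zeta$. It is integrable (its Nijenhuis tensor vanishes) if and only if $T^{(0,2)}=0$ and $C^{(0,2)}=0$ on $B(E)$. Here $T^{(0,2)}$ and $C^{(0,2)}$ are the coefficients of the forms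 $\bar\xi^{k,a}\wedge\bar\xi^{k,b}$ when the horizontal complex-valued $2$-forms $\xi^{k,j}(\Theta)$, $0\le j\le\lfloor k/2\rfloor$, respectively the horizontal $2$-form $(\Omega^1_2+\Omega^2_1)+i(\Omega^2_2-\Omega^1_1)$, are written in the basis $(\xi,\bar\xi)$. -/

import Mathlib

open Bundle Set Topology Manifold ContDiff

namespace GL2Geometry

noncomputable section

/-- The model fibre `ℝ²` of the rank-two bundle `E`. -/
abbrev Plane : Type := Fin 2 → ℝ

section FrameBundle

variable {H M : Type*} [TopologicalSpace H] [TopologicalSpace M] [ChartedSpace H M]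
  (E : M → Type*) [∀ p, AddCommGroup (E p)] [∀ p, Module ℝ (E p)]
  [TopologicalSpace (TotalSpace Plane E)] [∀ p, TopologicalSpace (E p)]
  [FiberBundle Plane E] [VectorBundle ℝ Plane E]

theorem linearIndependent_iff_det (a b : Plane) :
    LinearIndependent ℝ ![a, b] ↔ a 0 * b 1 - a 1 * b 0 ≠ 0 := by
  have h := Matrix.linearIndependent_rows_iff_isUnit (A := Matrix.of ![a, b])
  rw [Matrix.isUnit_iff_isUnit_det, isUnit_iff_ne_zero, Matrix.det_fin_two] at h
  have h' : (Matrix.of ![a, b]).row = ![a, b] := rfl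
  rw [h'] at h
  rw [h]
  simp [mul_comm]

theorem linearIndependent_triv_iff (e : Trivialization Plane (π Plane E)) [e.IsLinear ℝ]
    {p : M} (hp : p ∈ e.baseSet) (x y : E p) :
    LinearIndependent ℝ ![e.continuousLinearMapAt ℝ p x, e.continuousLinearMapAt ℝ p y] ↔
      LinearIndependent ℝ ![x, y] := by
  have hk : LinearMap.ker (e.linearEquivAt ℝ p hp : E p →ₗ[ℝ] Plane) = ⊥ := LinearEquiv.ker _
  rw [← LinearMap.linearIndependent_iff _ hk]
  have : ((e.linearEquivAt ℝ p hp : E p →ₗ[ℝ] Plane) ∘ ![x, y]) =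
      ![e.continuousLinearMapAt ℝ p x, e.continuousLinearMapAt ℝ p y] := by
    ext i j
    fin_cases i <;> simp [Trivialization.coe_linearMapAt_of_mem (R := ℝ) e hp]
  rw [this]

/-- The pairs `(x, y)` of vectors of `E ⊕ E` that form a basis of a fibre `E p`. -/
def frameSet : Set (TotalSpace (Plane × Plane) (E ×ᵇ E)) :=
  {χ | LinearIndependent ℝ ![χ.2.1, χ.2.2]}

theorem isOpen_frameSet : IsOpen (frameSet E) := by
  rw [isOpen_iff_mem_nhds]
  intro χ hχ
  let e := trivializationAt Plane E χ.proj
  have hp : χ.proj ∈ e.baseSet := mem_baseSet_trivializationAt Plane E χ.proj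
  let T := e.prod e
  have hT : χ ∈ T.source := by
    rw [T.mem_source]; exact ⟨hp, hp⟩
  have hc : ContinuousOn (fun c : TotalSpace (Plane × Plane) (E ×ᵇ E) =>
      (T c).2.1 0 * (T c).2.2 1 - (T c).2.1 1 * (T c).2.2 0) T.source := by
    have h0 : ContinuousOn (fun c => (T c).2) T.source := continuous_snd.comp_continuousOn T.continuousOn
    fun_prop
  have ho := hc.isOpen_inter_preimage T.open_source isOpen_ne (t := {r : ℝ | r ≠ 0})
  have key : ∀ c ∈ T.source, ((T c).2.1 0 * (T c).2.2 1 - (T c).2.1 1 * (T c).2.2 0 ≠ 0 ↔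
      c ∈ frameSet E) := by
    rintro ⟨p, x, y⟩ hc
    rw [T.mem_source] at hc
    rw [frameSet, mem_ofPred_eq, ← linearIndependent_triv_iff E e hc.1, linearIndependent_iff_det,
      e.continuousLinearMapAt_apply ℝ,
      Trivialization.coe_linearMapAt_of_mem (R := ℝ) e hc.1]
    rfl
  exact Filter.mem_of_superset (ho.mem_nhds ⟨hT, (key χ hT).2 hχ⟩) fun c hc => (key c hc.1).1 hc.2

/-- The bases of the fibres of `E`, as an open subset of the total space of `E ⊕ E`. -/
def frames : TopologicalSpace.Opens (TotalSpace (Plane × Plane) (E ×ᵇ E)) :=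
  ⟨frameSet E, isOpen_frameSet E⟩

/-- The `GL(2)`-bundle `B(E)`. A point is a point `p` of `M` with a basis `(x, y)` of `E p`; it stands
for the frame `(x^k, x^(k-1) y, …, y^k)` of `T_p M`, which for odd `k` determines `(x, y)`.
Its smooth structure is that of an open subset of the total space of `E ⊕ E`. -/
abbrev FrameBundle : Type _ := ↥(frames E)

variable {E}

/-- The right action of `GL(2)` on `B(E)`: the basis `(x, y)` is sent to the row `(x, y) g`. -/
def FrameBundle.act (χ : FrameBundle E) (g : GL (Fin 2) ℝ) : FrameBundle E :=
  ⟨⟨χ.1.proj, (g 0 0 • χ.1.2.1 + g 1 0 • χ.1.2.2, g 0 1 • χ.1.2.1 + g 1 1 • χ.1.2.2)⟩, by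
    have h : LinearIndependent ℝ ![χ.1.2.1, χ.1.2.2] := χ.2
    have hg : (g 0 0 * g 1 1 - g 0 1 * g 1 0 : ℝ) ≠ 0 := by
      have := g.det_ne_zero
      rwa [Matrix.det_fin_two] at this
    change LinearIndependent ℝ ![_, _]
    rw [LinearIndependent.pair_iff] at h ⊢
    intro s t hst
    have := h (s * g 0 0 + t * g 0 1) (s * g 1 0 + t * g 1 1) (by
      rw [← hst]; module)
    obtain ⟨h1, h2⟩ := this
    constructor
    · have : s * (g 0 0 * g 1 1 - g 0 1 * g 1 0 : ℝ) = 0 := by linear_combination g 1 1 * h1 - g 0 1 * h2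
      exact (mul_eq_zero.1 this).resolve_right hg
    · have : t * (g 0 0 * g 1 1 - g 0 1 * g 1 0 : ℝ) = 0 := by linear_combination g 0 0 * h2 - g 1 0 * h1
      exact (mul_eq_zero.1 this).resolve_right hg⟩

theorem FrameBundle.act_one (χ : FrameBundle E) : χ.act 1 = χ := by
  obtain ⟨⟨p, x, y⟩, h⟩ := χ
  simp [FrameBundle.act]

theorem FrameBundle.act_mul (χ : FrameBundle E) (g h : GL (Fin 2) ℝ) :
    χ.act (g * h) = (χ.act g).act h := by
  obtain ⟨⟨p, x, y⟩, hχ⟩ := χ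
  have key : ∀ a b c d r s : ℝ, (a * r + b * s) • x + (c * r + d * s) • y =
      r • (a • x + c • y) + s • (b • x + d • y) := by intros; module
  refine Subtype.ext ?_
  simp only [FrameBundle.act, Units.val_mul, Matrix.mul_apply, Fin.sum_univ_two]
  congr 1
  refine Prod.ext ?_ ?_
  · exact key _ _ _ _ _ _
  · exact key _ _ _ _ _ _

/-- The subgroup `CO(2)` of the matrices `!![u, -v; v, u]` in `GL(2)`. -/
def CO2 : Subgroup (GL (Fin 2) ℝ) where
  carrier := {g | ∃ u v : ℝ, (g : Matrix (Fin 2) (Fin 2) ℝ) = !![u, -v; v, u]}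
  one_mem' := ⟨1, 0, by simp [Matrix.one_fin_two]⟩
  mul_mem' := by
    rintro g h ⟨u, v, hg⟩ ⟨u', v', hh⟩
    refine ⟨u * u' - v * v', u * v' + v * u', ?_⟩
    rw [Units.val_mul, hg, hh, Matrix.mul_fin_two]
    congr 1; ext i j; fin_cases i <;> fin_cases j <;> simp <;> ring
  inv_mem' := by
    rintro g ⟨u, v, hg⟩
    refine ⟨u / (u * u + v * v), -v / (u * u + v * v), ?_⟩
    rw [Matrix.coe_units_inv, hg, Matrix.inv_def, Matrix.det_fin_two, Matrix.adjugate_fin_two]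
    ext i j; fin_cases i <;> fin_cases j <;> simp [div_eq_inv_mul]

variable (E) in
/-- Two points of `B(E)` are equivalent if they lie in the same `CO(2)`-orbit. -/
def coSetoid : Setoid (FrameBundle E) where
  r χ χ' := ∃ g ∈ CO2, χ' = χ.act g
  iseqv :=
    { refl := fun χ => ⟨1, CO2.one_mem, χ.act_one.symm⟩
      symm := by
        rintro χ _ ⟨g, hg, rfl⟩
        exact ⟨g⁻¹, CO2.inv_mem hg, by rw [← FrameBundle.act_mul, mul_inv_cancel, χ.act_one]⟩
      trans := by
        rintro χ _ _ ⟨g, hg, rfl⟩ ⟨h, hh, rfl⟩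
        exact ⟨g * h, CO2.mul_mem hg hh, by rw [χ.act_mul]⟩ }

variable (E) in
/-- The quotient `B(E)/CO(2)`, with the quotient topology. -/
def COQuotient : Type _ := Quotient (coSetoid E)

instance : TopologicalSpace (COQuotient E) :=
  inferInstanceAs (TopologicalSpace (Quotient (coSetoid E)))

/-- The quotient map `B(E) → B(E)/CO(2)`. -/
def COQuotient.mk (χ : FrameBundle E) : COQuotient E := Quotient.mk (coSetoid E) χ

theorem COQuotient.isQuotientMap_mk : IsQuotientMap (COQuotient.mk (E := E)) :=
  isQuotientMap_quotient_mk'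


/-! ### The smooth structure of `B(E)/CO(2)`

Over a trivialization of `E` a basis `(a, b)` of `ℝ²` defines `z = a + i b ∈ ℂ²`; the group `CO(2)`
multiplies `z` by nonzero complex numbers, and the ratio `z₁ / z₀ ∈ ℂ \ ℝ` is a coordinate on
`GL(2)/CO(2)`. -/

/-- The bundle projection `B(E)/CO(2) → M`. -/
def COQuotient.proj : COQuotient E → M :=
  Quotient.lift (s := coSetoid E) (fun χ => χ.1.proj) (by rintro χ _ ⟨g, -, rfl⟩; rfl)

theorem COQuotient.continuous_proj : Continuous (COQuotient.proj (E := E)) :=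
  Continuous.quotient_lift
    ((FiberBundle.continuous_proj (Plane × Plane) (E ×ᵇ E)).comp continuous_subtype_val) _

/-- The ratio `z₁ / z₀` of the components of `z = a + i b`. -/
def frameSlope (a b : Plane) : ℂ := (a 1 + b 1 * Complex.I) / (a 0 + b 0 * Complex.I)

theorem frameSlope_den_ne {a b : Plane} (h : a 0 * b 1 - a 1 * b 0 ≠ 0) :
    (a 0 + b 0 * Complex.I : ℂ) ≠ 0 := by
  intro h0
  have h1 := congrArg Complex.re h0
  have h2 := congrArg Complex.im h0
  simp at h1 h2
  exact h (by rw [h1, h2]; ring)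

theorem contDiffAt_frameSlope {n : ℕ∞ω} {c : Plane × Plane} (h : c.1 0 * c.2 1 - c.1 1 * c.2 0 ≠ 0) :
    ContDiffAt ℝ n (fun c : Plane × Plane => frameSlope c.1 c.2) c := by
  have hr : ∀ i, ContDiff ℝ n (fun c : Plane × Plane => (c.1 i + c.2 i * Complex.I : ℂ)) := by
    intro i
    have h1 : ContDiff ℝ n (fun c : Plane × Plane => (c.1 i : ℂ)) :=
      Complex.ofRealCLM.contDiff.comp ((contDiff_apply ℝ ℝ i).comp contDiff_fst)
    have h2 : ContDiff ℝ n (fun c : Plane × Plane => (c.2 i : ℂ)) :=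
      Complex.ofRealCLM.contDiff.comp ((contDiff_apply ℝ ℝ i).comp contDiff_snd)
    exact h1.add (h2.mul contDiff_const)
  simp only [frameSlope, div_eq_mul_inv]
  exact (hr 1).contDiffAt.mul ((hr 0).contDiffAt.inv (frameSlope_den_ne h))

theorem frameSlope_im {a b : Plane} (h : a 0 * b 1 - a 1 * b 0 ≠ 0) : (frameSlope a b).im ≠ 0 := by
  have hd := frameSlope_den_ne h
  have hn : Complex.normSq (a 0 + b 0 * Complex.I : ℂ) ≠ 0 := by simpa using hd
  have : (frameSlope a b).im = (a 0 * b 1 - a 1 * b 0) / Complex.normSq (a 0 + b 0 * Complex.I : ℂ) := by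
    rw [frameSlope, Complex.div_im]
    simp
    ring
  rw [this]
  exact div_ne_zero h hn

theorem frameSlope_std (w : ℂ) : frameSlope ![1, w.re] ![0, w.im] = w := by
  simp [frameSlope, Complex.re_add_im]

theorem frameSlope_act (a b : Plane) {u v : ℝ} (h : u * u + v * v ≠ 0) :
    frameSlope (u • a + v • b) (-v • a + u • b) = frameSlope a b := by
  have hc : (u - v * Complex.I : ℂ) ≠ 0 := by
    intro h0
    have h1 := congrArg Complex.re h0
    have h2 := congrArg Complex.im h0
    simp at h1 h2
    exact h (by rw [h1, h2]; ring)
  have hm := mul_div_mul_left (a 1 + b 1 * Complex.I) (a 0 + b 0 * Complex.I : ℂ) hc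
  rw [frameSlope, frameSlope, ← hm]
  simp only [Pi.add_apply, Pi.smul_apply, smul_eq_mul, Complex.ofReal_add, Complex.ofReal_mul,
    Complex.ofReal_neg]
  congr 1
  · linear_combination ((v : ℂ) * (b 1)) * Complex.I_sq
  · linear_combination ((v : ℂ) * (b 0)) * Complex.I_sq

/-- If two pairs have the same frameSlope they differ by an element of `CO(2)`. -/
theorem exists_co_of_frameSlope {a b : Plane} (h : a 0 * b 1 - a 1 * b 0 ≠ 0) :
    ∃ u v : ℝ, u * u + v * v ≠ 0 ∧ ![1, (frameSlope a b).re] = u • a + v • b ∧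
      ![0, (frameSlope a b).im] = -v • a + u • b := by
  have hd := frameSlope_den_ne h
  set d : ℂ := a 0 + b 0 * Complex.I with hdd
  have hn : Complex.normSq d ≠ 0 := by simpa using hd
  have hnn : Complex.normSq d = a 0 * a 0 + b 0 * b 0 := by simp [hdd, Complex.normSq_apply]
  rw [hnn] at hn
  have hn2 : a 0 ^ 2 + b 0 ^ 2 ≠ 0 := by convert hn using 1; ring
  refine ⟨a 0 / (a 0 * a 0 + b 0 * b 0), b 0 / (a 0 * a 0 + b 0 * b 0), ?_, ?_, ?_⟩
  · have : a 0 / (a 0 * a 0 + b 0 * b 0) * (a 0 / (a 0 * a 0 + b 0 * b 0)) +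
      b 0 / (a 0 * a 0 + b 0 * b 0) * (b 0 / (a 0 * a 0 + b 0 * b 0)) =
        1 / (a 0 * a 0 + b 0 * b 0) := by field_simp
    rw [this]; positivity
  · have : (frameSlope a b).re = (a 1 * a 0 + b 1 * b 0) / (a 0 * a 0 + b 0 * b 0) := by
      rw [frameSlope, Complex.div_re, ← hdd, hnn]; simp [hdd]; ring
    ext i; fin_cases i
    · simp; field_simp
    · simp [this]; field_simp
  · have : (frameSlope a b).im = (b 1 * a 0 - a 1 * b 0) / (a 0 * a 0 + b 0 * b 0) := by
      rw [frameSlope, Complex.div_im, ← hdd, hnn]; simp [hdd]; ring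
    ext i; fin_cases i
    · simp; field_simp; ring
    · simp [this]; field_simp; ring

/-- The ratio `z₁ / z₀` of a class of bases, computed in the trivialization `e`. -/
def COQuotient.slopeAt (e : Trivialization Plane (π Plane E)) [e.IsLinear ℝ] :
    COQuotient E → ℂ :=
  Quotient.lift (s := coSetoid E) (fun χ => frameSlope (e.continuousLinearMapAt ℝ χ.1.proj χ.1.2.1)
    (e.continuousLinearMapAt ℝ χ.1.proj χ.1.2.2)) (by
      rintro χ _ ⟨g, ⟨u, v, hg⟩, rfl⟩
      have hdet := g.det_ne_zero
      rw [hg, Matrix.det_fin_two] at hdet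
      have h1 : (χ.act g).1.2.1 = u • χ.1.2.1 + v • χ.1.2.2 := by simp [FrameBundle.act, hg]
      have h2 : (χ.act g).1.2.2 = -v • χ.1.2.1 + u • χ.1.2.2 := by simp [FrameBundle.act, hg]
      symm
      change frameSlope (e.continuousLinearMapAt ℝ χ.1.proj (χ.act g).1.2.1)
        (e.continuousLinearMapAt ℝ χ.1.proj (χ.act g).1.2.2) = _
      rw [h1, h2, map_add, map_add, map_smul, map_smul, map_smul, map_smul, frameSlope_act]
      simpa using hdet)


theorem std_det {w : ℂ} (hw : w.im ≠ 0) :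
    (![1, w.re] : Plane) 0 * (![0, w.im] : Plane) 1 - (![1, w.re] : Plane) 1 * (![0, w.im] : Plane) 0
      ≠ 0 := by
  simpa using hw

/-- The basis `((1, Re w), (0, Im w))`, in the trivialization `e`, whose ratio is `w`. -/
def stdFrame (e : Trivialization Plane (π Plane E)) [e.IsLinear ℝ] (p : M) (hp : p ∈ e.baseSet)
    (w : ℂ) (hw : w.im ≠ 0) : FrameBundle E :=
  ⟨⟨p, (e.symmL ℝ p ![1, w.re], e.symmL ℝ p ![0, w.im])⟩, by
    change LinearIndependent ℝ ![_, _]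
    rw [← linearIndependent_triv_iff E e hp, e.continuousLinearMapAt_symmL hp,
      e.continuousLinearMapAt_symmL hp, linearIndependent_iff_det]
    exact std_det hw⟩

theorem slopeAt_stdFrame (e : Trivialization Plane (π Plane E)) [e.IsLinear ℝ] (p : M)
    (hp : p ∈ e.baseSet) (w : ℂ) (hw : w.im ≠ 0) :
    COQuotient.slopeAt e (COQuotient.mk (stdFrame e p hp w hw)) = w := by
  change frameSlope (e.continuousLinearMapAt ℝ p (e.symmL ℝ p ![1, w.re]))
    (e.continuousLinearMapAt ℝ p (e.symmL ℝ p ![0, w.im])) = w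
  rw [e.continuousLinearMapAt_symmL hp, e.continuousLinearMapAt_symmL hp, frameSlope_std]

theorem FrameBundle.det_ne (e : Trivialization Plane (π Plane E)) [e.IsLinear ℝ]
    (χ : FrameBundle E) (hp : χ.1.proj ∈ e.baseSet) :
    e.continuousLinearMapAt ℝ χ.1.proj χ.1.2.1 0 * e.continuousLinearMapAt ℝ χ.1.proj χ.1.2.2 1 -
      e.continuousLinearMapAt ℝ χ.1.proj χ.1.2.1 1 * e.continuousLinearMapAt ℝ χ.1.proj χ.1.2.2 0
      ≠ 0 := by
  rw [← linearIndependent_iff_det, linearIndependent_triv_iff E e hp]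
  exact χ.2

theorem slopeAt_im_ne (e : Trivialization Plane (π Plane E)) [e.IsLinear ℝ] (q : COQuotient E)
    (hp : q.proj ∈ e.baseSet) : (COQuotient.slopeAt e q).im ≠ 0 := by
  induction q using Quotient.inductionOn with
  | h χ => exact frameSlope_im (FrameBundle.det_ne e χ hp)

theorem mk_stdFrame_slopeAt (e : Trivialization Plane (π Plane E)) [e.IsLinear ℝ]
    (q : COQuotient E) (hp : q.proj ∈ e.baseSet) (hw : (COQuotient.slopeAt e q).im ≠ 0) :
    COQuotient.mk (stdFrame e q.proj hp (COQuotient.slopeAt e q) hw) = q := by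
  induction q using Quotient.inductionOn with
  | h χ =>
    have hq : χ.1.proj ∈ e.baseSet := hp
    obtain ⟨u, v, hu, h1, h2⟩ := exists_co_of_frameSlope (FrameBundle.det_ne e χ hp)
    symm
    refine Quotient.sound (s := coSetoid E) ⟨Matrix.GeneralLinearGroup.mkOfDetNeZero
      !![u, -v; v, u] (by simpa [Matrix.det_fin_two] using hu), ⟨u, v, rfl⟩, ?_⟩
    refine Subtype.ext ?_
    change (⟨χ.1.proj, (e.symmL ℝ χ.1.proj ![1, (frameSlope _ _).re],
      e.symmL ℝ χ.1.proj ![0, (frameSlope _ _).im])⟩ : TotalSpace (Plane × Plane) (E ×ᵇ E)) =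
        ⟨χ.1.proj, (u • χ.1.2.1 + v • χ.1.2.2, -v • χ.1.2.1 + u • χ.1.2.2)⟩
    congr 1
    refine Prod.ext ?_ ?_
    · dsimp only
      rw [h1, map_add, map_smul, map_smul, e.symmL_continuousLinearMapAt hq,
        e.symmL_continuousLinearMapAt hq]
    · dsimp only
      rw [h2, map_add, map_smul, map_smul, e.symmL_continuousLinearMapAt hq,
        e.symmL_continuousLinearMapAt hq]

/-- The chart of `B(E)/CO(2)` with values in `M × ℂ` defined by a trivialization of `E`: the base
point and the ratio. -/
def COQuotient.preChart (e : Trivialization Plane (π Plane E)) [e.IsLinear ℝ]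
    (q₀ : COQuotient E) : OpenPartialHomeomorph (COQuotient E) (M × ℂ) where
  toFun q := (q.proj, q.slopeAt e)
  invFun z := by
    classical
    exact if h : z.1 ∈ e.baseSet ∧ z.2.im ≠ 0 then COQuotient.mk (stdFrame e z.1 h.1 z.2 h.2)
      else q₀
  source := COQuotient.proj ⁻¹' e.baseSet
  target := {z | z.1 ∈ e.baseSet ∧ z.2.im ≠ 0}
  map_source' q hq := ⟨hq, slopeAt_im_ne e q hq⟩
  map_target' z hz := by
    have hz' : z.1 ∈ e.baseSet ∧ z.2.im ≠ 0 := hz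
    rw [dif_pos hz']
    exact hz'.1
  left_inv' q hq := by
    rw [dif_pos ⟨hq, slopeAt_im_ne e q hq⟩]
    exact mk_stdFrame_slopeAt e q hq _
  right_inv' z hz := by
    have hz' : z.1 ∈ e.baseSet ∧ z.2.im ≠ 0 := hz
    rw [dif_pos hz', slopeAt_stdFrame]
    rfl
  open_source := e.open_baseSet.preimage COQuotient.continuous_proj
  open_target := (e.open_baseSet.preimage continuous_fst).inter
    (isOpen_ne.preimage (Complex.continuous_im.comp continuous_snd))
  continuousOn_toFun := by
    refine COQuotient.continuous_proj.continuousOn.prodMk ?_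
    rw [COQuotient.isQuotientMap_mk.continuousOn_isOpen_iff
      (e.open_baseSet.preimage COQuotient.continuous_proj)]
    have hT : ContinuousOn (fun χ : FrameBundle E => ((e.prod e) χ.1).2)
        {χ : FrameBundle E | χ.1.proj ∈ e.baseSet} :=
      continuous_snd.comp_continuousOn ((e.prod e).continuousOn.comp
        continuous_subtype_val.continuousOn fun χ hχ => by
          rw [(e.prod e).mem_source]; exact ⟨hχ, hχ⟩)
    intro χ hχ
    have hd := FrameBundle.det_ne e χ hχ
    have hev : ∀ χ : FrameBundle E, χ.1.proj ∈ e.baseSet →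
        (e.continuousLinearMapAt ℝ χ.1.proj χ.1.2.1, e.continuousLinearMapAt ℝ χ.1.proj χ.1.2.2) =
          ((e.prod e) χ.1).2 := fun χ hχ => by
      simp only [Trivialization.continuousLinearMapAt_apply,
        Trivialization.coe_linearMapAt_of_mem (R := ℝ) e hχ]
      rfl
    have hs : ContinuousAt (fun c : Plane × Plane => frameSlope c.1 c.2) ((e.prod e) χ.1).2 := by
      rw [← hev χ hχ]
      exact (contDiffAt_frameSlope (n := 0) hd).continuousAt
    refine (ContinuousAt.comp_continuousWithinAt (f := fun χ : FrameBundle E => ((e.prod e) χ.1).2)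
      hs (hT χ hχ)).congr (fun χ hχ => ?_) ?_
    · change frameSlope (e.continuousLinearMapAt ℝ χ.1.proj χ.1.2.1)
        (e.continuousLinearMapAt ℝ χ.1.proj χ.1.2.2) = _
      rw [Function.comp_apply, ← hev χ hχ]
    · change frameSlope (e.continuousLinearMapAt ℝ χ.1.proj χ.1.2.1)
        (e.continuousLinearMapAt ℝ χ.1.proj χ.1.2.2) = _
      rw [Function.comp_apply, ← hev χ hχ]
  continuousOn_invFun := by
    have hc : ContinuousOn (fun z : M × ℂ => (e.prod e).toOpenPartialHomeomorph.symm
        (z.1, (![1, z.2.re], ![0, z.2.im]))) {z | z.1 ∈ e.baseSet ∧ z.2.im ≠ 0} := by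
      refine (e.prod e).toOpenPartialHomeomorph.symm.continuousOn.comp ?_ fun z hz => ?_
      · have h1 : Continuous fun z : M × ℂ => (![1, z.2.re] : Plane) := by
          refine continuous_pi fun i => ?_
          fin_cases i
          · exact continuous_const
          · exact Complex.continuous_re.comp continuous_snd
        have h2 : Continuous fun z : M × ℂ => (![0, z.2.im] : Plane) := by
          refine continuous_pi fun i => ?_
          fin_cases i
          · exact continuous_const
          · exact Complex.continuous_im.comp continuous_snd
        exact (continuous_fst.prodMk (h1.prodMk h2)).continuousOn
      · refine (e.prod e).mem_target.2 ?_
        exact ⟨hz.1, hz.1⟩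
    rw [continuousOn_iff_continuous_domRestrict] at hc ⊢
    have hm : ∀ z : {z : M × ℂ | z.1 ∈ e.baseSet ∧ z.2.im ≠ 0},
        (e.prod e).toOpenPartialHomeomorph.symm (z.1.1, (![1, z.1.2.re], ![0, z.1.2.im])) =
          (stdFrame e z.1.1 z.2.1 z.1.2 z.2.2).1 := fun z => by
      change _ = (⟨z.1.1, (e.symmL ℝ z.1.1 ![1, z.1.2.re], e.symmL ℝ z.1.1 ![0, z.1.2.im])⟩ :
        TotalSpace (Plane × Plane) (E ×ᵇ E))
      rw [Trivialization.symmL_apply (R := ℝ) e z.2.1, Trivialization.symmL_apply (R := ℝ) e z.2.1]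
      rfl
    have hc' : Continuous fun z : {z : M × ℂ | z.1 ∈ e.baseSet ∧ z.2.im ≠ 0} =>
        stdFrame e z.1.1 z.2.1 z.1.2 z.2.2 :=
      continuous_induced_rng.2 (hc.congr hm)
    refine (COQuotient.isQuotientMap_mk.continuous.comp hc').congr fun z => ?_
    have hz : z.1.1 ∈ e.baseSet ∧ z.1.2.im ≠ 0 := z.2
    simp [Set.domRestrict, hz]


/-- The charts of `B(E)/CO(2)` with values in `M × ℂ`. -/
instance COQuotient.chartedSpace' : ChartedSpace (M × ℂ) (COQuotient E) where
  atlas := range fun q : COQuotient E => q.preChart (trivializationAt Plane E q.proj)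
  chartAt q := q.preChart (trivializationAt Plane E q.proj)
  mem_chart_source q := mem_baseSet_trivializationAt Plane E q.proj
  chart_mem_atlas q := mem_range_self q

/-- The charts above, composed with charts of `M`. -/
instance COQuotient.chartedSpace : ChartedSpace (ModelProd H ℂ) (COQuotient E) :=
  ChartedSpace.comp _ (M × ℂ) _

end FrameBundle

section Smooth

variable {H M V : Type*} [TopologicalSpace H] [NormedAddCommGroup V] [NormedSpace ℝ V]
  (I : ModelWithCorners ℝ V H) [TopologicalSpace M] [ChartedSpace H M]

/-- The smooth local self-maps of a manifold. -/
def smoothPregroupoid : Pregroupoid M where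
  property f s := ContMDiffOn I I ∞ f s
  comp hf hg _ _ _ := hg.comp (hf.mono inter_subset_left) inter_subset_right
  id_mem := contMDiffOn_id
  locality hu h := fun x hx => by
    obtain ⟨v, hv, hxv, h⟩ := h x hx
    exact ((h x ⟨hx, hxv⟩).contMDiffAt ((hu.inter hv).mem_nhds ⟨hx, hxv⟩)).contMDiffWithinAt
  congr _ h hf := hf.congr h

variable (E : M → Type*) [∀ p, AddCommGroup (E p)] [∀ p, Module ℝ (E p)]
  [TopologicalSpace (TotalSpace Plane E)] [∀ p, TopologicalSpace (E p)]
  [FiberBundle Plane E] [VectorBundle ℝ Plane E] [ContMDiffVectorBundle ∞ Plane E I]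

variable {E}

theorem contMDiffOn_preChart_symm_trans (e e' : Trivialization Plane (π Plane E))
    [MemTrivializationAtlas e] [MemTrivializationAtlas e'] (q q' : COQuotient E) :
    ContMDiffOn (I.prod 𝓘(ℝ, ℂ)) (I.prod 𝓘(ℝ, ℂ)) ∞
      ((q.preChart e).symm ≫ₕ q'.preChart e') ((q.preChart e).symm ≫ₕ q'.preChart e').source := by
  have hmem : ∀ z ∈ ((q.preChart e).symm ≫ₕ q'.preChart e').source,
      z.1 ∈ e.baseSet ∧ z.1 ∈ e'.baseSet ∧ z.2.im ≠ 0 := by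
    intro z hz
    rw [OpenPartialHomeomorph.trans_source, OpenPartialHomeomorph.symm_source] at hz
    have h1 : z.1 ∈ e.baseSet ∧ z.2.im ≠ 0 := hz.1
    have h2 : ((q.preChart e).symm z).proj ∈ e'.baseSet := hz.2
    have h3 : ((q.preChart e).symm z).proj = z.1 :=
      congrArg Prod.fst ((q.preChart e).right_inv hz.1)
    exact ⟨h1.1, h3 ▸ h2, h1.2⟩
  have heq : ∀ z ∈ ((q.preChart e).symm ≫ₕ q'.preChart e').source,
      ((q.preChart e).symm ≫ₕ q'.preChart e') z =
        (z.1, frameSlope (e.coordChangeL ℝ e' z.1 ![1, z.2.re]) (e.coordChangeL ℝ e' z.1 ![0, z.2.im])) := by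
    intro z hz
    obtain ⟨h1, h2, h3⟩ := hmem z hz
    have hs : (q.preChart e).symm z = COQuotient.mk (stdFrame e z.1 h1 z.2 h3) := dif_pos ⟨h1, h3⟩
    rw [OpenPartialHomeomorph.coe_trans, Function.comp_apply, hs]
    change (z.1, frameSlope (e'.continuousLinearMapAt ℝ z.1 (e.symmL ℝ z.1 _))
      (e'.continuousLinearMapAt ℝ z.1 (e.symmL ℝ z.1 _))) = _
    rw [e.coordChangeL_apply e' ⟨h1, h2⟩, e.coordChangeL_apply e' ⟨h1, h2⟩,
      Trivialization.symmL_apply (R := ℝ) e h1, Trivialization.symmL_apply (R := ℝ) e h1, Trivialization.continuousLinearMapAt_apply,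
      Trivialization.coe_linearMapAt_of_mem (R := ℝ) e' h2]
  refine ContMDiffOn.congr ?_ heq
  refine contMDiffOn_fst.prodMk fun z hz => ?_
  obtain ⟨h1, h2, h3⟩ := hmem z hz
  have hg : ContMDiffAt (I.prod 𝓘(ℝ, ℂ)) 𝓘(ℝ, Plane →L[ℝ] Plane) ∞
      (fun z : M × ℂ => (e.coordChangeL ℝ e' z.1 : Plane →L[ℝ] Plane)) z :=
    contMDiffAt_fst.coordChangeL h1 h2
  have hre : ContMDiffAt (I.prod 𝓘(ℝ, ℂ)) 𝓘(ℝ, Plane) ∞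
      (fun z : M × ℂ => (![1, z.2.re] : Plane)) z := by
    have : ContDiff ℝ ∞ (fun w : ℂ => (![1, w.re] : Plane)) := by
      refine contDiff_pi.2 fun i => ?_
      fin_cases i
      · exact contDiff_const
      · exact Complex.reCLM.contDiff
    exact this.contMDiff.contMDiffAt.comp z contMDiffAt_snd
  have him : ContMDiffAt (I.prod 𝓘(ℝ, ℂ)) 𝓘(ℝ, Plane) ∞
      (fun z : M × ℂ => (![0, z.2.im] : Plane)) z := by
    have : ContDiff ℝ ∞ (fun w : ℂ => (![0, w.im] : Plane)) := by
      refine contDiff_pi.2 fun i => ?_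
      fin_cases i
      · exact contDiff_const
      · exact Complex.imCLM.contDiff
    exact this.contMDiff.contMDiffAt.comp z contMDiffAt_snd
  have hp := (hg.clm_apply hre).prodMk_space (hg.clm_apply him)
  have hdet : (e.coordChangeL ℝ e' z.1 ![1, z.2.re]) 0 * (e.coordChangeL ℝ e' z.1 ![0, z.2.im]) 1 -
      (e.coordChangeL ℝ e' z.1 ![1, z.2.re]) 1 * (e.coordChangeL ℝ e' z.1 ![0, z.2.im]) 0 ≠ 0 := by
    have := FrameBundle.det_ne e' (stdFrame e z.1 h1 z.2 h3) h2
    change (e'.continuousLinearMapAt ℝ z.1 (e.symmL ℝ z.1 _)) 0 *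
      (e'.continuousLinearMapAt ℝ z.1 (e.symmL ℝ z.1 _)) 1 -
      (e'.continuousLinearMapAt ℝ z.1 (e.symmL ℝ z.1 _)) 1 *
      (e'.continuousLinearMapAt ℝ z.1 (e.symmL ℝ z.1 _)) 0 ≠ 0 at this
    simpa only [e.coordChangeL_apply e' ⟨h1, h2⟩, Trivialization.symmL_apply (R := ℝ) e h1,
      Trivialization.continuousLinearMapAt_apply,
      Trivialization.coe_linearMapAt_of_mem (R := ℝ) e' h2] using this
  have hs : ContDiffAt ℝ ∞ (fun c : Plane × Plane => frameSlope c.1 c.2)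
      (e.coordChangeL ℝ e' z.1 ![1, z.2.re], e.coordChangeL ℝ e' z.1 ![0, z.2.im]) :=
    contDiffAt_frameSlope hdet
  exact (hs.contMDiffAt.comp z hp).contMDiffWithinAt

variable [IsManifold I ∞ M]

/-- `B(E)/CO(2)` is a smooth manifold. -/
instance COQuotient.isManifold : IsManifold (I.prod 𝓘(ℝ, ℂ)) ∞ (COQuotient E) := by
  have hG : HasGroupoid (COQuotient E) (smoothPregroupoid (M := M × ℂ) (I.prod 𝓘(ℝ, ℂ))).groupoid := by
    refine hasGroupoid_of_pregroupoid _ ?_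
    rintro _ _ ⟨q, rfl⟩ ⟨q', rfl⟩
    exact contMDiffOn_preChart_symm_trans I _ _ q q'
  refine { StructureGroupoid.HasGroupoid.comp
    (smoothPregroupoid (M := M × ℂ) (I.prod 𝓘(ℝ, ℂ))).groupoid ?_ with }
  intro f hf
  rw [isLocalStructomorphOn_contDiffGroupoid_iff]
  exact mem_groupoid_of_pregroupoid.1 hf

instance : IsManifold (I.prod 𝓘(ℝ, Plane × Plane)) ∞ (FrameBundle E) := inferInstance

/-- The quotient map `B(E) → B(E)/CO(2)` is smooth. -/
theorem COQuotient.contMDiff_mk :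
    ContMDiff (I.prod 𝓘(ℝ, Plane × Plane)) (I.prod 𝓘(ℝ, ℂ)) ∞ (COQuotient.mk (E := E)) := by
  intro χ
  rw [contMDiffAt_iff_target]
  refine ⟨COQuotient.isQuotientMap_mk.continuous.continuousAt, ?_⟩
  let e := trivializationAt Plane E χ.1.proj
  have hχ : χ.1.proj ∈ e.baseSet := mem_baseSet_trivializationAt Plane E χ.1.proj
  have hval : ContMDiffAt (I.prod 𝓘(ℝ, Plane × Plane)) (I.prod 𝓘(ℝ, Plane × Plane)) ∞
      (fun χ : FrameBundle E => χ.1) χ := contMDiff_subtype_val.contMDiffAt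
  have hproj : ContMDiffAt (I.prod 𝓘(ℝ, Plane × Plane)) I ∞
      (fun χ : FrameBundle E => χ.1.proj) χ := (Bundle.contMDiffAt_totalSpace.1 hval).1
  have hT : ContMDiffAt (I.prod 𝓘(ℝ, Plane × Plane)) 𝓘(ℝ, Plane × Plane) ∞
      (fun χ : FrameBundle E => ((e.prod e) χ.1).2) χ := (Bundle.contMDiffAt_totalSpace.1 hval).2
  have hev : ∀ χ : FrameBundle E, χ.1.proj ∈ e.baseSet →
      (e.continuousLinearMapAt ℝ χ.1.proj χ.1.2.1, e.continuousLinearMapAt ℝ χ.1.proj χ.1.2.2) =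
        ((e.prod e) χ.1).2 := fun χ hχ => by
    simp only [Trivialization.continuousLinearMapAt_apply,
      Trivialization.coe_linearMapAt_of_mem (R := ℝ) e hχ]
    rfl
  have hs : ContDiffAt ℝ ∞ (fun c : Plane × Plane => frameSlope c.1 c.2) ((e.prod e) χ.1).2 := by
    rw [← hev χ hχ]
    exact contDiffAt_frameSlope (FrameBundle.det_ne e χ hχ)
  have h1 : ContMDiffAt (I.prod 𝓘(ℝ, Plane × Plane)) 𝓘(ℝ, V) ∞
      (fun χ' : FrameBundle E => extChartAt I χ.1.proj χ'.1.proj) χ :=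
    ContMDiffAt.comp χ contMDiffAt_extChartAt hproj
  have h2 : ContMDiffAt (I.prod 𝓘(ℝ, Plane × Plane)) 𝓘(ℝ, ℂ) ∞
      (fun χ' : FrameBundle E => frameSlope ((e.prod e) χ'.1).2.1 ((e.prod e) χ'.1).2.2) χ :=
    ContMDiffAt.comp (f := fun χ' : FrameBundle E => ((e.prod e) χ'.1).2) χ hs.contMDiffAt hT
  refine (h1.prodMk_space h2).congr_of_eventuallyEq ?_
  have hn : ∀ᶠ χ' : FrameBundle E in 𝓝 χ, χ'.1.proj ∈ e.baseSet :=
    hproj.continuousAt (e.open_baseSet.mem_nhds hχ)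
  filter_upwards [hn] with χ' hχ'
  rw [← hev χ' hχ']
  rfl

end Smooth


section Forms

variable {V H N : Type*} [NormedAddCommGroup V] [NormedSpace ℝ V] [TopologicalSpace H]
  (I : ModelWithCorners ℝ V H) [TopologicalSpace N] [ChartedSpace H N]

/-- The exterior derivative `dα_x(v, w)` of a real `1`-form `α`, computed in the chart at `x`, with
the normalization `dα(X, Y) = X(α(Y)) - Y(α(X)) - α([X, Y])`. -/
def extDerivOne (α : Π x : N, TangentSpace I x →L[ℝ] ℝ) (x : N) (v w : TangentSpace I x) : ℝ :=
  extDerivWithin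
    (fun y : V => ContinuousAlternatingMap.ofSubsingleton ℝ V ℝ (0 : Fin 1)
      ((α ((extChartAt I x).symm y)).comp
        (mfderivWithin 𝓘(ℝ, V) I (extChartAt I x).symm (range I) y)))
    (range I) (extChartAt I x x)
    ![mfderiv I 𝓘(ℝ, V) (extChartAt I x) x v, mfderiv I 𝓘(ℝ, V) (extChartAt I x) x w]

/-- Smoothness of a real `1`-form, as a section of the cotangent bundle. -/
def IsSmoothForm [IsManifold I ∞ N] (α : Π x : N, TangentSpace I x →L[ℝ] ℝ) : Prop :=
  ContMDiff I (I.prod 𝓘(ℝ, V →L[ℝ] ℝ)) ∞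
    (fun x => TotalSpace.mk' (V →L[ℝ] ℝ) (E := fun x : N => TangentSpace I x →L[ℝ] ℝ) x (α x))

/-- A (smooth) almost-complex structure on a manifold. -/
structure AlmostComplexStructure (N : Type*) [TopologicalSpace N] [ChartedSpace H N]
    [IsManifold I ∞ N] where
  toFun : Π x : N, TangentSpace I x →L[ℝ] TangentSpace I x
  smooth : ContMDiff I (I.prod 𝓘(ℝ, V →L[ℝ] V)) ∞
    (fun x => TotalSpace.mk' (V →L[ℝ] V)
      (E := fun x : N => TangentSpace I x →L[ℝ] TangentSpace I x) x (toFun x))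
  sq : ∀ (x : N) (v : TangentSpace I x), toFun x (toFun x v) = -v

variable {I}

/-- The Nijenhuis bracket `[JX, JY] - J[JX, Y] - J[X, JY] - [X, Y]` at `x`. -/
def AlmostComplexStructure.nijenhuis [IsManifold I ∞ N] (J : AlmostComplexStructure I N)
    (X Y : Π x : N, TangentSpace I x) (x : N) : TangentSpace I x :=
  VectorField.mlieBracket I (fun y => J.toFun y (X y)) (fun y => J.toFun y (Y y)) x
    - J.toFun x (VectorField.mlieBracket I (fun y => J.toFun y (X y)) Y x)
    - J.toFun x (VectorField.mlieBracket I X (fun y => J.toFun y (Y y)) x)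
    - VectorField.mlieBracket I X Y x

/-- Integrability of an almost-complex structure: its Nijenhuis tensor vanishes. The vector fields
only need to be smooth near the point at which the tensor is evaluated. -/
def AlmostComplexStructure.IsIntegrable [IsManifold I ∞ N] (J : AlmostComplexStructure I N) :
    Prop :=
  ∀ (x : N) (X Y : Π x : N, TangentSpace I x),
    ContMDiffAt I I.tangent ∞ (fun y => (⟨y, X y⟩ : TangentBundle I N)) x →
    ContMDiffAt I I.tangent ∞ (fun y => (⟨y, Y y⟩ : TangentBundle I N)) x →
    J.nijenhuis X Y x = 0

end Forms

section Linear

open MvPolynomial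

/-- The polynomial `W_i^even`, the real part of `(x + i y)^i`; `X 0` and `X 1` stand for `x`, `y`. -/
def Weven (i : ℕ) : MvPolynomial (Fin 2) ℝ :=
  ∑ s ∈ Finset.range (i / 2 + 1),
    C ((-1 : ℝ) ^ s * (i.choose (2 * s) : ℝ)) * X 0 ^ (i - 2 * s) * X 1 ^ (2 * s)

/-- The polynomial `W_i^odd`, the imaginary part of `(x + i y)^i`. -/
def Wodd (i : ℕ) : MvPolynomial (Fin 2) ℝ :=
  ∑ s ∈ Finset.range ((i + 1) / 2),
    C ((-1 : ℝ) ^ s * (i.choose (2 * s + 1) : ℝ)) * X 0 ^ (i - 2 * s - 1) * X 1 ^ (2 * s + 1)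

/-- `V_{k,j}^even = (x² + y²)^j W_{k-2j}^even`. -/
def Veven (k j : ℕ) : MvPolynomial (Fin 2) ℝ := (X 0 ^ 2 + X 1 ^ 2) ^ j * Weven (k - 2 * j)

/-- `V_{k,j}^odd = (x² + y²)^j W_{k-2j}^odd`. -/
def Vodd (k j : ℕ) : MvPolynomial (Fin 2) ℝ := (X 0 ^ 2 + X 1 ^ 2) ^ j * Wodd (k - 2 * j)

/-- The space of homogeneous polynomials of degree `k` in `x, y`, in the basis
`(x^k, x^(k-1) y, …, y^k)`. -/
abbrev Poly (k : ℕ) : Type := Fin (k + 1) → ℝ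

/-- The coefficients of a homogeneous polynomial at `x^(k-i) y^i`, `i = 0, …, k`. -/
def monomialCoords (k : ℕ) (P : MvPolynomial (Fin 2) ℝ) : Poly k :=
  fun i => P.coeff (Finsupp.single 0 (k - (i : ℕ)) + Finsupp.single 1 (i : ℕ))

/-- The index set `j = 0, …, ⌊k/2⌋`. -/
abbrev Idx (k : ℕ) : Type := Fin (k / 2 + 1)

/-- The map `c ↦ ∑ j, Re(c_j) V_{k,j}^even + Im(c_j) V_{k,j}^odd`. For odd `k` it is a linear
isomorphism, because the `V_{k,j}^even`, `V_{k,j}^odd` form a basis. -/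
def realCombination (k : ℕ) : (Idx k → ℂ) →L[ℝ] Poly k :=
  ∑ j : Idx k,
    ((Complex.reCLM.comp (ContinuousLinearMap.proj j)).smulRight (monomialCoords k (Veven k j)) +
      (Complex.imCLM.comp (ContinuousLinearMap.proj j)).smulRight (monomialCoords k (Vodd k j)))

/-- The inverse of `realCombination`, for odd `k`. Its component `j` is
`ξ^{k,j} = ξ^{k,j}_even + i ξ^{k,j}_odd`, where `(ξ^{k,j}_even, ξ^{k,j}_odd)_j` is the basis dual to
`(V_{k,j}^even, V_{k,j}^odd)_j`. -/
def xiMap (k : ℕ) : Poly k →L[ℝ] (Idx k → ℂ) := (realCombination k).inverse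

/-- The representation of `gl(2)` on homogeneous polynomials of degree `k`, in the monomial basis:
the derivative of `P(x, y) ↦ P((x, y) g)`. The matrix `A` is
`!![φ^1_1, φ^2_1; φ^1_2, φ^2_2]`. -/
def rep (k : ℕ) (A : Matrix (Fin 2) (Fin 2) ℝ) : Matrix (Fin (k + 1)) (Fin (k + 1)) ℝ :=
  Matrix.of fun i j =>
    if i = j then ((k : ℝ) - (j : ℕ)) * A 0 0 + ((j : ℕ) : ℝ) * A 1 1
    else if (i : ℕ) = j + 1 then ((k : ℝ) - (j : ℕ)) * A 1 0
    else if (i : ℕ) + 1 = j then ((j : ℕ) : ℝ) * A 0 1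
    else 0

/-- `A ↦ (φ^1_2 + φ^2_1) + i (φ^2_2 - φ^1_1)` for `A = !![φ^1_1, φ^2_1; φ^1_2, φ^2_2]`. -/
def zetaMap (A : Matrix (Fin 2) (Fin 2) ℝ) : ℂ :=
  ((A 1 0 + A 0 1 : ℝ) : ℂ) + ((A 1 1 - A 0 0 : ℝ) : ℂ) * Complex.I

end Linear

section Structure

open scoped TensorProduct

variable {k : ℕ} {M : Type*} [TopologicalSpace M] [ChartedSpace (EuclideanSpace ℝ (Fin (k + 1))) M]
  [IsManifold (𝓡 (k + 1)) ∞ M]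
  (E : M → Type*) [∀ p, AddCommGroup (E p)] [∀ p, Module ℝ (E p)]
  [TopologicalSpace (TotalSpace Plane E)] [∀ p, TopologicalSpace (E p)]
  [FiberBundle Plane E] [VectorBundle ℝ Plane E]

/-- The model with corners of `B(E)`. -/
abbrev frameModel (k : ℕ) := (𝓡 (k + 1)).prod 𝓘(ℝ, Plane × Plane)

/-- The model with corners of `B(E)/CO(2)`. -/
abbrev quotientModel (k : ℕ) := (𝓡 (k + 1)).prod 𝓘(ℝ, ℂ)

variable (k) in
/-- A `GL(2)`-structure on `M`: an isomorphism of smooth vector bundles `S^k(E) ≃ TM`. It is smooth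
if it sends symmetric products of smooth local sections of `E` to smooth vector fields. -/
structure GL2Structure where
  iso : ∀ p : M, Sym[ℝ]^k (E p) ≃ₗ[ℝ] TangentSpace (𝓡 (k + 1)) p
  smooth : ∀ (p : M) (s : Fin k → Π q : M, E q),
    (∀ i, ContMDiffAt (𝓡 (k + 1)) ((𝓡 (k + 1)).prod 𝓘(ℝ, Plane)) ∞
      (fun q => TotalSpace.mk' Plane q (s i q)) p) →
    ContMDiffAt (𝓡 (k + 1)) (𝓡 (k + 1)).tangent ∞
      (fun q => (⟨q, iso q (SymmetricPower.tprod ℝ fun i => s i q)⟩ :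
        TangentBundle (𝓡 (k + 1)) M)) p

variable {E}

namespace GL2Structure

variable (S : GL2Structure k E)

/-- The vector of `T_p M` corresponding to `x^(k-i) y^i`, where `χ = (p, (x, y))`. -/
def frameVector (χ : FrameBundle E) (i : Fin (k + 1)) : TangentSpace (𝓡 (k + 1)) χ.1.proj :=
  S.iso χ.1.proj (SymmetricPower.tprod ℝ fun a : Fin k =>
    if (a : ℕ) < k - i then χ.1.2.1 else χ.1.2.2)

/-- The linear isomorphism `c ↦ ∑ i, c_i x^(k-i) y^i` given by the frame `χ` (it is an isomorphism
since the monomials form a basis of `S^k(E p)`). -/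
def frameMap (χ : FrameBundle E) : Poly k →L[ℝ] TangentSpace (𝓡 (k + 1)) χ.1.proj :=
  ∑ i, (ContinuousLinearMap.proj (R := ℝ) (φ := fun _ : Fin (k + 1) => ℝ) i).smulRight
    (S.frameVector χ i)

/-- The soldering form `ω` on `B(E)`: the coordinates, in the frame `χ`, of the projection to `M`. -/
def solder (χ : FrameBundle E) : TangentSpace (frameModel k) χ →L[ℝ] Poly k :=
  (S.frameMap χ).inverse.comp
    (mfderiv (frameModel k) (𝓡 (k + 1)) (fun χ : FrameBundle E => χ.1.proj) χ)

/-- The component `ω^i` of the soldering form. -/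
def solderForm (i : Fin (k + 1)) (χ : FrameBundle E) : TangentSpace (frameModel k) χ →L[ℝ] ℝ :=
  (ContinuousLinearMap.proj i).comp (S.solder χ)

/-- The complex-valued `1`-form `ξ^{k,j}` on `B(E)`. -/
def xi (χ : FrameBundle E) (v : TangentSpace (frameModel k) χ) (j : Idx k) : ℂ :=
  xiMap k (S.solder χ v) j

end GL2Structure

/-- The exponential of a matrix, as an element of `GL(2)`. -/
def expGL (A : Matrix (Fin 2) (Fin 2) ℝ) : GL (Fin 2) ℝ := (Matrix.isUnit_exp A).unit

variable (k E) in
/-- A `GL(2)`-connection form on `B(E)`: a smooth `gl(2)`-valued `1`-form `φ` (the entries of the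
matrix `!![φ^1_1, φ^2_1; φ^1_2, φ^2_2]` are `form 0 0`, `form 0 1`, `form 1 0`, `form 1 1`) with
`R_g^* φ = g⁻¹ φ g` that takes the value `A` on the fundamental vector field
`d/dt χ · exp(t A)` at `t = 0`. -/
structure GL2Connection [ContMDiffVectorBundle ∞ Plane E (𝓡 (k + 1))] where
  form : Fin 2 → Fin 2 → Π χ : FrameBundle E, TangentSpace (frameModel k) χ →L[ℝ] ℝ
  smooth : ∀ i j, IsSmoothForm (frameModel k) (form i j)
  equivariant : ∀ (g : GL (Fin 2) ℝ) (χ : FrameBundle E) (v : TangentSpace (frameModel k) χ),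
    Matrix.of (fun i j => form i j (χ.act g)
      (mfderiv (frameModel k) (frameModel k) (fun χ : FrameBundle E => χ.act g) χ v)) =
    (g⁻¹ : GL (Fin 2) ℝ).1 * Matrix.of (fun i j => form i j χ v) * g.1
  vertical : ∀ (A : Matrix (Fin 2) (Fin 2) ℝ) (χ : FrameBundle E),
    Matrix.of (fun i j => form i j (χ.act (expGL ((0 : ℝ) • A)))
      (mfderiv 𝓘(ℝ, ℝ) (frameModel k) (fun t : ℝ => χ.act (expGL (t • A))) (0 : ℝ) (1 : ℝ))) = A

namespace GL2Connection

variable [ContMDiffVectorBundle ∞ Plane E (𝓡 (k + 1))]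
variable (S : GL2Structure k E) (φ : GL2Connection k E)

/-- The value of the connection form as a matrix. -/
def val (χ : FrameBundle E) (v : TangentSpace (frameModel k) χ) : Matrix (Fin 2) (Fin 2) ℝ :=
  Matrix.of fun i j => φ.form i j χ v

/-- The torsion `Θ = dω + Φ ∧ ω`, where `Φ = rep k φ`. -/
def torsion (χ : FrameBundle E) (v w : TangentSpace (frameModel k) χ) : Poly k :=
  fun i => extDerivOne (frameModel k) (S.solderForm i) χ v w +
    ((rep k (φ.val χ v)).mulVec (S.solder χ w) i - (rep k (φ.val χ w)).mulVec (S.solder χ v) i)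

/-- The curvature `Ω = dφ + φ ∧ φ`. -/
def curvature (χ : FrameBundle E) (v w : TangentSpace (frameModel k) χ) :
    Matrix (Fin 2) (Fin 2) ℝ :=
  Matrix.of (fun i j => extDerivOne (frameModel k) (φ.form i j) χ v w) +
    (φ.val χ v * φ.val χ w - φ.val χ w * φ.val χ v)

/-- The coframe `(ω, φ)` of `B(E)`; at every point it is a linear isomorphism. -/
def coframe (χ : FrameBundle E) :
    TangentSpace (frameModel k) χ →L[ℝ] Poly k × (Fin 2 → Fin 2 → ℝ) :=
  (S.solder χ).prod (ContinuousLinearMap.pi fun i => ContinuousLinearMap.pi fun j => φ.form i j χ)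

/-- The vector `h` at `χ` with `ω(h) = P` and `φ(h) = 0`. -/
def horizontalLift (χ : FrameBundle E) (P : Poly k) : TangentSpace (frameModel k) χ :=
  (φ.coframe S χ).inverse (P, 0)

/-- The complex-valued `1`-form `ζ = (φ^1_2 + φ^2_1) + i (φ^2_2 - φ^1_1)` on `B(E)`. -/
def zeta (χ : FrameBundle E) (v : TangentSpace (frameModel k) χ) : ℂ := zetaMap (φ.val χ v)

/-- The coefficients of the `(0,2)`-part of a complex-valued horizontal `2`-form `β` in the basis
`(ξ, ξ̄)`: the values of the complex bilinear extension of `β` on `(ē_a, ē_b)`, where `ē_a` is the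
complex horizontal vector dual to `ξ̄^{k,a}`, that is, half the horizontal lift of
`V_{k,a}^even + i V_{k,a}^odd`. -/
def coeff02 (χ : FrameBundle E)
    (β : TangentSpace (frameModel k) χ → TangentSpace (frameModel k) χ → ℂ) (a b : Idx k) : ℂ :=
  let re (c : Idx k) := φ.horizontalLift S χ (monomialCoords k (Veven k c))
  let im (c : Idx k) := φ.horizontalLift S χ (monomialCoords k (Vodd k c))
  (1 / 4) * (β (re a) (re b) - β (im a) (im b) + Complex.I * (β (re a) (im b) + β (im a) (re b)))

/-- The coefficients of `ξ̄^{k,a} ∧ ξ̄^{k,b}` in the torsion component `ξ^{k,j}(Θ)`: `T^(0,2)`. -/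
def torsion02 (χ : FrameBundle E) (j a b : Idx k) : ℂ :=
  φ.coeff02 S χ (fun v w => xiMap k (φ.torsion S χ v w) j) a b

/-- The coefficients of `ξ̄^{k,a} ∧ ξ̄^{k,b}` in the curvature component
`(Ω^1_2 + Ω^2_1) + i (Ω^2_2 - Ω^1_1)`, which is the curvature term of `dζ`: `C^(0,2)`. -/
def curvature02 (χ : FrameBundle E) (a b : Idx k) : ℂ :=
  φ.coeff02 S χ (fun v w => zetaMap (φ.curvature χ v w)) a b

/-- `J` is the almost-complex structure `J_φ` on `B(E)/CO(2)`: a complex-valued real-linear form on a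
tangent space of `B(E)/CO(2)` is of type `(1,0)` if and only if its pullback to `B(E)` is a linear
combination of the forms `ξ^{k,j}` and `ζ`. -/
def IsCanonical (J : AlmostComplexStructure (quotientModel k) (COQuotient E)) : Prop :=
  ∀ (χ : FrameBundle E) (α : TangentSpace (quotientModel k) (COQuotient.mk χ) →L[ℝ] ℂ),
    (∀ v, α (J.toFun (COQuotient.mk χ) v) = Complex.I * α v) ↔
      ∃ (c : Idx k → ℂ) (d : ℂ), ∀ v : TangentSpace (frameModel k) χ,
        α (mfderiv (frameModel k) (quotientModel k) COQuotient.mk χ v) =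
          ∑ j, c j * S.xi χ v j + d * φ.zeta χ v

end GL2Connection

end Structure

end
end GL2Geometry

open GL2Geometry

/-! Write `k = 2n + 1` and `z = x + i y`. A real homogeneous polynomial of degree `k` is uniquely
`Re ∑ conj(c_j) z^(k-j) conj(z)^j` with `0 ≤ j ≤ n`, and `ξ^{k,j}` is the coordinate `c_j`. A matrix
of `gl(2)` acts on `z` as `κ z + s conj z`, where `s = (i/2) ζ`. So `ζ` measures the part of the
matrix outside the Lie algebra of `CO(2)`.

Existence and uniqueness. The forms `(ξ, ζ)` map each tangent space of `B(E)` onto a complex vector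
space, and their kernel is tangent to the `CO(2)`-orbits. Along an orbit each of them is multiplied
by a complex number (`quotientCoframe_act`). Multiplication by `i` on their values therefore
descends to `B(E)/CO(2)`. A structure with the prescribed `(1,0)`-forms must be this one, since the
induced map on a tangent space of the quotient is bijective (`quotientCoframe_bijective`,
`isCanonical_iff`).

Integrability. A local section of the projection pulls `(ξ, ζ)` back to a coframe `L` with `L ∘ J =
i L`. Cartan's formula shows that `L` of the Nijenhuis bracket is the `(0,2)`-part of `dL`
(`apply_nijenhuis`, `nijenhuis_eq_zero_iff`). The structure equations give `dξ = ξ(Θ) - ξ(Φ ∧ ω)`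
and `dζ = ζ(Ω) - ζ(φ ∧ φ)` (`dForm_pullComplex`).

The connection terms have no `(0,2)`-part. The action of `(κ, s)` on the coordinates `c` is complex
linear in `c`, up to a single term at `j = n` that is antilinear in `c` but complex linear in `s`
(`rep_realCombination`). Hence every summand of `ξ(Φ ∧ ω)` contains a factor `ξ` or `ζ`
(`part02_rep`). The same holds for `ζ(φ ∧ φ)` by `zetaMap_commutator` (`part02_commutator`).

Torsion and curvature remain. They are horizontal, which follows by differentiating the equivariance
of `ω` and `φ` (`dForm_pullSolder_vertical`, `dForm_pullForm_vertical`), so they are bilinear forms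
in `ξ` alone. Their `(0,2)`-parts are antilinear in both arguments and vanish exactly when the
coefficients `torsion02` and `curvature02` do. -/

namespace GL2Geometry

noncomputable section

/-! ### Homogeneous polynomials as functions on the plane -/

/-- The value at `(x, y)` of the homogeneous polynomial with the given coefficients. -/
def evalPoly {k : ℕ} (P : Poly k) (x y : ℝ) : ℝ := ∑ i : Fin (k + 1), P i * (x ^ (k - (i : ℕ)) * y ^ (i : ℕ))

section EvalPoly

variable {k : ℕ}

theorem evalPoly_add (P Q : Poly k) (x y : ℝ) :
    evalPoly (P + Q) x y = evalPoly P x y + evalPoly Q x y := by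
  simp [evalPoly, add_mul, Finset.sum_add_distrib]

theorem evalPoly_smul (r : ℝ) (P : Poly k) (x y : ℝ) :
    evalPoly (r • P) x y = r * evalPoly P x y := by
  simp [evalPoly, Finset.mul_sum, mul_assoc]

/-- Evaluation of a homogeneous polynomial at `(x, y)`, as a linear form. -/
def evalPolyCLM (k : ℕ) (x y : ℝ) : Poly k →L[ℝ] ℝ :=
  LinearMap.toContinuousLinearMap
    { toFun := fun P => evalPoly P x y
      map_add' := fun P Q => evalPoly_add P Q x y
      map_smul' := fun r P => evalPoly_smul r P x y }

@[simp] theorem evalPolyCLM_apply (x y : ℝ) (P : Poly k) : evalPolyCLM k x y P = evalPoly P x y := rfl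

theorem evalPoly_sum {ι : Type*} (s : Finset ι) (P : ι → Poly k) (x y : ℝ) :
    evalPoly (∑ i ∈ s, P i) x y = ∑ i ∈ s, evalPoly (P i) x y :=
  map_sum (evalPolyCLM k x y) P s

/-- On the line `x = 1` the values at the `k + 1` distinct nodes depend on the coefficients through
an invertible Vandermonde matrix. -/
theorem evalPoly_injective_nat {P Q : Poly k}
    (h : ∀ l : Fin (k + 1), evalPoly P 1 (l : ℕ) = evalPoly Q 1 (l : ℕ)) : P = Q := by
  have hdet : (Matrix.vandermonde fun l : Fin (k + 1) => ((l : ℕ) : ℝ)).det ≠ 0 := by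
    rw [Matrix.det_vandermonde_ne_zero_iff]
    intro a b hab
    exact Fin.ext (Nat.cast_injective hab)
  have hinj := Matrix.mulVec_injective_of_isUnit
    ((Matrix.isUnit_iff_isUnit_det _).2 (isUnit_iff_ne_zero.2 hdet))
  refine hinj (funext fun l => ?_)
  have := h l
  simp only [evalPoly, one_pow, one_mul] at this
  simpa [Matrix.mulVec, dotProduct, Matrix.vandermonde, mul_comm] using this

theorem evalPoly_injective {P Q : Poly k} (h : ∀ x y, evalPoly P x y = evalPoly Q x y) : P = Q :=
  evalPoly_injective_nat fun l => h 1 (l : ℕ)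

/-- The values at the points `(1, l)`, `l = 0, …, k`. -/
def evalNodes (k : ℕ) : Poly k →L[ℝ] (Fin (k + 1) → ℝ) :=
  ContinuousLinearMap.pi fun l => evalPolyCLM k 1 (l : ℕ)

/-- Through this left inverse, smoothness and derivatives of polynomial-valued maps can be checked
on scalar values at fixed points. -/
theorem exists_leftInverse_evalNodes (k : ℕ) :
    ∃ G : (Fin (k + 1) → ℝ) →L[ℝ] Poly k, ∀ P, G (evalNodes k P) = P := by
  obtain ⟨G, hG⟩ := (evalNodes k : Poly k →ₗ[ℝ] (Fin (k + 1) → ℝ)).exists_leftInverse_of_injective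
    (LinearMap.ker_eq_bot.2 fun P Q h => evalPoly_injective_nat fun l => by
      simpa [evalNodes] using congrFun h l)
  exact ⟨LinearMap.toContinuousLinearMap G, fun P => LinearMap.congr_fun hG P⟩

theorem contDiff_of_evalPoly {W : Type*} [NormedAddCommGroup W] [NormedSpace ℝ W] {n : ℕ∞ω}
    {f : W → Poly k} (h : ∀ x y, ContDiff ℝ n fun w => evalPoly (f w) x y) : ContDiff ℝ n f := by
  obtain ⟨G, hG⟩ := exists_leftInverse_evalNodes k
  have : f = fun w => G (evalNodes k (f w)) := funext fun w => (hG _).symm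
  rw [this]
  exact G.contDiff.comp (contDiff_pi.2 fun l => h _ _)

theorem hasDerivAt_of_evalPoly {f : ℝ → Poly k} {f' : Poly k} {t : ℝ}
    (h : ∀ x y, HasDerivAt (fun t => evalPoly (f t) x y) (evalPoly f' x y) t) :
    HasDerivAt f f' t := by
  obtain ⟨G, hG⟩ := exists_leftInverse_evalNodes k
  have : f = fun w => G (evalNodes k (f w)) := funext fun w => (hG _).symm
  rw [this, ← hG f']
  exact G.hasFDerivAt.comp_hasDerivAt t (hasDerivAt_pi.2 fun l => h _ _)

/-- Only the exponents `(k - i, i)` are recorded by `monomialCoords`; homogeneity ensures that these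
exhaust the support. -/
theorem evalPoly_monomialCoords {Q : MvPolynomial (Fin 2) ℝ} (hQ : Q.IsHomogeneous k) (x y : ℝ) :
    evalPoly (monomialCoords k Q) x y = MvPolynomial.eval ![x, y] Q := by
  rw [MvPolynomial.eval_eq']
  let f : Fin (k + 1) → (Fin 2 →₀ ℕ) := fun i =>
    Finsupp.single 0 (k - (i : ℕ)) + Finsupp.single 1 (i : ℕ)
  have hf : Function.Injective f := by
    intro i j hij
    have := DFunLike.congr_fun hij 1
    exact Fin.ext (by simpa [f] using this)
  have hsub : Q.support ⊆ Finset.univ.image f := by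
    intro d hd
    have hdeg := hQ (MvPolynomial.mem_support_iff.1 hd)
    have hd2 : d 0 + d 1 = k := by
      rw [← hdeg]
      simp [Finsupp.weight_apply, Finsupp.sum_fintype]
    refine Finset.mem_image.2 ⟨⟨d 1, by omega⟩, Finset.mem_univ _, ?_⟩
    ext a
    fin_cases a
    · simp [f]; omega
    · simp [f]
  rw [Finset.sum_subset hsub fun d _ hd => by
    rw [MvPolynomial.notMem_support_iff.1 hd, zero_mul], Finset.sum_image hf.injOn]
  refine Finset.sum_congr rfl fun i _ => ?_
  simp [f, monomialCoords, Fin.prod_univ_two]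

end EvalPoly

/-! ### The basis `V_{k,j}` and the coordinates `ξ^{k,j}` -/

section Basis

open MvPolynomial

theorem sum_range_eq_even_add_odd {A : Type*} [AddCommMonoid A] (f : ℕ → A) (n : ℕ) :
    ∑ m ∈ Finset.range n, f m =
      ∑ s ∈ Finset.range ((n + 1) / 2), f (2 * s) + ∑ s ∈ Finset.range (n / 2), f (2 * s + 1) := by
  induction n with
  | zero => simp
  | succ n ih =>
    rw [Finset.sum_range_succ, ih]
    rcases Nat.even_or_odd' n with ⟨m, rfl | rfl⟩
    · have h1 : (2 * m + 1 + 1) / 2 = m + 1 := by omega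
      have h2 : (2 * m + 1) / 2 = m := by omega
      have h3 : 2 * m / 2 = m := by omega
      rw [h1, h2, h3, Finset.sum_range_succ]
      abel
    · have h1 : (2 * m + 1 + 1) / 2 = m + 1 := by omega
      have h2 : (2 * m + 1 + 1 + 1) / 2 = m + 1 := by omega
      have h3 : (2 * m + 1) / 2 = m := by omega
      rw [h1, h2, h3, Finset.sum_range_succ (fun s => f (2 * s + 1))]
      abel

theorem isHomogeneous_term {i a b : ℕ} (h : a + b = i) (r : ℝ) :
    (C r * X 0 ^ a * X 1 ^ b : MvPolynomial (Fin 2) ℝ).IsHomogeneous i := by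
  have := ((isHomogeneous_C (Fin 2) r).mul ((isHomogeneous_X ℝ (0 : Fin 2)).pow a)).mul
    ((isHomogeneous_X ℝ (1 : Fin 2)).pow b)
  convert this using 1
  omega

theorem isHomogeneous_Weven (i : ℕ) : (Weven i).IsHomogeneous i :=
  IsHomogeneous.sum _ _ _ fun s hs => isHomogeneous_term (by rw [Finset.mem_range] at hs; omega) _

theorem isHomogeneous_Wodd (i : ℕ) : (Wodd i).IsHomogeneous i :=
  IsHomogeneous.sum _ _ _ fun s hs => isHomogeneous_term (by rw [Finset.mem_range] at hs; omega) _

theorem isHomogeneous_normSq_pow (j : ℕ) :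
    ((X 0 ^ 2 + X 1 ^ 2) ^ j : MvPolynomial (Fin 2) ℝ).IsHomogeneous (2 * j) :=
  (((isHomogeneous_X ℝ (0 : Fin 2)).pow 2).add ((isHomogeneous_X ℝ (1 : Fin 2)).pow 2)).pow j

theorem isHomogeneous_Veven {k j : ℕ} (h : 2 * j ≤ k) : (Veven k j).IsHomogeneous k := by
  have := (isHomogeneous_normSq_pow j).mul (isHomogeneous_Weven (k - 2 * j))
  rwa [Nat.add_sub_cancel' h] at this

theorem isHomogeneous_Vodd {k j : ℕ} (h : 2 * j ≤ k) : (Vodd k j).IsHomogeneous k := by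
  have := (isHomogeneous_normSq_pow j).mul (isHomogeneous_Wodd (k - 2 * j))
  rwa [Nat.add_sub_cancel' h] at this

/-- Binomial expansion, split by the parity of the exponent of `y * I`: the even powers are real and
the odd ones imaginary. Commuting the two summands first makes that exponent the summation index. -/
theorem eval_W (i : ℕ) (x y : ℝ) :
    (x + y * Complex.I : ℂ) ^ i =
      (eval ![x, y] (Weven i) : ℝ) + (eval ![x, y] (Wodd i) : ℝ) * Complex.I := by
  rw [add_comm, add_pow, sum_range_eq_even_add_odd, Weven, Wodd]
  simp only [map_sum, Complex.ofReal_sum, Finset.sum_mul]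
  have hI : ∀ s : ℕ, Complex.I ^ (2 * s) = (-1) ^ s := fun s => by rw [pow_mul, Complex.I_sq]
  congr 1
  · refine Finset.sum_congr (by congr 1; omega) fun s _ => ?_
    simp [mul_pow, hI]
    ring
  · refine Finset.sum_congr rfl fun s _ => ?_
    simp [mul_pow, hI, pow_succ, Nat.sub_sub]
    ring

/-- The complex function `z^(k-j) * conj z ^ j`, whose real and imaginary parts are `V_{k,j}^even`,
`V_{k,j}^odd`. -/
def zMonomial (k j : ℕ) (z : ℂ) : ℂ := z ^ (k - j) * (starRingEnd ℂ z) ^ j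

/-- As `2 * j ≤ k`, the `j` conjugate factors pair off with `j` factors `z` to give `(x² + y²)^j`,
and `z^(k-2j)` is left. -/
theorem eval_V {k j : ℕ} (h : 2 * j ≤ k) (x y : ℝ) :
    zMonomial k j (x + y * Complex.I) =
      (eval ![x, y] (Veven k j) : ℝ) + (eval ![x, y] (Vodd k j) : ℝ) * Complex.I := by
  have h1 : zMonomial k j (x + y * Complex.I) =
      (((x ^ 2 + y ^ 2 : ℝ) : ℂ)) ^ j * (x + y * Complex.I : ℂ) ^ (k - 2 * j) := by
    have : (((x ^ 2 + y ^ 2 : ℝ) : ℂ)) = (x + y * Complex.I) * starRingEnd ℂ (x + y * Complex.I) := by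
      simp
      linear_combination ((y : ℂ) ^ 2) * Complex.I_sq
    rw [this, mul_pow, zMonomial, show k - j = j + (k - 2 * j) by omega, pow_add]
    ring
  rw [h1, eval_W, Veven, Vodd]
  simp
  ring

theorem two_mul_idx_le {k : ℕ} (j : Idx k) : 2 * (j : ℕ) ≤ k := by
  have := j.2
  omega

theorem realCombination_apply (k : ℕ) (c : Idx k → ℂ) :
    realCombination k c = ∑ j : Idx k, ((c j).re • monomialCoords k (Veven k j) +
      (c j).im • monomialCoords k (Vodd k j)) := by
  simp [realCombination]

/-- The conjugate comes from `Re (conj c * m) = Re c * Re m + Im c * Im m`. In this form the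
coordinates `ξ` become coefficients of monomials in `z` and `conj z`, where substitutions are easy
to compute. -/
theorem evalPoly_realCombination {k : ℕ} (c : Idx k → ℂ) (x y : ℝ) :
    evalPoly (realCombination k c) x y =
      (∑ j : Idx k, starRingEnd ℂ (c j) * zMonomial k j (x + y * Complex.I)).re := by
  rw [realCombination_apply, evalPoly_sum, Complex.re_sum]
  refine Finset.sum_congr rfl fun j _ => ?_
  rw [evalPoly_add, evalPoly_smul, evalPoly_smul,
    evalPoly_monomialCoords (isHomogeneous_Veven (two_mul_idx_le j)),
    evalPoly_monomialCoords (isHomogeneous_Vodd (two_mul_idx_le j)), eval_V (two_mul_idx_le j)]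
  simp

end Basis

theorem infinite_unit_circle : {w : ℂ | ‖w‖ = 1}.Infinite := by
  have h : (Ioc (-Real.pi) Real.pi).Infinite := Ioc_infinite (by linarith [Real.pi_pos])
  refine (h.image (f := fun θ : ℝ => Complex.exp (θ * Complex.I)) fun a ha b hb hab => ?_).mono ?_
  · have := congrArg Complex.arg hab
    simp only at this
    rwa [Complex.arg_exp_mul_I, Complex.arg_exp_mul_I, (toIocMod_eq_self _).2, (toIocMod_eq_self _).2] at this
    · exact ⟨hb.1, by linarith [hb.2]⟩
    · exact ⟨ha.1, by linarith [ha.2]⟩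
  · rintro _ ⟨θ, -, rfl⟩
    exact Complex.norm_exp_ofReal_mul_I θ

/-- On the unit circle, twice the real part times `z^k` is the polynomial `∑ conj(c_j) w^(k-j) + c_j
w^j` in `w = z²`. It vanishes on the whole circle, hence identically. For odd `k` the exponents `j`
and `k - j` are all distinct, so each `c_j` occurs alone as a coefficient. -/
theorem realCombination_injective {k : ℕ} (hk : Odd k) : Function.Injective (realCombination k) := by
  rw [injective_iff_map_eq_zero]
  intro c hc
  obtain ⟨n, hn⟩ := hk
  have hre : ∀ z : ℂ, (∑ j : Idx k, starRingEnd ℂ (c j) * zMonomial k j z).re = 0 := fun z => by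
    have h := evalPoly_realCombination c z.re z.im
    rw [hc, Complex.re_add_im] at h
    rw [← h]
    simp [evalPoly]
  let Q : Polynomial ℂ := ∑ j : Idx k, (Polynomial.C (starRingEnd ℂ (c j)) * Polynomial.X ^ (k - (j : ℕ)) +
    Polynomial.C (c j) * Polynomial.X ^ (j : ℕ))
  have hQ : ∀ w : ℂ, ‖w‖ = 1 → Q.eval w = 0 := by
    intro w hw
    obtain ⟨z, rfl⟩ : ∃ z : ℂ, w = z ^ 2 := by
      obtain ⟨z, hz⟩ := IsAlgClosed.exists_pow_nat_eq w two_pos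
      exact ⟨z, hz.symm⟩
    have hz : z * starRingEnd ℂ z = 1 := by
      rw [Complex.mul_conj, Complex.normSq_eq_norm_sq]
      rw [norm_pow] at hw
      exact_mod_cast hw
    have h2 : (∑ j : Idx k, starRingEnd ℂ (c j) * zMonomial k j z) +
        starRingEnd ℂ (∑ j : Idx k, starRingEnd ℂ (c j) * zMonomial k j z) = 0 := by
      rw [Complex.add_conj, hre]; simp
    have h3 : Q.eval (z ^ 2) = z ^ k * ((∑ j : Idx k, starRingEnd ℂ (c j) * zMonomial k j z) +
        starRingEnd ℂ (∑ j : Idx k, starRingEnd ℂ (c j) * zMonomial k j z)) := by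
      rw [map_sum, ← Finset.sum_add_distrib, Finset.mul_sum, Polynomial.eval_finsetSum]
      refine Finset.sum_congr rfl fun j _ => ?_
      have hj := two_mul_idx_le j
      obtain ⟨m, hm⟩ := Nat.exists_eq_add_of_le hj
      simp only [zMonomial, map_mul, map_pow, Complex.conj_conj, Polynomial.eval_add,
        Polynomial.eval_mul, Polynomial.eval_C, Polynomial.eval_pow, Polynomial.eval_X]
      have e1 : z ^ k * (starRingEnd ℂ z) ^ (j : ℕ) = z ^ (k - j) := by
        rw [show z ^ k = z ^ (k - (j : ℕ)) * z ^ (j : ℕ) by rw [← pow_add]; congr 1; omega, mul_assoc,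
          ← mul_pow, hz, one_pow, mul_one]
      have e2 : z ^ k * (starRingEnd ℂ z) ^ (k - (j : ℕ)) = z ^ (j : ℕ) := by
        rw [show z ^ k = z ^ (j : ℕ) * z ^ (k - j) by rw [← pow_add]; congr 1; omega, mul_assoc,
          ← mul_pow, hz, one_pow, mul_one]
      rw [← pow_mul, ← pow_mul]
      have e3 : z ^ (2 * (k - (j : ℕ))) = z ^ (k - j) * z ^ (k - j) := by rw [← pow_add]; congr 1; omega
      have e4 : z ^ (2 * (j : ℕ)) = z ^ (j : ℕ) * z ^ (j : ℕ) := by rw [← pow_add]; congr 1; omega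
      rw [e3, e4]
      linear_combination (-(starRingEnd ℂ (c j)) * z ^ (k - j)) * e1 - (c j * z ^ (j : ℕ)) * e2
    rw [h3, h2, mul_zero]
  have hQ0 : Q = 0 := Polynomial.eq_zero_of_infinite_isRoot Q (infinite_unit_circle.mono hQ)
  funext j
  have hcoef := congrArg (fun q => Polynomial.coeff q (j : ℕ)) hQ0
  simp only [Q, Polynomial.finsetSum_coeff, Polynomial.coeff_add, Polynomial.coeff_C_mul,
    Polynomial.coeff_X_pow, Polynomial.coeff_zero] at hcoef
  rw [Finset.sum_eq_single j] at hcoef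
  · have hj := two_mul_idx_le j
    have : (j : ℕ) ≠ k - j := by omega
    simpa [this] using hcoef
  · intro i _ hi
    have hj := two_mul_idx_le j
    have hi' := two_mul_idx_le i
    have h1 : (j : ℕ) ≠ k - i := by omega
    have h2 : (j : ℕ) ≠ i := fun h => hi (Fin.ext h.symm)
    simp [h1, h2]
  · simp

theorem finrank_idx {k : ℕ} (hk : Odd k) :
    Module.finrank ℝ (Idx k → ℂ) = Module.finrank ℝ (Poly k) := by
  obtain ⟨n, rfl⟩ := hk
  rw [Module.finrank_pi_fintype]
  simp
  omega

/-- `realCombination` as an isomorphism. -/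
def realCombinationEquiv {k : ℕ} (hk : Odd k) : (Idx k → ℂ) ≃L[ℝ] Poly k :=
  (LinearEquiv.ofInjectiveOfFinrankEq (realCombination k : (Idx k → ℂ) →ₗ[ℝ] Poly k)
    (realCombination_injective hk) (finrank_idx hk)).toContinuousLinearEquiv

theorem coe_realCombinationEquiv {k : ℕ} (hk : Odd k) :
    (realCombinationEquiv hk : (Idx k → ℂ) →L[ℝ] Poly k) = realCombination k := by
  ext1 c
  rfl

theorem xiMap_eq {k : ℕ} (hk : Odd k) :
    xiMap k = ((realCombinationEquiv hk).symm : Poly k →L[ℝ] (Idx k → ℂ)) := by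
  rw [xiMap, ← coe_realCombinationEquiv hk, ContinuousLinearMap.inverse_equiv]

theorem xiMap_realCombination {k : ℕ} (hk : Odd k) (c : Idx k → ℂ) :
    xiMap k (realCombination k c) = c := by
  rw [xiMap_eq hk, ← coe_realCombinationEquiv hk]
  simp

theorem realCombination_xiMap {k : ℕ} (hk : Odd k) (P : Poly k) :
    realCombination k (xiMap k P) = P := by
  rw [xiMap_eq hk, ← coe_realCombinationEquiv hk]
  simp

/-! ### Linear substitutions in homogeneous polynomials -/

section Substitution

open MvPolynomial

/-- The linear form with the given coefficients. -/
def linForm (u : Plane) : MvPolynomial (Fin 2) ℝ := C (u 0) * X 0 + C (u 1) * X 1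

theorem isHomogeneous_linForm (u : Plane) : (linForm u).IsHomogeneous 1 := by
  have h : ∀ i, (C (u i) * X i : MvPolynomial (Fin 2) ℝ).IsHomogeneous 1 := fun i => by
    simpa using (isHomogeneous_C (Fin 2) (u i)).mul (isHomogeneous_X ℝ i)
  exact (h 0).add (h 1)

@[simp] theorem eval_linForm (u : Plane) (x y : ℝ) :
    eval ![x, y] (linForm u) = u 0 * x + u 1 * y := by
  simp [linForm]

/-- The substitution `P(x, y) ↦ P(a₀ x + a₁ y, b₀ x + b₁ y)`, where `c = (a, b)`. -/
def substMap (k : ℕ) (c : Plane × Plane) : Poly k →L[ℝ] Poly k :=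
  ∑ i : Fin (k + 1), (ContinuousLinearMap.proj (R := ℝ) (φ := fun _ : Fin (k + 1) => ℝ) i).smulRight
    (monomialCoords k (linForm c.1 ^ (k - (i : ℕ)) * linForm c.2 ^ (i : ℕ)))

theorem substMap_apply {k : ℕ} (c : Plane × Plane) (P : Poly k) :
    substMap k c P = ∑ i : Fin (k + 1),
      P i • monomialCoords k (linForm c.1 ^ (k - (i : ℕ)) * linForm c.2 ^ (i : ℕ)) := by
  simp [substMap]

theorem evalPoly_substMap {k : ℕ} (c : Plane × Plane) (P : Poly k) (x y : ℝ) :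
    evalPoly (substMap k c P) x y =
      evalPoly P (c.1 0 * x + c.1 1 * y) (c.2 0 * x + c.2 1 * y) := by
  rw [substMap_apply, evalPoly_sum]
  refine Finset.sum_congr rfl fun i _ => ?_
  have h : (linForm c.1 ^ (k - (i : ℕ)) * linForm c.2 ^ (i : ℕ)).IsHomogeneous k := by
    have := ((isHomogeneous_linForm c.1).pow (k - (i : ℕ))).mul ((isHomogeneous_linForm c.2).pow (i : ℕ))
    rwa [one_mul, one_mul, Nat.sub_add_cancel (Nat.lt_succ_iff.1 i.2)] at this
  rw [evalPoly_smul, evalPoly_monomialCoords h]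
  simp

/-- The right action of `2 × 2`-matrices on pairs of vectors. -/
def pairMul (c : Plane × Plane) (A : Matrix (Fin 2) (Fin 2) ℝ) : Plane × Plane :=
  (A 0 0 • c.1 + A 1 0 • c.2, A 0 1 • c.1 + A 1 1 • c.2)

/-- The columns of a matrix. -/
def columns (A : Matrix (Fin 2) (Fin 2) ℝ) : Plane × Plane := (![A 0 0, A 1 0], ![A 0 1, A 1 1])

theorem contDiff_evalPoly {k : ℕ} (P : Poly k) {n : ℕ∞ω} :
    ContDiff ℝ n fun p : ℝ × ℝ => evalPoly P p.1 p.2 := by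
  unfold evalPoly
  fun_prop

theorem contDiff_substMap (k : ℕ) {n : ℕ∞ω} : ContDiff ℝ n (substMap k) := by
  rw [contDiff_clm_apply_iff]
  intro P
  refine contDiff_of_evalPoly fun x y => ?_
  simp only [evalPoly_substMap]
  have h : ContDiff ℝ n fun c : Plane × Plane =>
      (c.1 0 * x + c.1 1 * y, c.2 0 * x + c.2 1 * y) := by fun_prop
  exact (contDiff_evalPoly P).comp h

theorem substMap_columns_one (k : ℕ) : substMap k (columns 1) = ContinuousLinearMap.id ℝ (Poly k) := by
  ext1 P
  refine evalPoly_injective fun x y => ?_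
  rw [evalPoly_substMap]
  simp [columns]

end Substitution

/-! ### The representation of `gl(2)` in terms of `z` and `conj z` -/

section Representation

theorem hasDerivAt_monomial (k j : ℕ) (x y x' y' : ℝ) :
    HasDerivAt (fun t : ℝ => (x + t * x') ^ (k - j) * (y + t * y') ^ j)
      ((((k - j : ℕ) : ℝ) * x ^ (k - j - 1) * x') * y ^ j + x ^ (k - j) * (j * y ^ (j - 1) * y')) 0 := by
  have hx : HasDerivAt (fun t : ℝ => x + t * x') x' 0 := by
    simpa using ((hasDerivAt_id (0 : ℝ)).mul_const x').const_add x
  have hy : HasDerivAt (fun t : ℝ => y + t * y') y' 0 := by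
    simpa using ((hasDerivAt_id (0 : ℝ)).mul_const y').const_add y
  exact ((hx.fun_pow (k - j)).fun_mul (hy.fun_pow j)).congr_deriv (by simp)

/-- Column `j` of `rep` holds the derivative of `x^(k-j) y^j` along the linear vector field of `A`;
the right-hand side has the shape produced by `hasDerivAt_monomial`. -/
theorem rep_column {k : ℕ} (A : Matrix (Fin 2) (Fin 2) ℝ) (j : Fin (k + 1)) (x y : ℝ) :
    ∑ i : Fin (k + 1), rep k A i j * (x ^ (k - (i : ℕ)) * y ^ (i : ℕ)) =
      (((k - j : ℕ) : ℝ) * x ^ (k - (j : ℕ) - 1) * (A 0 0 * x + A 1 0 * y)) * y ^ (j : ℕ) +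
        x ^ (k - (j : ℕ)) * ((j : ℕ) * y ^ ((j : ℕ) - 1) * (A 0 1 * x + A 1 1 * y)) := by
  obtain ⟨j, hj⟩ := j
  have hj' : j ≤ k := Nat.lt_succ_iff.1 hj
  have hsplit : ∀ i : Fin (k + 1), rep k A i ⟨j, hj⟩ * (x ^ (k - (i : ℕ)) * y ^ (i : ℕ)) =
      (if (i : ℕ) = j then (((k : ℝ) - j) * A 0 0 + (j : ℝ) * A 1 1) * (x ^ (k - j) * y ^ j) else 0) +
      (if (i : ℕ) = j + 1 then (((k : ℝ) - j) * A 1 0) * (x ^ (k - (j + 1)) * y ^ (j + 1)) else 0) +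
      (if (i : ℕ) + 1 = j then ((j : ℝ) * A 0 1) * (x ^ (k - (i : ℕ)) * y ^ (i : ℕ)) else 0) := by
    intro i
    simp only [rep, Matrix.of_apply, Fin.ext_iff]
    by_cases h1 : (i : ℕ) = j
    · simp [h1]
    · by_cases h2 : (i : ℕ) = j + 1
      · have h3 : j + 1 + 1 ≠ j := by omega
        simp [h2, h3]
      · by_cases h3 : (i : ℕ) + 1 = j
        · simp [h1, h2, h3]
        · simp [h1, h2, h3]
  have hsum : ∀ (m : ℕ) (f : ℕ → ℝ), ∑ i : Fin (k + 1), (if (i : ℕ) = m then f i else 0) =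
      if m ≤ k then f m else 0 := by
    intro m f
    rw [Fin.sum_univ_eq_sum_range (fun i => if i = m then f i else 0), Finset.sum_ite_eq' ]
    simp
  rw [Finset.sum_congr rfl fun i _ => hsplit i, Finset.sum_add_distrib, Finset.sum_add_distrib,
    hsum j (fun _ => _), hsum (j + 1) (fun _ => _), if_pos hj', Nat.cast_sub hj']
  have h3 : ∑ i : Fin (k + 1), (if (i : ℕ) + 1 = j then
      ((j : ℝ) * A 0 1) * (x ^ (k - (i : ℕ)) * y ^ (i : ℕ)) else 0) =
        (j : ℝ) * A 0 1 * (x ^ (k - j + 1) * y ^ (j - 1)) := by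
    rcases j with _ | j
    · simp
    · simp only [Nat.add_right_cancel_iff]
      rw [hsum j fun i => (((j + 1 : ℕ) : ℝ) * A 0 1) * (x ^ (k - i) * y ^ i), if_pos (by omega),
        show k - (j + 1) + 1 = k - j by omega, Nat.add_sub_cancel]
  rw [h3]
  -- The next identities absorb truncated subtraction: where an exponent `k - j - 1` or `j - 1` is
  -- cut off at zero, its coefficient `k - j` or `j` vanishes.
  have e1 : ((k : ℝ) - j) * x ^ (k - j) = ((k : ℝ) - j) * (x ^ (k - j - 1) * x) := by
    rcases Nat.eq_or_lt_of_le hj' with rfl | h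
    · simp
    · rw [← pow_succ, show k - j - 1 + 1 = k - j by omega]
  have e2 : (j : ℝ) * y ^ j = (j : ℝ) * (y ^ (j - 1) * y) := by
    rcases j with _ | j
    · simp
    · rw [← pow_succ, Nat.add_sub_cancel]
  have e3 : (if j + 1 ≤ k then ((k : ℝ) - j) * A 1 0 * (x ^ (k - (j + 1)) * y ^ (j + 1)) else 0) =
      ((k : ℝ) - j) * A 1 0 * (x ^ (k - j - 1) * y ^ (j + 1)) := by
    split_ifs with h
    · rw [Nat.sub_sub]
    · rw [show k = j by omega]; simp
  rw [e3]
  linear_combination (A 0 0 * y ^ j) * e1 + (A 1 1 * x ^ (k - j)) * e2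

/-- `rep k A` is the derivative of `P(x, y) ↦ P((x, y) g)` at `g = 1` in the direction `A`. -/
theorem hasDerivAt_evalPoly_rep {k : ℕ} (A : Matrix (Fin 2) (Fin 2) ℝ) (P : Poly k) (x y : ℝ) :
    HasDerivAt (fun t : ℝ => evalPoly P (x + t * (A 0 0 * x + A 1 0 * y)) (y + t * (A 0 1 * x + A 1 1 * y)))
      (evalPoly ((rep k A).mulVec P) x y) 0 := by
  have h : evalPoly ((rep k A).mulVec P) x y = ∑ j : Fin (k + 1), P j *
      ∑ i : Fin (k + 1), rep k A i j * (x ^ (k - (i : ℕ)) * y ^ (i : ℕ)) := by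
    simp only [evalPoly, Matrix.mulVec, dotProduct, Finset.sum_mul, Finset.mul_sum]
    rw [Finset.sum_comm]
    exact Finset.sum_congr rfl fun i _ => Finset.sum_congr rfl fun j _ => by ring
  rw [h]
  unfold evalPoly
  refine HasDerivAt.fun_sum fun j _ => ?_
  rw [rep_column]
  exact (hasDerivAt_monomial k j x y _ _).const_mul (P j)

theorem hasDerivAt_substMap {k : ℕ} (A : Matrix (Fin 2) (Fin 2) ℝ) (P : Poly k) :
    HasDerivAt (fun t : ℝ => substMap k (columns (1 + t • A)) P) ((rep k A).mulVec P) 0 := by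
  refine hasDerivAt_of_evalPoly fun x y => ?_
  refine (hasDerivAt_evalPoly_rep A P x y).congr_of_eventuallyEq (Filter.Eventually.of_forall fun t => ?_)
  simp only
  rw [evalPoly_substMap]
  congr 1
  · simp [columns]; ring
  · simp [columns]; ring

/-- The coefficient of `z` in the real-linear self-map `x ↦ A₀₀ x + A₁₀ y`, `y ↦ A₀₁ x + A₁₁ y`
applied to `z = x + i y`. -/
def linCoeff (A : Matrix (Fin 2) (Fin 2) ℝ) : ℂ :=
  ((A 0 0 + A 1 1 : ℝ) + (A 0 1 - A 1 0 : ℝ) * Complex.I) / 2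

/-- The coefficient of `conj z` in the self-map of `linCoeff`. -/
def antiCoeff (A : Matrix (Fin 2) (Fin 2) ℝ) : ℂ := Complex.I / 2 * zetaMap A

/-- A real-linear self-map of `ℂ` is a sum of a complex linear and an antilinear one. That the
antilinear coefficient is a constant multiple of `ζ` is what links the type of `ζ` to the action on
polynomials. -/
theorem linCoeff_antiCoeff (A : Matrix (Fin 2) (Fin 2) ℝ) (x y : ℝ) :
    ((A 0 0 * x + A 1 0 * y : ℝ) + (A 0 1 * x + A 1 1 * y : ℝ) * Complex.I : ℂ) =
      linCoeff A * (x + y * Complex.I) + antiCoeff A * starRingEnd ℂ (x + y * Complex.I) := by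
  simp [linCoeff, antiCoeff, zetaMap]
  linear_combination (A 1 0 * y - (A 1 1 - A 0 0) * (x - y * Complex.I) / 2 : ℂ) * Complex.I_sq

/-- A family indexed by `Idx k`, extended by zero. -/
def extendIdx {k : ℕ} (c : Idx k → ℂ) (j : ℕ) : ℂ := if h : j < k / 2 + 1 then c ⟨j, h⟩ else 0

/-- The part of the action of `z ↦ κ z + s conj z` that is complex linear in `c`. -/
def repLin {k : ℕ} (κ s : ℂ) (c : Idx k → ℂ) (j : Idx k) : ℂ :=
  (((k - j : ℕ) : ℂ) * starRingEnd ℂ κ + ((j : ℕ) : ℂ) * κ) * c j +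
    ((if (j : ℕ) = 0 then 0 else ((k - j + 1 : ℕ) : ℂ) * starRingEnd ℂ s * extendIdx c (j - 1)) +
      (((j + 1 : ℕ) : ℂ) * s * extendIdx c (j + 1)))

/-- The part of the action of `z ↦ κ z + s conj z` that is antilinear in `c`; it is complex linear
in `s`. -/
def repAnti {k : ℕ} (s : ℂ) (c : Idx k → ℂ) (j : Idx k) : ℂ :=
  if (j : ℕ) = k / 2 then ((k - j : ℕ) : ℂ) * s * starRingEnd ℂ (c j) else 0

theorem hasDerivAt_zMonomial (k j : ℕ) (z z' : ℂ) :
    HasDerivAt (fun t : ℝ => zMonomial k j (z + t * z'))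
      ((((k - j : ℕ) : ℂ) * z ^ (k - j - 1) * z') * (starRingEnd ℂ z) ^ j +
        z ^ (k - j) * (j * (starRingEnd ℂ z) ^ (j - 1) * starRingEnd ℂ z')) 0 := by
  have hl : HasDerivAt (fun t : ℝ => (t : ℂ)) 1 0 := (hasDerivAt_id (0 : ℝ)).ofReal_comp
  have hx : HasDerivAt (fun t : ℝ => z + t * z') z' 0 := by
    simpa using (hl.mul_const z').const_add z
  have hy : HasDerivAt (fun t : ℝ => starRingEnd ℂ (z + t * z')) (starRingEnd ℂ z') 0 := by
    simpa using (hl.mul_const (starRingEnd ℂ z')).const_add (starRingEnd ℂ z)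
  exact ((hx.fun_pow (k - j)).fun_mul (hy.fun_pow j)).congr_deriv (by simp)

theorem extendIdx_fin {k : ℕ} (c : Idx k → ℂ) (j : Idx k) : extendIdx c j = c j := by
  rw [extendIdx, dif_pos j.2]

/-- The monomial just past the last index is the conjugate of the last one. This is the source of
the antilinear term `repAnti`. -/
theorem zMonomial_conj {k n : ℕ} (hn : k = 2 * n + 1) (z : ℂ) :
    starRingEnd ℂ (zMonomial k n z) = zMonomial k (n + 1) z := by
  subst hn
  simp only [zMonomial, map_mul, map_pow, Complex.conj_conj]
  rw [show 2 * n + 1 - n = n + 1 by omega, show 2 * n + 1 - (n + 1) = n by omega, mul_comm]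

/-- The action of `gl(2)` on homogeneous polynomials, in terms of the coefficients `ξ^{k,j}`. -/
theorem rep_realCombination {k : ℕ} (hk : Odd k) (A : Matrix (Fin 2) (Fin 2) ℝ) (c : Idx k → ℂ) :
    (rep k A).mulVec (realCombination k c) =
      realCombination k (repLin (linCoeff A) (antiCoeff A) c + repAnti (antiCoeff A) c) := by
  refine evalPoly_injective fun x y => ?_
  have h1 := hasDerivAt_evalPoly_rep A (realCombination k c) x y
  simp only [evalPoly_realCombination] at h1
  set z : ℂ := x + y * Complex.I with hz
  set κ := linCoeff A
  set s := antiCoeff A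
  have h2 : ∀ t : ℝ, (((x + t * (A 0 0 * x + A 1 0 * y) : ℝ) : ℂ) +
      ((y + t * (A 0 1 * x + A 1 1 * y) : ℝ) : ℂ) * Complex.I) = z + t * (κ * z + s * starRingEnd ℂ z) := by
    intro t
    rw [hz, ← linCoeff_antiCoeff]
    push_cast
    ring
  simp only [h2] at h1
  have h3 : HasDerivAt (fun t : ℝ => ∑ j : Idx k, starRingEnd ℂ (c j) *
      zMonomial k j (z + t * (κ * z + s * starRingEnd ℂ z))) _ 0 :=
    HasDerivAt.fun_sum fun j _ => (hasDerivAt_zMonomial k j z _).const_mul _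
  have h4 := (Complex.reCLM.hasFDerivAt.comp_hasDerivAt (0 : ℝ) h3)
  -- Both are derivatives of the same real function at `0`, so the claim is reduced to an identity
  -- between real parts of sums of monomials.
  rw [h1.unique h4, evalPoly_realCombination, ← hz, Complex.reCLM_apply]
  obtain ⟨n, hn⟩ := hk
  have hn2 : k / 2 = n := by omega
  let d : ℕ → ℂ := extendIdx c
  have hL : ∑ j : Idx k, starRingEnd ℂ (c j) *
      ((((k - (j : ℕ) : ℕ) : ℂ) * z ^ (k - (j : ℕ) - 1) * (κ * z + s * starRingEnd ℂ z)) *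
        (starRingEnd ℂ z) ^ (j : ℕ) + z ^ (k - (j : ℕ)) * ((j : ℕ) * (starRingEnd ℂ z) ^ ((j : ℕ) - 1) *
          starRingEnd ℂ (κ * z + s * starRingEnd ℂ z))) =
      ∑ j ∈ Finset.range (n + 1), (starRingEnd ℂ (d j) * (((k - j : ℕ) : ℂ) * κ + j * starRingEnd ℂ κ) *
        zMonomial k j z + starRingEnd ℂ (d j) * (((k - j : ℕ) : ℂ) * s) * zMonomial k (j + 1) z +
        starRingEnd ℂ (d j) * (j * starRingEnd ℂ s) * zMonomial k (j - 1) z) := by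
    rw [← hn2, ← Fin.sum_univ_eq_sum_range (fun j => (starRingEnd ℂ (d j) *
      (((k - j : ℕ) : ℂ) * κ + j * starRingEnd ℂ κ) *
        zMonomial k j z + starRingEnd ℂ (d j) * (((k - j : ℕ) : ℂ) * s) * zMonomial k (j + 1) z +
        starRingEnd ℂ (d j) * (j * starRingEnd ℂ s) * zMonomial k (j - 1) z))]
    refine Finset.sum_congr rfl fun j _ => ?_
    simp only [d, extendIdx_fin]
    have hj := two_mul_idx_le j
    generalize c j = w
    generalize (j : ℕ) = i at *
    have e1 : zMonomial k i z = z ^ (k - i - 1) * z * starRingEnd ℂ z ^ i := by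
      rw [zMonomial, ← pow_succ]; congr 2; omega
    have e2 : zMonomial k (i + 1) z = z ^ (k - i - 1) * (starRingEnd ℂ z ^ i * starRingEnd ℂ z) := by
      rw [zMonomial, ← pow_succ, Nat.sub_sub]
    have e3 : (i : ℂ) * zMonomial k i z = i * (z ^ (k - i) * (starRingEnd ℂ z ^ (i - 1) * starRingEnd ℂ z)) := by
      rcases i with _ | i
      · simp
      · rw [zMonomial, ← pow_succ, Nat.add_sub_cancel]
    have e4 : (i : ℂ) * zMonomial k (i - 1) z = i * (z ^ (k - i) * z * starRingEnd ℂ z ^ (i - 1)) := by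
      rcases i with _ | i
      · simp
      · rw [zMonomial, ← pow_succ, show k - (i + 1) + 1 = k - (i + 1 - 1) by omega]
    simp only [map_add, map_mul, Complex.conj_conj]
    linear_combination (-(starRingEnd ℂ w) * ((k - i : ℕ) : ℂ) * κ) * e1 -
      (starRingEnd ℂ w) * ((k - i : ℕ) : ℂ) * s * e2 - (starRingEnd ℂ w) * starRingEnd ℂ κ * e3 -
      (starRingEnd ℂ w) * starRingEnd ℂ s * e4
  have hR : ∑ j : Idx k, starRingEnd ℂ ((repLin κ s c + repAnti s c) j) * zMonomial k j z =
      ∑ j ∈ Finset.range (n + 1), (starRingEnd ℂ (d j) * (((k - j : ℕ) : ℂ) * κ + j * starRingEnd ℂ κ) *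
        zMonomial k j z +
        (if j = 0 then 0 else ((k - j + 1 : ℕ) : ℂ) * s * starRingEnd ℂ (d (j - 1))) * zMonomial k j z +
        (((j + 1 : ℕ) : ℂ) * starRingEnd ℂ s * starRingEnd ℂ (d (j + 1))) * zMonomial k j z +
        (if j = n then ((k - j : ℕ) : ℂ) * starRingEnd ℂ s * d j else 0) * zMonomial k j z) := by
    rw [← hn2, ← Fin.sum_univ_eq_sum_range (fun j => (starRingEnd ℂ (d j) *
        (((k - j : ℕ) : ℂ) * κ + j * starRingEnd ℂ κ) * zMonomial k j z +
        (if j = 0 then 0 else ((k - j + 1 : ℕ) : ℂ) * s * starRingEnd ℂ (d (j - 1))) * zMonomial k j z +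
        (((j + 1 : ℕ) : ℂ) * starRingEnd ℂ s * starRingEnd ℂ (d (j + 1))) * zMonomial k j z +
        (if j = k / 2 then ((k - j : ℕ) : ℂ) * starRingEnd ℂ s * d j else 0) * zMonomial k j z))]
    refine Finset.sum_congr rfl fun j _ => ?_
    simp only [Pi.add_apply, repLin, repAnti, d, extendIdx_fin]
    split_ifs <;> simp <;> ring
  rw [hL, hR]
  simp only [Finset.sum_add_distrib]
  -- Shifting the index by one matches the neighbour terms with their monomials. The guard at `j =
  -- 0` discards the truncated index `j - 1`, and the extension by zero removes the term past `n`.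
  have hd : d (n + 1) = 0 := by simp [d, extendIdx, hn2]
  have s1 : ∑ j ∈ Finset.range (n + 1), (if j = 0 then 0 else
      ((k - j + 1 : ℕ) : ℂ) * s * starRingEnd ℂ (d (j - 1))) * zMonomial k j z =
      ∑ j ∈ Finset.range n, starRingEnd ℂ (d j) * (((k - j : ℕ) : ℂ) * s) * zMonomial k (j + 1) z := by
    rw [Finset.sum_range_succ']
    simp only [if_true, zero_mul, add_zero, Nat.succ_ne_zero, if_false, Nat.add_sub_cancel]
    refine Finset.sum_congr rfl fun j hj => ?_
    rw [Finset.mem_range] at hj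
    rw [show k - (j + 1) + 1 = k - j by omega]
    ring
  have s2 : ∑ j ∈ Finset.range (n + 1), (((j + 1 : ℕ) : ℂ) * starRingEnd ℂ s * starRingEnd ℂ (d (j + 1))) *
      zMonomial k j z =
      ∑ j ∈ Finset.range (n + 1), starRingEnd ℂ (d j) * (j * starRingEnd ℂ s) * zMonomial k (j - 1) z := by
    rw [Finset.sum_range_succ, hd, Finset.sum_range_succ']
    simp only [map_zero, mul_zero, zero_mul, add_zero, Nat.cast_zero, Nat.add_sub_cancel]
    exact Finset.sum_congr rfl fun j _ => by ring
  rw [s1, s2, Finset.sum_range_succ (fun j => starRingEnd ℂ (d j) * (((k - j : ℕ) : ℂ) * s) *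
    zMonomial k (j + 1) z)]
  simp only [ite_mul, zero_mul, Finset.sum_ite_eq', Finset.mem_range, Nat.lt_succ_self, if_true,
    Complex.add_re]
  -- The term left over in `zMonomial k (n + 1)` lies outside the chosen range. Conjugation keeps
  -- its real part and folds it back onto index `n`, at the price of antilinearity in `c`.
  have h5 : (starRingEnd ℂ (d n) * (((k - n : ℕ) : ℂ) * s) * zMonomial k (n + 1) z).re =
      (((k - n : ℕ) : ℂ) * starRingEnd ℂ s * d n * zMonomial k n z).re := by
    rw [← zMonomial_conj hn, ← Complex.conj_re]
    congr 1
    simp only [map_mul, Complex.conj_conj, map_natCast]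
    ring
  rw [h5]
  ring

theorem xiMap_rep_realCombination {k : ℕ} (hk : Odd k) (A : Matrix (Fin 2) (Fin 2) ℝ) (c : Idx k → ℂ) :
    xiMap k ((rep k A).mulVec (realCombination k c)) =
      repLin (linCoeff A) (antiCoeff A) c + repAnti (antiCoeff A) c := by
  rw [rep_realCombination hk, xiMap_realCombination hk]

/-- The action of `CO(2)` on homogeneous polynomials is diagonal in the coefficients `ξ^{k,j}`. -/
theorem substMap_co_realCombination {k : ℕ} (u v : ℝ) (c : Idx k → ℂ) :
    substMap k (columns !![u, -v; v, u]) (realCombination k c) =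
      realCombination k fun j => zMonomial k j (u + v * Complex.I) * c j := by
  refine evalPoly_injective fun x y => ?_
  rw [evalPoly_substMap, evalPoly_realCombination, evalPoly_realCombination]
  congr 1
  refine Finset.sum_congr rfl fun j _ => ?_
  have h : (((columns !![u, -v; v, u]).1 0 * x + (columns !![u, -v; v, u]).1 1 * y : ℝ) +
      ((columns !![u, -v; v, u]).2 0 * x + (columns !![u, -v; v, u]).2 1 * y : ℝ) * Complex.I : ℂ) =
      starRingEnd ℂ (u + v * Complex.I) * (x + y * Complex.I) := by
    simp [columns]
    linear_combination (v * y : ℂ) * Complex.I_sq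
  rw [h]
  simp only [zMonomial, map_mul, map_pow, Complex.conj_conj, mul_pow]
  ring

/-- Conjugating `z ↦ κ z + s conj z` by a complex multiplication only rescales `s`, and `ζ` is
proportional to `s`. The value of the factor does not matter, only that it is the same complex
number for all `A`. -/
theorem zetaMap_co_conj (u v : ℝ) :
    ∃ μ : ℂ, ∀ A : Matrix (Fin 2) (Fin 2) ℝ,
      zetaMap ((!![u, -v; v, u])⁻¹ * A * !![u, -v; v, u]) = μ * zetaMap A := by
  obtain ⟨r, hr⟩ : ∃ r : ℝ, (!![u, -v; v, u])⁻¹ = r • !![u, v; -v, u] :=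
    ⟨_, by rw [Matrix.inv_def, Matrix.adjugate_fin_two_of, neg_neg]⟩
  refine ⟨(u - v * Complex.I) ^ 2 * r, fun A => ?_⟩
  rw [hr, A.eta_fin_two]
  simp only [Matrix.smul_mul, Matrix.mul_fin_two]
  apply Complex.ext
  · simp [zetaMap, pow_two]
    ring
  · simp [zetaMap, pow_two]
    ring

/-- The `ζ`-component of a commutator is complex linear in the `ζ`-components. -/
theorem zetaMap_commutator (A B : Matrix (Fin 2) (Fin 2) ℝ) :
    zetaMap (A * B - B * A) =
      Complex.I * (((A 1 0 - A 0 1 : ℝ) : ℂ) * zetaMap B - ((B 1 0 - B 0 1 : ℝ) : ℂ) * zetaMap A) := by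
  apply Complex.ext <;> simp [zetaMap, Matrix.mul_apply, Fin.sum_univ_two] <;> ring

end Representation

/-! ### The `(0,2)`-part of a bilinear form -/

section ZeroTwoPart

variable {W K : Type*} [AddCommGroup K] [Module ℂ K]

/-- The value on `(u + i J u, w + i J w)` of the complex bilinear extension of `β`. -/
def part02 (J : W → W) (β : W → W → K) (u w : W) : K :=
  β u w - β (J u) (J w) + Complex.I • (β (J u) w + β u (J w))

theorem part02_add (J : W → W) (β γ : W → W → K) (u w : W) :
    part02 J (fun u w => β u w + γ u w) u w = part02 J β u w + part02 J γ u w := by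
  simp only [part02]
  module

theorem part02_sub (J : W → W) (β γ : W → W → K) (u w : W) :
    part02 J (fun u w => β u w - γ u w) u w = part02 J β u w - part02 J γ u w := by
  simp only [part02]
  module

theorem part02_swap (J : W → W) (β : W → W → K) (u w : W) :
    part02 J (fun u w => β w u) u w = part02 J β w u := by
  simp only [part02, add_comm]

/-- A complex linear argument annihilates `w + i J w`, because `1 + i * i = 0`. -/
theorem part02_eq_zero_of_right {J : W → W} {β : W → W → K}
    (h : ∀ u w, β u (J w) = Complex.I • β u w) (u w : W) : part02 J β u w = 0 := by
  simp only [part02, h]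
  rw [smul_add, smul_smul, Complex.I_mul_I]
  module

theorem part02_eq_zero_of_left {J : W → W} {β : W → W → K}
    (h : ∀ u w, β (J u) w = Complex.I • β u w) (u w : W) : part02 J β u w = 0 := by
  rw [← part02_swap]
  exact part02_eq_zero_of_right (fun u w => h w u) w u

end ZeroTwoPart

section Algebra

variable {k : ℕ}

theorem extendIdx_smul (a : ℂ) (c : Idx k → ℂ) (j : ℕ) : extendIdx (a • c) j = a * extendIdx c j := by
  unfold extendIdx
  split_ifs <;> simp

theorem repLin_smul (κ s a : ℂ) (c : Idx k → ℂ) : repLin κ s (a • c) = a • repLin κ s c := by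
  funext j
  simp only [repLin, extendIdx_smul, Pi.smul_apply, smul_eq_mul]
  split_ifs <;> ring

theorem repAnti_mul (s a : ℂ) (c : Idx k → ℂ) : repAnti (a * s) c = a • repAnti s c := by
  funext j
  simp only [repAnti, Pi.smul_apply, smul_eq_mul]
  split_ifs <;> ring

theorem antiCoeff_eq {A B : Matrix (Fin 2) (Fin 2) ℝ} {a : ℂ} (h : zetaMap B = a * zetaMap A) :
    antiCoeff B = a * antiCoeff A := by
  simp only [antiCoeff, h]
  ring

/-- The factor `linCoeff` has no type, but it occurs only in `repLin`, which is complex linear in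
the coordinates of the other argument. The antilinear remainder `repAnti` is complex linear in
`antiCoeff`, hence in `ζ`. So each summand is complex linear in one of its two arguments. -/
theorem part02_rep {W : Type*} (hk : Odd k) {J : W → W} {P : W → Poly k}
    {A : W → Matrix (Fin 2) (Fin 2) ℝ} (hP : ∀ u, xiMap k (P (J u)) = Complex.I • xiMap k (P u))
    (hA : ∀ u, zetaMap (A (J u)) = Complex.I * zetaMap (A u)) (u w : W) :
    part02 J (fun u w => xiMap k ((rep k (A u)).mulVec (P w) - (rep k (A w)).mulVec (P u))) u w = 0 := by
  have h : ∀ u w, xiMap k ((rep k (A u)).mulVec (P w)) =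
      repLin (linCoeff (A u)) (antiCoeff (A u)) (xiMap k (P w)) + repAnti (antiCoeff (A u)) (xiMap k (P w)) :=
    fun u w => by rw [← xiMap_rep_realCombination hk, realCombination_xiMap hk]
  have h0 : ∀ u w, part02 J (fun u w => xiMap k ((rep k (A u)).mulVec (P w))) u w = 0 := by
    intro u w
    simp only [h]
    rw [part02_add, part02_eq_zero_of_right, part02_eq_zero_of_left, add_zero]
    · intro u w
      rw [antiCoeff_eq (hA u), repAnti_mul]
    · intro u w
      rw [hP, repLin_smul]
  simp only [map_sub]
  rw [part02_sub, h0, part02_swap J (fun u w => xiMap k ((rep k (A u)).mulVec (P w))), h0, sub_zero]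

/-- By `zetaMap_commutator` each summand is an untyped real factor times `ζ` of one argument. -/
theorem part02_commutator {W : Type*} {J : W → W} {A : W → Matrix (Fin 2) (Fin 2) ℝ}
    (hA : ∀ u, zetaMap (A (J u)) = Complex.I * zetaMap (A u)) (u w : W) :
    part02 J (fun u w => zetaMap (A u * A w - A w * A u)) u w = 0 := by
  have h : ∀ u w, zetaMap (A u * A w - A w * A u) =
      Complex.I * ((A u 1 0 - A u 0 1 : ℝ) : ℂ) * zetaMap (A w) -
        Complex.I * ((A w 1 0 - A w 0 1 : ℝ) : ℂ) * zetaMap (A u) := fun u w => by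
    rw [zetaMap_commutator]; ring
  simp only [h]
  rw [part02_sub, part02_eq_zero_of_right, part02_eq_zero_of_left, sub_zero]
  · intro u w
    rw [hA, smul_eq_mul]; ring
  · intro u w
    rw [hA, smul_eq_mul]; ring

/-- The `(0,2)`-part of a real bilinear form on `ℂⁿ` is antilinear in both variables, hence
determined by its values on the standard basis. -/
theorem part02_eq_zero_iff {ι : Type*} [Fintype ι] [DecidableEq ι]
    (B : (ι → ℂ) →ₗ[ℝ] (ι → ℂ) →ₗ[ℝ] ℂ) :
    (∀ c d, part02 (fun c => Complex.I • c) (fun c d => B c d) c d = 0) ↔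
      ∀ a b, B (Pi.single a 1) (Pi.single b 1) - B (Pi.single a Complex.I) (Pi.single b Complex.I) +
        Complex.I * (B (Pi.single a 1) (Pi.single b Complex.I) +
          B (Pi.single a Complex.I) (Pi.single b 1)) = 0 := by
  have hI : ∀ a : ι, Complex.I • (Pi.single a 1 : ι → ℂ) = Pi.single a Complex.I := fun a => by
    rw [← Pi.single_smul, smul_eq_mul, mul_one]
  constructor
  · intro h a b
    have := h (Pi.single a 1) (Pi.single b 1)
    simp only [part02, hI, smul_eq_mul] at this
    linear_combination this
  · intro h c d
    have hs : ∀ c : ι → ℂ, c = ∑ a, ((c a).re • (Pi.single a 1 : ι → ℂ) +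
        (c a).im • (Pi.single a Complex.I : ι → ℂ)) := by
      intro c
      funext i
      rw [Finset.sum_apply, Finset.sum_eq_single i]
      · simp
      · intro b _ hb
        simp [hb.symm]
      · simp
    let P : (ι → ℂ) →ₗ[ℝ] (ι → ℂ) →ₗ[ℝ] ℂ := LinearMap.mk₂ ℝ
      (fun c d => part02 (fun c => Complex.I • c) (fun c d => B c d) c d)
      (fun c c' d => by simp only [part02, smul_add, map_add, LinearMap.add_apply]; ring)
      (fun r c d => by
        simp only [part02, smul_comm Complex.I r, map_smul, LinearMap.smul_apply]; module)
      (fun c d d' => by simp only [part02, smul_add, map_add]; ring)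
      (fun r c d => by simp only [part02, smul_comm Complex.I r, map_smul]; module)
    have hP : ∀ c d, P c d = part02 (fun c => Complex.I • c) (fun c d => B c d) c d := fun _ _ => rfl
    have hII : ∀ c : ι → ℂ, Complex.I • Complex.I • c = -c := fun c => by
      rw [smul_smul, Complex.I_mul_I, neg_one_smul]
    have hl : ∀ c d, P (Complex.I • c) d = -Complex.I * P c d := by
      intro c d
      simp only [hP, part02, hII, map_neg, LinearMap.neg_apply, smul_eq_mul]
      linear_combination (B (Complex.I • c) d + B c (Complex.I • d)) * Complex.I_mul_I
    have hr : ∀ c d, P c (Complex.I • d) = -Complex.I * P c d := by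
      intro c d
      simp only [hP, part02, hII, map_neg, smul_eq_mul]
      linear_combination (B (Complex.I • c) d + B c (Complex.I • d)) * Complex.I_mul_I
    have h0 : ∀ a b, P (Pi.single a 1) (Pi.single b 1) = 0 := by
      intro a b
      simp only [hP, part02, hI, smul_eq_mul]
      linear_combination h a b
    rw [← hP, hs c, hs d]
    simp only [map_sum, LinearMap.sum_apply, map_add, map_smul, LinearMap.add_apply,
      LinearMap.smul_apply, ← hI, hl, hr, h0]
    simp

end Algebra

/-! ### The Nijenhuis bracket and exterior derivatives on a vector space -/

section Nijenhuis

variable {W K : Type*} [NormedAddCommGroup W] [NormedSpace ℝ W] [NormedAddCommGroup K]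
  [NormedSpace ℝ K]

/-- The exterior derivative of a vector-valued `1`-form on a vector space. -/
def dForm (L : W → W →L[ℝ] K) (y u w : W) : K := fderiv ℝ L y u w - fderiv ℝ L y w u

/-- Cartan's formula `dL(X, Y) = X(L Y) - Y(L X) - L[X, Y]`, solved for the bracket. -/
theorem apply_lieBracket {L : W → W →L[ℝ] K} {X Y : W → W} {y : W} (hL : DifferentiableAt ℝ L y)
    (hX : DifferentiableAt ℝ X y) (hY : DifferentiableAt ℝ Y y) :
    L y (VectorField.lieBracket ℝ X Y y) = fderiv ℝ (fun y => L y (Y y)) y (X y) -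
      fderiv ℝ (fun y => L y (X y)) y (Y y) - dForm L y (X y) (Y y) := by
  rw [fderiv_clm_apply hL hY, fderiv_clm_apply hL hX]
  simp [VectorField.lieBracket, dForm]
  abel

variable [NormedSpace ℂ K] [IsScalarTower ℝ ℂ K]

/-- If `L` is of type `(1,0)` with respect to `J`, its value on the Nijenhuis bracket is the
`(0,2)`-part of its exterior derivative. -/
theorem apply_nijenhuis {L : W → W →L[ℝ] K} {J : W → W →L[ℝ] W} {X Y : W → W} {y : W}
    (hL : DifferentiableAt ℝ L y) (hJ : DifferentiableAt ℝ J y)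
    (hX : DifferentiableAt ℝ X y) (hY : DifferentiableAt ℝ Y y)
    (h : ∀ᶠ y' in 𝓝 y, ∀ v, L y' (J y' v) = Complex.I • L y' v) :
    L y (VectorField.lieBracket ℝ (fun y => J y (X y)) (fun y => J y (Y y)) y
      - J y (VectorField.lieBracket ℝ (fun y => J y (X y)) Y y)
      - J y (VectorField.lieBracket ℝ X (fun y => J y (Y y)) y)
      - VectorField.lieBracket ℝ X Y y) = part02 (J y) (dForm L y) (X y) (Y y) := by
  have hJX : DifferentiableAt ℝ (fun y => J y (X y)) y := hJ.clm_apply hX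
  have hJY : DifferentiableAt ℝ (fun y => J y (Y y)) y := hJ.clm_apply hY
  -- The relation `L ∘ J = i L` holds in a neighbourhood, not only at `y`, so it may be
  -- differentiated.
  have hfX : fderiv ℝ (fun y => L y (J y (X y))) y = Complex.I • fderiv ℝ (fun y => L y (X y)) y := by
    rw [← fderiv_const_smul (hL.clm_apply hX)]
    exact Filter.EventuallyEq.fderiv_eq (h.mono fun y' hy' => hy' _)
  have hfY : fderiv ℝ (fun y => L y (J y (Y y))) y = Complex.I • fderiv ℝ (fun y => L y (Y y)) y := by
    rw [← fderiv_const_smul (hL.clm_apply hY)]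
    exact Filter.EventuallyEq.fderiv_eq (h.mono fun y' hy' => hy' _)
  have h0 := h.self_of_nhds
  rw [map_sub, map_sub, map_sub, h0, h0, apply_lieBracket hL hJX hJY, apply_lieBracket hL hJX hY,
    apply_lieBracket hL hX hJY, apply_lieBracket hL hX hY, hfX, hfY]
  -- The derivatives of `L X` and `L Y` cancel in pairs; only the four values of `dL` remain.
  simp only [_root_.smul_apply, part02, smul_sub, smul_add, smul_smul, Complex.I_mul_I]
  module

end Nijenhuis

/-! ### Forms, endomorphisms and vector fields in a chart -/

section Coordinates

variable {V H N : Type*} [NormedAddCommGroup V] [NormedSpace ℝ V] [TopologicalSpace H]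
  (I : ModelWithCorners ℝ V H) [TopologicalSpace N] [ChartedSpace H N]

/-- The differential at `x` of the preferred chart at `x₀`. -/
def toChart (x₀ x : N) : TangentSpace I x →L[ℝ] V := mfderiv I 𝓘(ℝ, V) (extChartAt I x₀) x

/-- The differential at `y` of the inverse of the preferred chart at `x₀`. -/
def fromChart (x₀ : N) (y : V) : V →L[ℝ] TangentSpace I ((extChartAt I x₀).symm y) :=
  mfderivWithin 𝓘(ℝ, V) I (extChartAt I x₀).symm (range I) y

/-- A vector-valued `1`-form, in the preferred chart at `x₀`. -/
def pullForm {F : Type*} [NormedAddCommGroup F] [NormedSpace ℝ F] (x₀ : N)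
    (α : Π x : N, TangentSpace I x →L[ℝ] F) (y : V) : V →L[ℝ] F :=
  (α ((extChartAt I x₀).symm y)).comp (fromChart I x₀ y)

/-- A field of endomorphisms, in the preferred chart at `x₀`. -/
def pullEnd (x₀ : N) (J : Π x : N, TangentSpace I x →L[ℝ] TangentSpace I x) (y : V) : V →L[ℝ] V :=
  (toChart I x₀ ((extChartAt I x₀).symm y)).comp
    ((J ((extChartAt I x₀).symm y)).comp (fromChart I x₀ y))

/-- A vector field, in the preferred chart at `x₀`. -/
def pullField (x₀ : N) (X : Π x : N, TangentSpace I x) (y : V) : V :=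
  toChart I x₀ ((extChartAt I x₀).symm y) (X ((extChartAt I x₀).symm y))

theorem pullField_self (x₀ : N) (X : Π x : N, TangentSpace I x) :
    pullField I x₀ X (extChartAt I x₀ x₀) = toChart I x₀ x₀ (X x₀) := by
  rw [pullField, extChartAt_to_inv]

/-- Without boundary `range I` is the whole space, so the derivative within it is the full one; for
a `1`-form the alternating sum has two terms. -/
theorem extDerivOne_eq [I.Boundaryless] {α : Π x : N, TangentSpace I x →L[ℝ] ℝ} {x : N}
    (h : DifferentiableAt ℝ (pullForm I x α) (extChartAt I x x)) (v w : TangentSpace I x) :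
    extDerivOne I α x v w = dForm (pullForm I x α) (extChartAt I x x) (toChart I x x v) (toChart I x x w) := by
  have h' : extDerivOne I α x v w = extDeriv (fun y : V => ContinuousAlternatingMap.ofSubsingleton ℝ V ℝ (0 : Fin 1)
      (pullForm I x α y)) (extChartAt I x x) ![toChart I x x v, toChart I x x w] := by
    rw [← extDerivWithin_univ, ← I.range_eq_univ]
    rfl
  have hd : HasFDerivAt (fun y : V => ContinuousAlternatingMap.ofSubsingleton ℝ V ℝ (0 : Fin 1)
      (pullForm I x α y)) _ (extChartAt I x x) :=
    (ContinuousAlternatingMap.ofSubsingletonLIE (𝕜 := ℝ) (E := V) (F := ℝ)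
      (0 : Fin 1)).toContinuousLinearEquiv.toContinuousLinearMap.hasFDerivAt.comp _ h.hasFDerivAt
  rw [h', extDeriv_apply hd.differentiableAt, Fin.sum_univ_two]
  have e : ∀ u : V, fderiv ℝ (fun y => pullForm I x α y u) (extChartAt I x x) =
      (ContinuousLinearMap.apply ℝ ℝ u).comp (fderiv ℝ (pullForm I x α) (extChartAt I x x)) :=
    fun u => ((ContinuousLinearMap.apply ℝ ℝ u).hasFDerivAt.comp _ h.hasFDerivAt).fderiv
  have e0 : (fun y => (ContinuousAlternatingMap.ofSubsingleton ℝ V ℝ (0 : Fin 1) (pullForm I x α y))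
      ((0 : Fin 2).removeNth ![toChart I x x v, toChart I x x w])) =
        fun y => pullForm I x α y (toChart I x x w) := rfl
  have e1 : (fun y => (ContinuousAlternatingMap.ofSubsingleton ℝ V ℝ (0 : Fin 1) (pullForm I x α y))
      ((1 : Fin 2).removeNth ![toChart I x x v, toChart I x x w])) =
        fun y => pullForm I x α y (toChart I x x v) := rfl
  rw [e0, e1, e, e, dForm]
  simp
  ring

variable [IsManifold I ∞ N]

theorem isManifold_one : IsManifold I 1 N := IsManifold.of_le (n := ∞) (by simp)

theorem toChart_fromChart (x₀ : N) {y : V} (hy : y ∈ (extChartAt I x₀).target) (v : V) :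
    toChart I x₀ _ (fromChart I x₀ y v) = v :=
  have := isManifold_one (I := I) (N := N)
  DFunLike.congr_fun (mfderiv_extChartAt_comp_mfderivWithin_extChartAt_symm hy) v

theorem fromChart_toChart (x₀ : N) {y : V} (hy : y ∈ (extChartAt I x₀).target)
    (v : TangentSpace I ((extChartAt I x₀).symm y)) :
    fromChart I x₀ y (toChart I x₀ _ v) = v :=
  have := isManifold_one (I := I) (N := N)
  DFunLike.congr_fun (mfderivWithin_extChartAt_symm_comp_mfderiv_extChartAt hy) v

theorem toChart_self (x : N) (v : TangentSpace I x) : toChart I x x v = v :=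
  have := isManifold_one (I := I) (N := N)
  DFunLike.congr_fun (mfderiv_extChartAt_self (I := I) (x := x)) v

theorem toChart_bijective (x₀ : N) {x : N} (hx : x ∈ (extChartAt I x₀).source) :
    Function.Bijective (toChart I x₀ x) := by
  have := isManifold_one (I := I) (N := N)
  obtain ⟨e, he⟩ := isInvertible_mfderiv_extChartAt (I := I) hx
  rw [toChart, ← he]
  exact e.bijective

theorem apply_eq_pullForm {F : Type*} [NormedAddCommGroup F] [NormedSpace ℝ F] (x₀ : N)
    (α : Π x : N, TangentSpace I x →L[ℝ] F) {x : N} (hx : x ∈ (extChartAt I x₀).source)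
    (v : TangentSpace I x) : α x v = pullForm I x₀ α (extChartAt I x₀ x) (toChart I x₀ x v) := by
  have hy := (extChartAt I x₀).map_source hx
  obtain ⟨y, hy', rfl⟩ : ∃ y ∈ (extChartAt I x₀).target, x = (extChartAt I x₀).symm y :=
    ⟨_, hy, ((extChartAt I x₀).left_inv hx).symm⟩
  rw [(extChartAt I x₀).right_inv hy', pullForm, ContinuousLinearMap.comp_apply,
    fromChart_toChart I x₀ hy']

/-- The trivialization of the tangent bundle at `x₀` is the differential of the preferred chart. The
fibre coordinate of the section is thus `pullForm` itself, read through the inverse chart. The same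
argument serves endomorphisms and vector fields below. -/
theorem contDiffAt_pullForm {α : Π x : N, TangentSpace I x →L[ℝ] ℝ} [I.Boundaryless]
    (h : IsSmoothForm I α) (x₀ : N) : ContDiffAt ℝ ∞ (pullForm I x₀ α) (extChartAt I x₀ x₀) := by
  have := isManifold_one (I := I) (N := N)
  have h1 := ((contMDiffAt_hom_bundle (IB := I) (F₁ := V) (E₁ := TangentSpace I) (F₂ := ℝ)
    (E₂ := Bundle.Trivial N ℝ) (fun x => TotalSpace.mk' (V →L[ℝ] ℝ)
      (E := fun x : N => TangentSpace I x →L[ℝ] ℝ) x (α x))).1 (h x₀)).2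
  have h2 := ContMDiffAt.comp (x := extChartAt I x₀ x₀) (f := (extChartAt I x₀).symm)
    (by rw [extChartAt_to_inv]; exact h1)
    ((contMDiffOn_extChartAt_symm (n := ∞) (I := I) x₀).contMDiffAt (extChartAt_target_mem_nhds x₀))
  refine h2.contDiffAt.congr_of_eventuallyEq ?_
  filter_upwards [extChartAt_target_mem_nhds (I := I) x₀] with y hy
  have hx : (extChartAt I x₀).symm y ∈ (chartAt H x₀).source := by
    rw [← extChartAt_source I]; exact (extChartAt I x₀).map_target hy
  simp only [Function.comp_apply, ContinuousLinearMap.inCoordinates]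
  rw [TangentBundle.symmL_trivializationAt hx, (extChartAt I x₀).right_inv hy]
  simp only [Bundle.Trivial.fiberBundle_trivializationAt', Bundle.Trivial.continuousLinearMapAt_trivialization]
  rfl

theorem contDiffAt_pullEnd [I.Boundaryless] {J : Π x : N, TangentSpace I x →L[ℝ] TangentSpace I x} {x₀ : N}
    (h : ContMDiffAt I (I.prod 𝓘(ℝ, V →L[ℝ] V)) ∞ (fun x => TotalSpace.mk' (V →L[ℝ] V)
      (E := fun x : N => TangentSpace I x →L[ℝ] TangentSpace I x) x (J x)) x₀) :
    ContDiffAt ℝ ∞ (pullEnd I x₀ J) (extChartAt I x₀ x₀) := by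
  have := isManifold_one (I := I) (N := N)
  have h1 := ((contMDiffAt_hom_bundle (IB := I) (F₁ := V) (E₁ := TangentSpace I) (F₂ := V)
    (E₂ := TangentSpace I) _).1 h).2
  have h2 := ContMDiffAt.comp (x := extChartAt I x₀ x₀) (f := (extChartAt I x₀).symm)
    (by rw [extChartAt_to_inv]; exact h1)
    ((contMDiffOn_extChartAt_symm (n := ∞) (I := I) x₀).contMDiffAt (extChartAt_target_mem_nhds x₀))
  refine h2.contDiffAt.congr_of_eventuallyEq ?_
  filter_upwards [extChartAt_target_mem_nhds (I := I) x₀] with y hy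
  have hx : (extChartAt I x₀).symm y ∈ (chartAt H x₀).source := by
    rw [← extChartAt_source I]; exact (extChartAt I x₀).map_target hy
  simp only [Function.comp_apply, ContinuousLinearMap.inCoordinates]
  rw [TangentBundle.symmL_trivializationAt hx, TangentBundle.continuousLinearMapAt_trivializationAt hx,
    (extChartAt I x₀).right_inv hy]
  rfl

theorem contMDiffAt_of_pullEnd [I.Boundaryless]
    {J : Π x : N, TangentSpace I x →L[ℝ] TangentSpace I x} {x₀ : N}
    (h : ContDiffAt ℝ ∞ (pullEnd I x₀ J) (extChartAt I x₀ x₀)) :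
    ContMDiffAt I (I.prod 𝓘(ℝ, V →L[ℝ] V)) ∞ (fun x => TotalSpace.mk' (V →L[ℝ] V)
      (E := fun x : N => TangentSpace I x →L[ℝ] TangentSpace I x) x (J x)) x₀ := by
  have := isManifold_one (I := I) (N := N)
  refine (contMDiffAt_hom_bundle (IB := I) (F₁ := V) (E₁ := TangentSpace I) (F₂ := V)
    (E₂ := TangentSpace I) _).2 ⟨contMDiffAt_id, ?_⟩
  have h1 : ContMDiffAt I 𝓘(ℝ, V →L[ℝ] V) ∞ (fun x => pullEnd I x₀ J (extChartAt I x₀ x)) x₀ :=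
    h.contMDiffAt.comp x₀ contMDiffAt_extChartAt
  refine h1.congr_of_eventuallyEq ?_
  filter_upwards [extChartAt_source_mem_nhds (I := I) x₀] with x hx
  have hx' : x ∈ (chartAt H x₀).source := by rwa [← extChartAt_source I]
  simp only [ContinuousLinearMap.inCoordinates]
  rw [TangentBundle.symmL_trivializationAt hx', TangentBundle.continuousLinearMapAt_trivializationAt hx']
  obtain ⟨y, hy', rfl⟩ : ∃ y ∈ (extChartAt I x₀).target, x = (extChartAt I x₀).symm y :=
    ⟨_, (extChartAt I x₀).map_source hx, ((extChartAt I x₀).left_inv hx).symm⟩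
  rw [(extChartAt I x₀).right_inv hy']
  rfl

theorem contDiffAt_pullField [I.Boundaryless] {X : Π x : N, TangentSpace I x} {x₀ : N}
    (h : ContMDiffAt I I.tangent ∞ (fun y => (⟨y, X y⟩ : TangentBundle I N)) x₀) :
    ContDiffAt ℝ ∞ (pullField I x₀ X) (extChartAt I x₀ x₀) := by
  have := isManifold_one (I := I) (N := N)
  have h1 := (Bundle.contMDiffAt_totalSpace.1 h).2
  have h2 := ContMDiffAt.comp (x := extChartAt I x₀ x₀) (f := (extChartAt I x₀).symm)
    (by rw [extChartAt_to_inv]; exact h1)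
    ((contMDiffOn_extChartAt_symm (n := ∞) (I := I) x₀).contMDiffAt (extChartAt_target_mem_nhds x₀))
  refine h2.contDiffAt.congr_of_eventuallyEq ?_
  filter_upwards [extChartAt_target_mem_nhds (I := I) x₀] with y hy
  have hx : (extChartAt I x₀).symm y ∈ (chartAt H x₀).source := by
    rw [← extChartAt_source I]; exact (extChartAt I x₀).map_target hy
  simp only [Function.comp_apply, pullField, toChart]
  rw [← TangentBundle.continuousLinearMapAt_trivializationAt hx,
    Trivialization.continuousLinearMapAt_apply, Trivialization.coe_linearMapAt_of_mem]
  rwa [TangentBundle.trivializationAt_baseSet]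

/-- The field is constant in the trivialization at `x₀`; smoothness is only required at `x₀`, so no
cutoff function is needed. -/
theorem exists_contMDiffAt_field (x₀ : N) (v : TangentSpace I x₀) :
    ∃ X : Π x : N, TangentSpace I x,
      ContMDiffAt I I.tangent ∞ (fun y => (⟨y, X y⟩ : TangentBundle I N)) x₀ ∧ X x₀ = v := by
  let e := trivializationAt V (TangentSpace I) x₀
  have hx := mem_baseSet_trivializationAt V (TangentSpace I) x₀
  refine ⟨fun x => e.symm x (e ⟨x₀, v⟩).2, ?_, ?_⟩
  · refine Bundle.contMDiffAt_totalSpace.2 ⟨contMDiffAt_id, ?_⟩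
    refine (contMDiffAt_const (c := (e ⟨x₀, v⟩).2)).congr_of_eventuallyEq ?_
    filter_upwards [e.open_baseSet.mem_nhds hx] with x hx
    exact (congrArg Prod.snd (e.apply_mk_symm hx (e ⟨x₀, v⟩).2) :)
  · exact e.symm_apply_apply_mk hx v

/-- The bracket on a manifold is defined by pulling both fields back along the inverse chart. Near
the centre this pullback is `pullField`, because the two chart differentials are inverse to each
other. -/
theorem toChart_mlieBracket [I.Boundaryless] (X Y : Π x : N, TangentSpace I x) (x₀ : N) :
    toChart I x₀ x₀ (VectorField.mlieBracket I X Y x₀) =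
      VectorField.lieBracket ℝ (pullField I x₀ X) (pullField I x₀ Y) (extChartAt I x₀ x₀) := by
  have := isManifold_one (I := I) (N := N)
  have h : ∀ X : Π x : N, TangentSpace I x,
      VectorField.mpullbackWithin 𝓘(ℝ, V) I (extChartAt I x₀).symm X (range I) =ᶠ[𝓝 (extChartAt I x₀ x₀)]
        pullField I x₀ X := by
    intro X
    filter_upwards [extChartAt_target_mem_nhds (I := I) x₀] with y hy
    rw [VectorField.mpullbackWithin_apply, pullField, toChart]
    have hi := ContinuousLinearMap.inverse_eq
      (mfderivWithin_extChartAt_symm_comp_mfderiv_extChartAt (I := I) hy)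
      (mfderiv_extChartAt_comp_mfderivWithin_extChartAt_symm (I := I) hy)
    rw [hi]
    rfl
  rw [← VectorField.mlieBracketWithin_univ, VectorField.mlieBracketWithin_apply, preimage_univ, univ_inter]
  have h2 : ∀ A B : V → V, A =ᶠ[𝓝 (extChartAt I x₀ x₀)] pullField I x₀ X →
      B =ᶠ[𝓝 (extChartAt I x₀ x₀)] pullField I x₀ Y →
      VectorField.lieBracketWithin ℝ A B (range I) (extChartAt I x₀ x₀) =
        VectorField.lieBracket ℝ (pullField I x₀ X) (pullField I x₀ Y) (extChartAt I x₀ x₀) := by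
    intro A B hA hB
    rw [I.range_eq_univ, VectorField.lieBracketWithin_univ]
    exact Filter.EventuallyEq.lieBracket_vectorField_eq hA hB
  rw [h2 _ _ (h X) (h Y)]
  obtain ⟨e, he⟩ := isInvertible_mfderiv_extChartAt (I := I) (mem_extChartAt_source (I := I) x₀)
  rw [toChart, ← he, ContinuousLinearMap.inverse_equiv]
  exact e.apply_symm_apply _

theorem pullField_apply {x₀ : N} {J : Π x : N, TangentSpace I x →L[ℝ] TangentSpace I x}
    (X : Π x : N, TangentSpace I x) {y : V} (hy : y ∈ (extChartAt I x₀).target) :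
    pullField I x₀ (fun x => J x (X x)) y = pullEnd I x₀ J y (pullField I x₀ X y) := by
  simp only [pullEnd, pullField, ContinuousLinearMap.comp_apply]
  rw [fromChart_toChart I x₀ hy]

theorem toChart_end (x₀ : N) (J : Π x : N, TangentSpace I x →L[ℝ] TangentSpace I x)
    {x : N} (hx : x ∈ (extChartAt I x₀).source) (v : TangentSpace I x) :
    toChart I x₀ x (J x v) = pullEnd I x₀ J (extChartAt I x₀ x) (toChart I x₀ x v) := by
  obtain ⟨y, hy', rfl⟩ : ∃ y ∈ (extChartAt I x₀).target, x = (extChartAt I x₀).symm y :=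
    ⟨_, (extChartAt I x₀).map_source hx, ((extChartAt I x₀).left_inv hx).symm⟩
  rw [(extChartAt I x₀).right_inv hy']
  simp only [pullEnd, ContinuousLinearMap.comp_apply]
  rw [fromChart_toChart I x₀ hy']

/-- At a point, the Nijenhuis bracket of an almost-complex structure vanishes if and only if the
`(0,2)`-part of the exterior derivative of a coframe of type `(1,0)` vanishes. -/
theorem nijenhuis_eq_zero_iff [I.Boundaryless] {K : Type*} [NormedAddCommGroup K]
    [NormedSpace ℝ K] [NormedSpace ℂ K] [IsScalarTower ℝ ℂ K] (J : AlmostComplexStructure I N) (x₀ : N)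
    {L : V → V →L[ℝ] K} (hL : DifferentiableAt ℝ L (extChartAt I x₀ x₀))
    (hinj : Function.Injective (L (extChartAt I x₀ x₀)))
    (h : ∀ᶠ y in 𝓝 (extChartAt I x₀ x₀), ∀ v, L y (pullEnd I x₀ J.toFun y v) = Complex.I • L y v) :
    (∀ X Y : Π x : N, TangentSpace I x,
      ContMDiffAt I I.tangent ∞ (fun y => (⟨y, X y⟩ : TangentBundle I N)) x₀ →
      ContMDiffAt I I.tangent ∞ (fun y => (⟨y, Y y⟩ : TangentBundle I N)) x₀ →
      J.nijenhuis X Y x₀ = 0) ↔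
    ∀ u w : V, part02 (pullEnd I x₀ J.toFun (extChartAt I x₀ x₀)) (dForm L (extChartAt I x₀ x₀)) u w = 0 := by
  have hJ : DifferentiableAt ℝ (pullEnd I x₀ J.toFun) (extChartAt I x₀ x₀) :=
    (contDiffAt_pullEnd I (J.smooth x₀)).differentiableAt (by simp)
  have hnhds := extChartAt_target_mem_nhds (I := I) x₀
  have key : ∀ X Y : Π x : N, TangentSpace I x,
      ContMDiffAt I I.tangent ∞ (fun y => (⟨y, X y⟩ : TangentBundle I N)) x₀ →
      ContMDiffAt I I.tangent ∞ (fun y => (⟨y, Y y⟩ : TangentBundle I N)) x₀ →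
      (J.nijenhuis X Y x₀ = 0 ↔ part02 (pullEnd I x₀ J.toFun (extChartAt I x₀ x₀))
        (dForm L (extChartAt I x₀ x₀)) (toChart I x₀ x₀ (X x₀)) (toChart I x₀ x₀ (Y x₀)) = 0) := by
    intro X Y hX hY
    have hX' := (contDiffAt_pullField I hX).differentiableAt (by simp)
    have hY' := (contDiffAt_pullField I hY).differentiableAt (by simp)
    have eX : pullField I x₀ (fun y => J.toFun y (X y)) =ᶠ[𝓝 (extChartAt I x₀ x₀)]
        fun y => pullEnd I x₀ J.toFun y (pullField I x₀ X y) := by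
      filter_upwards [hnhds] with y hy using pullField_apply I X hy
    have eY : pullField I x₀ (fun y => J.toFun y (Y y)) =ᶠ[𝓝 (extChartAt I x₀ x₀)]
        fun y => pullEnd I x₀ J.toFun y (pullField I x₀ Y y) := by
      filter_upwards [hnhds] with y hy using pullField_apply I Y hy
    have hsrc := mem_extChartAt_source (I := I) x₀
    -- The chart differential at `x₀` and the coframe `L` are both injective, so the vanishing of
    -- the bracket can be tested after applying them.
    rw [← pullField_self, ← pullField_self, ← apply_nijenhuis hL hJ hX' hY' h,
      ← (toChart_bijective I x₀ hsrc).1.eq_iff, ← hinj.eq_iff, map_zero, map_zero]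
    simp only [AlmostComplexStructure.nijenhuis, map_sub, toChart_end I x₀ J.toFun hsrc,
      toChart_mlieBracket]
    rw [Filter.EventuallyEq.lieBracket_vectorField_eq eX eY,
      Filter.EventuallyEq.lieBracket_vectorField_eq eX Filter.EventuallyEq.rfl,
      Filter.EventuallyEq.lieBracket_vectorField_eq Filter.EventuallyEq.rfl eY]
  constructor
  · intro hN u w
    obtain ⟨X, hX, hXu⟩ := exists_contMDiffAt_field I x₀ (u : TangentSpace I x₀)
    obtain ⟨Y, hY, hYw⟩ := exists_contMDiffAt_field I x₀ (w : TangentSpace I x₀)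
    have := (key X Y hX hY).1 (hN X Y hX hY)
    rwa [show toChart I x₀ x₀ (X x₀) = u from (toChart_self I x₀ _).trans hXu,
      show toChart I x₀ x₀ (Y x₀) = w from (toChart_self I x₀ _).trans hYw] at this
  · intro h0 X Y hX hY
    exact (key X Y hX hY).2 (h0 _ _)

end Coordinates

/-! ### Monomials in the symmetric power -/

section SymmetricPower

open scoped TensorProduct

open MvPolynomial

variable {k : ℕ} {U : Type*} [AddCommGroup U] [Module ℝ U]

/-- The symmetric product `x^(k-i) y^i`. -/
def symMonomial (k : ℕ) (x y : U) (i : ℕ) : Sym[ℝ]^k U :=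
  SymmetricPower.tprod ℝ fun a : Fin k => if (a : ℕ) < k - i then x else y

/-- A symmetric product does not depend on the order of its factors: the bijection from the first
slots to the slots holding `x` extends to a permutation of all slots. -/
theorem tprod_ite_eq_symMonomial (x y : U) (r : Fin k → Fin 2) :
    SymmetricPower.tprod ℝ (fun a => if r a = 0 then x else y) =
      symMonomial k x y (Fintype.card {a // r a ≠ 0}) := by
  classical
  have hc : Fintype.card {a // r a ≠ 0} = k - Fintype.card {a // r a = 0} := by
    rw [Fintype.card_subtype_compl, Fintype.card_fin]
  have hle : Fintype.card {a // r a = 0} ≤ k := by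
    simpa using Fintype.card_subtype_le (fun a : Fin k => r a = 0)
  have hcard : Fintype.card {a : Fin k // (a : ℕ) < k - Fintype.card {a // r a ≠ 0}} =
      Fintype.card {a // r a = 0} := by
    rw [hc, Nat.sub_sub_self hle, Fintype.card_subtype, Fin.card_filter_val_lt, min_eq_right hle]
  let e := Fintype.equivOfCardEq hcard
  rw [← SymmetricPower.tprod_equiv e.extendSubtype, symMonomial]
  congr 1
  funext a
  by_cases ha : (a : ℕ) < k - Fintype.card {a // r a ≠ 0}
  · rw [if_pos ha, if_pos (e.extendSubtype_mem a ha)]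
  · rw [if_neg ha, if_neg (e.extendSubtype_not_mem a ha)]

theorem monomialCoords_prod_X (r : Fin k → Fin 2) (j : Fin (k + 1)) :
    monomialCoords k (∏ a, X (r a)) j = if (j : ℕ) = Fintype.card {a // r a ≠ 0} then 1 else 0 := by
  classical
  have h : (∏ a, X (r a) : MvPolynomial (Fin 2) ℝ) = monomial (∑ a, Finsupp.single (r a) 1) 1 := by
    rw [monomial_sum_one]
    rfl
  rw [h, monomialCoords, coeff_monomial]
  have h0 : (∑ a, Finsupp.single (r a) 1 : Fin 2 →₀ ℕ) 0 = Fintype.card {a // r a = 0} := by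
    rw [Finsupp.finsetSum_apply, Fintype.card_subtype, Finset.card_filter]
    exact Finset.sum_congr rfl fun a _ => Finsupp.single_apply
  have h1 : (∑ a, Finsupp.single (r a) 1 : Fin 2 →₀ ℕ) 1 = Fintype.card {a // r a ≠ 0} := by
    rw [Finsupp.finsetSum_apply, Fintype.card_subtype, Finset.card_filter]
    refine Finset.sum_congr rfl fun a _ => ?_
    rw [Finsupp.single_apply]
    exact if_congr (by omega) rfl rfl
  have hc : Fintype.card {a // r a ≠ 0} = k - Fintype.card {a // r a = 0} := by
    rw [Fintype.card_subtype_compl, Fintype.card_fin]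
  have hle : Fintype.card {a // r a = 0} ≤ k := by
    simpa using Fintype.card_subtype_le (fun a : Fin k => r a = 0)
  refine if_congr ⟨fun h => ?_, fun h => ?_⟩ rfl rfl
  · have := DFunLike.congr_fun h 1
    rw [h1] at this
    simpa using this.symm
  · ext b
    fin_cases b
    · simp only [Fin.zero_eta, h0]
      simp
      omega
    · simp only [Fin.mk_one, h1]
      simp [h]

/-- The linear map `linForm`. -/
def linFormLM : Plane →ₗ[ℝ] MvPolynomial (Fin 2) ℝ where
  toFun := linForm
  map_add' u v := by simp [linForm]; ring
  map_smul' r u := by simp [linForm, smul_eq_C_mul]; ring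

/-- The coefficients `monomialCoords`, as a linear map. -/
def monomialCoordsLM (k : ℕ) : MvPolynomial (Fin 2) ℝ →ₗ[ℝ] Poly k where
  toFun := monomialCoords k
  map_add' P Q := by funext i; simp [monomialCoords]
  map_smul' r P := by funext i; simp [monomialCoords]

/-- The linear combination of the `x^(k-i) y^i` with the given coefficients. -/
def symCombination (k : ℕ) (x y : U) : Poly k →ₗ[ℝ] Sym[ℝ]^k U :=
  Fintype.linearCombination ℝ fun i : Fin (k + 1) => symMonomial k x y i

theorem symCombination_apply (x y : U) (P : Poly k) :
    symCombination k x y P = ∑ i : Fin (k + 1), P i • symMonomial k x y i := rfl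

/-- Expansion of a symmetric product of linear combinations of `x` and `y`. -/
theorem tprod_eq_symCombination (x y : U) (u : Fin k → Plane) :
    SymmetricPower.tprod ℝ (fun a => u a 0 • x + u a 1 • y) =
      symCombination k x y (monomialCoords k (∏ a, linForm (u a))) := by
  classical
  let lin : Plane →ₗ[ℝ] U :=
    (LinearMap.proj 0).smulRight x + (LinearMap.proj 1).smulRight y
  let f₁ : MultilinearMap ℝ (fun _ : Fin k => Plane) (Sym[ℝ]^k U) :=
    (SymmetricPower.tprod ℝ).compLinearMap fun _ => lin
  let f₂ : MultilinearMap ℝ (fun _ : Fin k => Plane) (Sym[ℝ]^k U) :=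
    (symCombination k x y ∘ₗ monomialCoordsLM k).compMultilinearMap
      ((MultilinearMap.mkPiAlgebra ℝ (Fin k) (MvPolynomial (Fin 2) ℝ)).compLinearMap
        fun _ => linFormLM)
  -- Both sides are multilinear in `u`, so it suffices to take every `u a` in the standard basis,
  -- where the product of linear forms is a single monomial.
  have h : f₁ = f₂ := by
    refine Module.Basis.ext_multilinear (fun _ => Pi.basisFun ℝ (Fin 2)) fun r => ?_
    have e1 : f₁ (fun a => Pi.basisFun ℝ (Fin 2) (r a)) =
        SymmetricPower.tprod ℝ (fun a => if r a = 0 then x else y) := by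
      change SymmetricPower.tprod ℝ (fun a => lin (Pi.basisFun ℝ (Fin 2) (r a))) = _
      congr 1
      funext a
      rcases Fin.exists_fin_two.1 ⟨r a, rfl⟩ with h | h <;> simp [lin, h]
    have e2 : f₂ (fun a => Pi.basisFun ℝ (Fin 2) (r a)) =
        symCombination k x y (monomialCoords k (∏ a, X (r a))) := by
      change symCombination k x y (monomialCoords k (∏ a, linForm (Pi.basisFun ℝ (Fin 2) (r a)))) = _
      congr 2
      refine Finset.prod_congr rfl fun a _ => ?_
      rcases Fin.exists_fin_two.1 ⟨r a, rfl⟩ with h | h <;> simp [linForm, h]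
    rw [e1, e2, tprod_ite_eq_symMonomial, symCombination_apply]
    simp only [monomialCoords_prod_X, ite_smul, one_smul, zero_smul]
    have hlt : Fintype.card {a // r a ≠ 0} < k + 1 := by
      have := Fintype.card_subtype_le (fun a : Fin k => r a ≠ 0)
      rw [Fintype.card_fin] at this
      omega
    rw [Finset.sum_eq_single ⟨_, hlt⟩]
    · simp
    · intro b _ hb
      rw [if_neg fun h => hb (Fin.ext h)]
    · simp
  exact congrArg (fun f : MultilinearMap ℝ (fun _ : Fin k => Plane) (Sym[ℝ]^k U) => f u) h

/-- Changing the pair of vectors amounts to substituting in the polynomial, since products of linear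
forms expand alike in both places. Applied to two frames it gives the equivariance of `ω`; applied
to a frame and a local basis of sections it gives smoothness. -/
theorem symCombination_substMap (x y : U) (c : Plane × Plane) (P : Poly k) :
    symCombination k (c.1 0 • x + c.1 1 • y) (c.2 0 • x + c.2 1 • y) P =
      symCombination k x y (substMap k c P) := by
  rw [substMap_apply, map_sum, symCombination_apply]
  refine Finset.sum_congr rfl fun i _ => ?_
  rw [map_smul]
  congr 1
  have h := tprod_eq_symCombination x y fun a : Fin k => if (a : ℕ) < k - i then c.1 else c.2
  have h1 : (fun a : Fin k => (if (a : ℕ) < k - i then c.1 else c.2) 0 • x +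
      (if (a : ℕ) < k - i then c.1 else c.2) 1 • y) = fun a : Fin k => if (a : ℕ) < k - i then
        c.1 0 • x + c.1 1 • y else c.2 0 • x + c.2 1 • y := by
    funext a
    split_ifs <;> rfl
  rw [h1] at h
  rw [symMonomial, h]
  congr 2
  have h2 : ∀ a : Fin k, linForm (if (a : ℕ) < k - i then c.1 else c.2) =
      if (a : ℕ) < k - i then linForm c.1 else linForm c.2 := fun a => apply_ite _ _ _ _
  rw [Finset.prod_congr rfl fun a _ => h2 a, Finset.prod_ite, Finset.prod_const, Finset.prod_const]
  have h3 := Nat.lt_succ_iff.1 i.2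
  have h4 : (Finset.univ.filter fun a : Fin k => (a : ℕ) < k - i).card = k - i := by
    rw [Fin.card_filter_val_lt]; omega
  have h5 := Finset.card_filter_add_card_filter_not (s := (Finset.univ : Finset (Fin k))) (fun a : Fin k => (a : ℕ) < k - i)
  rw [h4, Finset.card_univ, Fintype.card_fin] at h5
  rw [h4, show (Finset.univ.filter fun a : Fin k => ¬ (a : ℕ) < k - i).card = i by omega]

/-- The symmetric products span the symmetric power, and each of them expands in monomials.
Injectivity is not needed here: it comes later from the dimension of `M`. -/
theorem symCombination_surjective {x y : U} (h : ∀ v : U, ∃ u : Plane, v = u 0 • x + u 1 • y) :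
    Function.Surjective (symCombination k x y) := by
  rw [← LinearMap.range_eq_top, eq_top_iff, ← SymmetricPower.span_tprod_eq_top, Submodule.span_le]
  rintro _ ⟨f, rfl⟩
  choose u hu using fun a => h (f a)
  refine ⟨_, (tprod_eq_symCombination x y u).symm.trans ?_⟩
  congr 1
  funext a
  exact (hu a).symm

end SymmetricPower

/-! ### Charts of `B(E)` and of `B(E)/CO(2)` -/

section FrameCoordinates

variable {k : ℕ} {M : Type*} [TopologicalSpace M] [ChartedSpace (EuclideanSpace ℝ (Fin (k + 1))) M]
  {E : M → Type*} [∀ p, AddCommGroup (E p)] [∀ p, Module ℝ (E p)]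
  [TopologicalSpace (TotalSpace Plane E)] [∀ p, TopologicalSpace (E p)]
  [FiberBundle Plane E] [VectorBundle ℝ Plane E]

/-- The components of a basis in a trivialization of `E`. -/
def frameCoords (e : Trivialization Plane (π Plane E)) [e.IsLinear ℝ] (χ : FrameBundle E) :
    Plane × Plane :=
  (e.continuousLinearMapAt ℝ χ.1.proj χ.1.2.1, e.continuousLinearMapAt ℝ χ.1.proj χ.1.2.2)

theorem frameCoords_eq (e : Trivialization Plane (π Plane E)) [e.IsLinear ℝ] (χ : FrameBundle E)
    (hχ : χ.1.proj ∈ e.baseSet) : frameCoords e χ = ((e.prod e) χ.1).2 := by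
  simp only [frameCoords, Trivialization.continuousLinearMapAt_apply,
    Trivialization.coe_linearMapAt_of_mem (R := ℝ) e hχ]
  rfl

theorem frameCoords_act (e : Trivialization Plane (π Plane E)) [e.IsLinear ℝ] (χ : FrameBundle E)
    (g : GL (Fin 2) ℝ) : frameCoords e (χ.act g) = pairMul (frameCoords e χ) g := by
  simp only [frameCoords, pairMul, ← map_smul, ← map_add]
  rfl

/-- The chart domain is the full preimage of an open subset of `M`, hence stable under `GL(2)`. This
is why equivariance can be expressed within a single chart. -/
theorem mem_frame_source {χ₀ χ : FrameBundle E} :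
    χ ∈ (extChartAt (frameModel k) χ₀).source ↔
      χ.1.proj ∈ (chartAt (EuclideanSpace ℝ (Fin (k + 1))) χ₀.1.proj).source ∧
        χ.1.proj ∈ (trivializationAt Plane E χ₀.1.proj).baseSet := by
  rw [extChartAt_source, TopologicalSpace.Opens.chartAt_eq, OpenPartialHomeomorph.subtypeRestr_source,
    mem_preimage, FiberBundle.chartedSpace_chartAt]
  simp only [OpenPartialHomeomorph.trans_source, mem_inter_iff, mem_preimage]
  constructor
  · rintro ⟨h1, h2⟩
    have h1' := (Trivialization.mem_source _).1 h1
    exact ⟨h2.1, h1'.1⟩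
  · rintro ⟨h1, h2⟩
    exact ⟨(Trivialization.mem_source _).2 ⟨h2, h2⟩, h1, trivial⟩

theorem extChartAt_frame (χ₀ χ : FrameBundle E)
    (hχ : χ.1.proj ∈ (trivializationAt Plane E χ₀.1.proj).baseSet) :
    extChartAt (frameModel k) χ₀ χ =
      (extChartAt (𝓡 (k + 1)) χ₀.1.proj χ.1.proj,
        frameCoords (trivializationAt Plane E χ₀.1.proj) χ) := by
  rw [frameCoords_eq _ _ hχ]
  rfl

theorem mem_quotient_source {q₀ q : COQuotient E} :
    q ∈ (extChartAt (quotientModel k) q₀).source ↔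
      q.proj ∈ (chartAt (EuclideanSpace ℝ (Fin (k + 1))) q₀.proj).source ∧
        q.proj ∈ (trivializationAt Plane E q₀.proj).baseSet := by
  rw [extChartAt_source]
  change q ∈ (_ ≫ₕ _ : OpenPartialHomeomorph _ _).source ↔ _
  rw [OpenPartialHomeomorph.trans_source]
  constructor
  · rintro ⟨h1, h2⟩
    exact ⟨h2.1, h1⟩
  · rintro ⟨h1, h2⟩
    exact ⟨h2, h1, trivial⟩

theorem extChartAt_quotient (q₀ q : COQuotient E) :
    extChartAt (quotientModel k) q₀ q =
      (extChartAt (𝓡 (k + 1)) q₀.proj q.proj, q.slopeAt (trivializationAt Plane E q₀.proj)) := rfl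

theorem contMDiff_frame_proj :
    ContMDiff (frameModel k) (𝓡 (k + 1)) ∞ (fun χ : FrameBundle E => χ.1.proj) := fun _ =>
  (Bundle.contMDiffAt_totalSpace.1 (contMDiff_subtype_val (I := frameModel k) (n := ∞)).contMDiffAt).1

theorem continuous_frame_proj : Continuous fun χ : FrameBundle E => χ.1.proj :=
  (FiberBundle.continuous_proj (Plane × Plane) (E ×ᵇ E)).comp continuous_subtype_val

theorem continuous_act (g : GL (Fin 2) ℝ) : Continuous fun χ : FrameBundle E => χ.act g := by
  rw [continuous_induced_rng, continuous_iff_continuousAt]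
  intro χ
  rw [FiberBundle.continuousAt_totalSpace]
  refine ⟨continuous_frame_proj.continuousAt, ?_⟩
  let e := trivializationAt Plane E χ.1.proj
  have hχ : χ.1.proj ∈ e.baseSet := mem_baseSet_trivializationAt Plane E χ.1.proj
  have h1 : ContinuousAt (fun χ' : FrameBundle E => ((e.prod e) χ'.1).2) χ :=
    ((FiberBundle.continuousAt_totalSpace (Plane × Plane) (E := E ×ᵇ E) (fun χ : FrameBundle E => χ.1)).1
      continuous_subtype_val.continuousAt).2
  have h2 : Continuous fun c : Plane × Plane => pairMul c g := by
    unfold pairMul; fun_prop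
  refine (h2.continuousAt.comp h1).congr ?_
  have hn : ∀ᶠ χ' : FrameBundle E in 𝓝 χ, χ'.1.proj ∈ e.baseSet :=
    continuous_frame_proj.continuousAt (e.open_baseSet.mem_nhds hχ)
  filter_upwards [hn] with χ' hχ'
  rw [Function.comp_apply, ← frameCoords_eq _ _ hχ', ← frameCoords_act, frameCoords_eq]
  · rfl
  · exact hχ'

theorem contDiff_pairMul (A : Matrix (Fin 2) (Fin 2) ℝ) {n : ℕ∞ω} :
    ContDiff ℝ n fun c : Plane × Plane => pairMul c A := by
  unfold pairMul; fun_prop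

theorem contMDiff_act (g : GL (Fin 2) ℝ) :
    ContMDiff (frameModel k) (frameModel k) ∞ (fun χ : FrameBundle E => χ.act g) := by
  intro χ
  rw [contMDiffAt_iff_target]
  refine ⟨(continuous_act g).continuousAt, ?_⟩
  have h1 : ContMDiffAt (frameModel k) 𝓘(ℝ, EuclideanSpace ℝ (Fin (k + 1)) × (Plane × Plane)) ∞
      (extChartAt (frameModel k) χ) χ := contMDiffAt_extChartAt
  have h2 : ContDiff ℝ ∞ fun y : EuclideanSpace ℝ (Fin (k + 1)) × (Plane × Plane) =>
      (y.1, pairMul y.2 g) := contDiff_fst.prodMk ((contDiff_pairMul _).comp contDiff_snd)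
  refine (h2.contMDiff.contMDiffAt.comp χ h1).congr_of_eventuallyEq ?_
  filter_upwards [extChartAt_source_mem_nhds (I := frameModel k) χ] with χ' hχ'
  rw [mem_frame_source] at hχ'
  rw [Function.comp_apply, Function.comp_apply, extChartAt_frame χ χ' hχ'.2,
    extChartAt_frame (χ.act g) (χ'.act g) hχ'.2, frameCoords_act]
  rfl

end FrameCoordinates

/-! ### The chain rule in charts -/

section ChainRule

variable {V H N V' H' N' : Type*} [NormedAddCommGroup V] [NormedSpace ℝ V] [TopologicalSpace H]
  (I : ModelWithCorners ℝ V H) [TopologicalSpace N] [ChartedSpace H N]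
  [NormedAddCommGroup V'] [NormedSpace ℝ V'] [TopologicalSpace H']
  (I' : ModelWithCorners ℝ V' H') [TopologicalSpace N'] [ChartedSpace H' N']
  [IsManifold I ∞ N] [IsManifold I' ∞ N']

theorem mdifferentiableAt_chart {x₀ x : N} (hx : x ∈ (extChartAt I x₀).source) :
    MDifferentiableAt I 𝓘(ℝ, V) (extChartAt I x₀) x :=
  have := isManifold_one (I := I) (N := N)
  mdifferentiableAt_extChartAt (by rwa [← extChartAt_source I])

/-- The charts are centred at `x₀` and `x₀'`, not at `x` and `f x`: local expressions must be
compared at all points near the centre. -/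
theorem toChart_mfderiv {f : N → N'} {x₀ x : N} {x₀' : N'} {F : V → V'}
    (hx : x ∈ (extChartAt I x₀).source) (hx' : f x ∈ (extChartAt I' x₀').source)
    (hf : MDifferentiableAt I I' f x) (hF : DifferentiableAt ℝ F (extChartAt I x₀ x))
    (h : ∀ᶠ y in 𝓝 x, extChartAt I' x₀' (f y) = F (extChartAt I x₀ y)) (v : TangentSpace I x) :
    toChart I' x₀' (f x) (mfderiv I I' f x v) = fderiv ℝ F (extChartAt I x₀ x) (toChart I x₀ x v) := by
  have h1 : mfderiv I 𝓘(ℝ, V') (extChartAt I' x₀' ∘ f) x = (toChart I' x₀' (f x)).comp (mfderiv I I' f x) :=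
    mfderiv_comp x (mdifferentiableAt_chart I' hx') hf
  have h2 : mfderiv I 𝓘(ℝ, V') (F ∘ extChartAt I x₀) x =
      (mfderiv 𝓘(ℝ, V) 𝓘(ℝ, V') F (extChartAt I x₀ x)).comp (toChart I x₀ x) :=
    mfderiv_comp x hF.mdifferentiableAt (mdifferentiableAt_chart I hx)
  have h3 : mfderiv I 𝓘(ℝ, V') (extChartAt I' x₀' ∘ f) x = mfderiv I 𝓘(ℝ, V') (F ∘ extChartAt I x₀) x :=
    Filter.EventuallyEq.mfderiv_eq h
  rw [h1, h2, mfderiv_eq_fderiv] at h3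
  exact DFunLike.congr_fun h3 v

end ChainRule

/-! ### The soldering form and its equivariance -/

section Solder

open scoped TensorProduct

variable {k : ℕ} {M : Type*} [TopologicalSpace M] [ChartedSpace (EuclideanSpace ℝ (Fin (k + 1))) M]
  [IsManifold (𝓡 (k + 1)) ∞ M]
  {E : M → Type*} [∀ p, AddCommGroup (E p)] [∀ p, Module ℝ (E p)]
  [TopologicalSpace (TotalSpace Plane E)] [∀ p, TopologicalSpace (E p)]
  [FiberBundle Plane E] [VectorBundle ℝ Plane E]

theorem exists_combination {p : M} {x y : E p} (h : LinearIndependent ℝ ![x, y]) (v : E p) :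
    ∃ u : Plane, v = u 0 • x + u 1 • y := by
  let e := trivializationAt Plane E p
  have hp : p ∈ e.baseSet := mem_baseSet_trivializationAt Plane E p
  have hd : Module.finrank ℝ (E p) = 2 := by
    rw [(e.linearEquivAt ℝ p hp).finrank_eq]; simp
  have := Module.finite_of_finrank_pos (R := ℝ) (M := E p) (by omega)
  have hs := h.span_eq_top_of_card_eq_finrank' (by simp [hd])
  have hv : v ∈ Submodule.span ℝ (range ![x, y]) := by rw [hs]; trivial
  rw [Matrix.range_cons_cons_empty, Submodule.mem_span_pair] at hv
  obtain ⟨a, b, hab⟩ := hv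
  exact ⟨![a, b], by simpa using hab.symm⟩

namespace GL2Structure

variable (S : GL2Structure k E)

theorem frameMap_apply (χ : FrameBundle E) (P : Poly k) :
    S.frameMap χ P = S.iso χ.1.proj (symCombination k χ.1.2.1 χ.1.2.2 P) := by
  simp [frameMap, symCombination_apply, frameVector, symMonomial]

theorem frameMap_act (χ : FrameBundle E) (g : GL (Fin 2) ℝ) (P : Poly k) :
    S.frameMap (χ.act g) P = S.frameMap χ (substMap k (columns g) P) := by
  rw [frameMap_apply, frameMap_apply, ← symCombination_substMap]
  rfl

/-- Monomials in a basis span `S^k`, and `T_p M` has dimension `k + 1`. Injectivity follows by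
counting dimensions, so the independence of the monomials needs no proof of its own. -/
theorem frameMap_bijective (χ : FrameBundle E) : Function.Bijective (S.frameMap χ) := by
  have hs : Function.Surjective (S.frameMap χ) := by
    intro v
    obtain ⟨P, hP⟩ := symCombination_surjective (k := k) (exists_combination χ.2) ((S.iso _).symm v)
    exact ⟨P, by rw [frameMap_apply, hP, LinearEquiv.apply_symm_apply]⟩
  have hd : Module.finrank ℝ (Poly k) = Module.finrank ℝ (TangentSpace (𝓡 (k + 1)) χ.1.proj) := by
    change _ = Module.finrank ℝ (EuclideanSpace ℝ (Fin (k + 1)))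
    simp
  have : FiniteDimensional ℝ (TangentSpace (𝓡 (k + 1)) χ.1.proj) :=
    inferInstanceAs (FiniteDimensional ℝ (EuclideanSpace ℝ (Fin (k + 1))))
  exact ⟨(LinearMap.injective_iff_surjective_of_finrank_eq_finrank hd (f := (S.frameMap χ).toLinearMap)).2 hs, hs⟩

theorem frameMap_invertible (χ : FrameBundle E) : (S.frameMap χ).IsInvertible := by
  have : FiniteDimensional ℝ (TangentSpace (𝓡 (k + 1)) χ.1.proj) :=
    inferInstanceAs (FiniteDimensional ℝ (EuclideanSpace ℝ (Fin (k + 1))))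
  have : T2Space (TangentSpace (𝓡 (k + 1)) χ.1.proj) :=
    inferInstanceAs (T2Space (EuclideanSpace ℝ (Fin (k + 1))))
  exact ⟨(LinearEquiv.ofBijective (S.frameMap χ).toLinearMap (S.frameMap_bijective χ)).toContinuousLinearEquiv,
    by ext1 x; rfl⟩

theorem frameMap_solder (χ : FrameBundle E) (v : TangentSpace (frameModel k) χ) :
    S.frameMap χ (S.solder χ v) =
      mfderiv (frameModel k) (𝓡 (k + 1)) (fun χ : FrameBundle E => χ.1.proj) χ v := by
  obtain ⟨e, he⟩ := S.frameMap_invertible χ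
  rw [solder, ← he, ContinuousLinearMap.inverse_equiv]
  exact e.apply_symm_apply _

/-- The projection to `M` is unchanged by the action, so the coordinates of a vector transform
inversely to the frame. -/
theorem solder_act [ContMDiffVectorBundle ∞ Plane E (𝓡 (k + 1))] (χ : FrameBundle E)
    (g : GL (Fin 2) ℝ) (v : TangentSpace (frameModel k) χ) :
    S.solder χ v = substMap k (columns g) (S.solder (χ.act g)
      (mfderiv (frameModel k) (frameModel k) (fun χ : FrameBundle E => χ.act g) χ v)) := by
  apply (S.frameMap_bijective χ).1
  rw [← frameMap_act, frameMap_solder, frameMap_solder]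
  have h : mfderiv (frameModel k) (𝓡 (k + 1))
      ((fun χ : FrameBundle E => χ.1.proj) ∘ fun χ : FrameBundle E => χ.act g) χ = _ :=
    mfderiv_comp χ ((contMDiff_frame_proj (χ.act g)).mdifferentiableAt (by simp))
      ((contMDiff_act g χ).mdifferentiableAt (by simp))
  exact DFunLike.congr_fun h v

end GL2Structure

end Solder

/-! ### One-parameter subgroups and fundamental vector fields -/

section Exponential

attribute [local instance] Matrix.linftyOpNormedRing Matrix.linftyOpNormedAlgebra

theorem hasDerivAt_expGL (A : Matrix (Fin 2) (Fin 2) ℝ) (i j : Fin 2) :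
    HasDerivAt (fun t : ℝ => (expGL (t • A) : Matrix (Fin 2) (Fin 2) ℝ) i j) (A i j) 0 := by
  have h := hasDerivAt_exp_smul_const (𝕂 := ℝ) A (0 : ℝ)
  rw [zero_smul, NormedSpace.exp_zero, one_mul] at h
  let l : Matrix (Fin 2) (Fin 2) ℝ →L[ℝ] ℝ := LinearMap.toContinuousLinearMap (Matrix.entryLinearMap ℝ ℝ i j)
  exact l.hasFDerivAt.comp_hasDerivAt (0 : ℝ) h

theorem expGL_zero : expGL 0 = 1 := by
  apply Units.ext
  simp [expGL]

end Exponential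

section FrameDerivatives

open scoped TensorProduct

variable {k : ℕ} {M : Type*} [TopologicalSpace M] [ChartedSpace (EuclideanSpace ℝ (Fin (k + 1))) M]
  {E : M → Type*} [∀ p, AddCommGroup (E p)] [∀ p, Module ℝ (E p)]
  [TopologicalSpace (TotalSpace Plane E)] [∀ p, TopologicalSpace (E p)]
  [FiberBundle Plane E] [VectorBundle ℝ Plane E]

theorem mem_frame_source_act {χ₀ χ : FrameBundle E} (g : GL (Fin 2) ℝ)
    (hχ : χ ∈ (extChartAt (frameModel k) χ₀).source) : χ.act g ∈ (extChartAt (frameModel k) χ₀).source :=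
  mem_frame_source.2 (mem_frame_source.1 hχ)

/-- The action of a matrix on the fibre coordinates of `B(E)`. -/
def actCoords {V : Type*} [NormedAddCommGroup V] [NormedSpace ℝ V] (A : Matrix (Fin 2) (Fin 2) ℝ) :
    V × (Plane × Plane) →L[ℝ] V × (Plane × Plane) :=
  (ContinuousLinearMap.id ℝ V).prodMap
    (((A 0 0 • ContinuousLinearMap.fst ℝ Plane Plane + A 1 0 • ContinuousLinearMap.snd ℝ Plane Plane)).prod
      (A 0 1 • ContinuousLinearMap.fst ℝ Plane Plane + A 1 1 • ContinuousLinearMap.snd ℝ Plane Plane))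

theorem actCoords_apply {V : Type*} [NormedAddCommGroup V] [NormedSpace ℝ V]
    (A : Matrix (Fin 2) (Fin 2) ℝ) (y : V × (Plane × Plane)) :
    actCoords A y = (y.1, pairMul y.2 A) := rfl

theorem extChartAt_frame_act {χ₀ χ : FrameBundle E} (g : GL (Fin 2) ℝ)
    (hχ : χ ∈ (extChartAt (frameModel k) χ₀).source) :
    extChartAt (frameModel k) χ₀ (χ.act g) =
      actCoords (g : Matrix (Fin 2) (Fin 2) ℝ) (extChartAt (frameModel k) χ₀ χ) := by
  rw [extChartAt_frame χ₀ χ (mem_frame_source.1 hχ).2,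
    extChartAt_frame χ₀ (χ.act g) (mem_frame_source.1 (mem_frame_source_act g hχ)).2, frameCoords_act,
    actCoords_apply]
  rfl

variable [IsManifold (𝓡 (k + 1)) ∞ M] [ContMDiffVectorBundle ∞ Plane E (𝓡 (k + 1))]

theorem toChart_mfderiv_proj {χ₀ χ : FrameBundle E} (hχ : χ ∈ (extChartAt (frameModel k) χ₀).source)
    (v : TangentSpace (frameModel k) χ) :
    toChart (𝓡 (k + 1)) χ₀.1.proj χ.1.proj
      (mfderiv (frameModel k) (𝓡 (k + 1)) (fun χ : FrameBundle E => χ.1.proj) χ v) =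
        (toChart (frameModel k) χ₀ χ v).1 := by
  have h := toChart_mfderiv (frameModel k) (𝓡 (k + 1)) (f := fun χ : FrameBundle E => χ.1.proj)
    (x₀' := χ₀.1.proj) (F := Prod.fst) hχ
    (by rw [extChartAt_source]; exact (mem_frame_source.1 hχ).1)
    ((contMDiff_frame_proj χ).mdifferentiableAt (by simp)) differentiableAt_fst (by
      filter_upwards [(isOpen_extChartAt_source (I := frameModel k) χ₀).mem_nhds hχ] with χ' hχ'
      rw [extChartAt_frame χ₀ χ' (mem_frame_source.1 hχ').2]) v
  rw [h, fderiv_fst]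
  rfl

theorem toChart_mfderiv_act {χ₀ χ : FrameBundle E} (g : GL (Fin 2) ℝ)
    (hχ : χ ∈ (extChartAt (frameModel k) χ₀).source) (v : TangentSpace (frameModel k) χ) :
    toChart (frameModel k) χ₀ (χ.act g)
      (mfderiv (frameModel k) (frameModel k) (fun χ : FrameBundle E => χ.act g) χ v) =
        actCoords (g : Matrix (Fin 2) (Fin 2) ℝ) (toChart (frameModel k) χ₀ χ v) := by
  have h := toChart_mfderiv (frameModel k) (frameModel k) (f := fun χ : FrameBundle E => χ.act g)
    (x₀' := χ₀) (F := actCoords (g : Matrix (Fin 2) (Fin 2) ℝ)) hχ (mem_frame_source_act g hχ)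
    ((contMDiff_act g χ).mdifferentiableAt (by simp)) (ContinuousLinearMap.differentiableAt _) (by
      filter_upwards [(isOpen_extChartAt_source (I := frameModel k) χ₀).mem_nhds hχ] with χ' hχ'
      exact extChartAt_frame_act g hχ') v
  rw [h, ContinuousLinearMap.fderiv]

/-- In the chart the curve is linear in the entries of the exponential, whose derivative at `0` is
`A`. The base coordinate stays fixed. -/
theorem toChart_vertical {χ₀ χ : FrameBundle E} (hχ : χ ∈ (extChartAt (frameModel k) χ₀).source)
    (A : Matrix (Fin 2) (Fin 2) ℝ) :
    toChart (frameModel k) χ₀ (χ.act (expGL ((0 : ℝ) • A)))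
      (mfderiv 𝓘(ℝ, ℝ) (frameModel k) (fun t : ℝ => χ.act (expGL (t • A))) (0 : ℝ) (1 : ℝ)) =
        (0, pairMul (extChartAt (frameModel k) χ₀ χ).2 A) := by
  let γ : ℝ → FrameBundle E := fun t => χ.act (expGL (t • A))
  have hγ : ∀ t, γ t ∈ (extChartAt (frameModel k) χ₀).source := fun t => mem_frame_source_act _ hχ
  let f : ℝ → EuclideanSpace ℝ (Fin (k + 1)) × (Plane × Plane) := fun t =>
    actCoords (expGL (t • A) : Matrix (Fin 2) (Fin 2) ℝ) (extChartAt (frameModel k) χ₀ χ)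
  have hf : ∀ t, extChartAt (frameModel k) χ₀ (γ t) = f t := fun t => extChartAt_frame_act _ hχ
  have hd : HasDerivAt f (0, pairMul (extChartAt (frameModel k) χ₀ χ).2 A) 0 := by
    have h := hasDerivAt_expGL A
    simp only [f, actCoords_apply, pairMul]
    exact (hasDerivAt_const _ _).prodMk
      ((((h 0 0).smul_const _).add ((h 1 0).smul_const _)).prodMk
        (((h 0 1).smul_const _).add ((h 1 1).smul_const _)))
  -- `mfderiv` is zero by default where a map is not differentiable, so differentiability has to be
  -- secured; it is inherited from the coordinate expression through the inverse chart.
  have h1 : MDifferentiableAt 𝓘(ℝ, ℝ) (frameModel k) γ 0 := by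
    have h2 : γ = (extChartAt (frameModel k) χ₀).symm ∘ f := funext fun t => by
      rw [Function.comp_apply, ← hf, (extChartAt (frameModel k) χ₀).left_inv (hγ t)]
    rw [h2]
    refine MDifferentiableAt.comp (0 : ℝ) (I' := 𝓘(ℝ, EuclideanSpace ℝ (Fin (k + 1)) × (Plane × Plane)))
      ?_ hd.differentiableAt.mdifferentiableAt
    have h3 := (contMDiffOn_extChartAt_symm (n := ∞) (I := frameModel k) χ₀).contMDiffAt
      ((isOpen_extChartAt_target (I := frameModel k) χ₀).mem_nhds
        ((extChartAt (frameModel k) χ₀).map_source (hγ 0)))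
    rw [hf] at h3
    exact h3.mdifferentiableAt (by simp)
  have h2 := toChart_mfderiv 𝓘(ℝ, ℝ) (frameModel k) (f := γ) (x₀ := (0 : ℝ)) (x₀' := χ₀) (F := f)
    (mem_extChartAt_source _) (hγ 0) h1 hd.differentiableAt (Filter.Eventually.of_forall hf) (1 : ℝ)
  have e : toChart 𝓘(ℝ, ℝ) (0 : ℝ) (0 : ℝ) (1 : ℝ) = (1 : ℝ) := toChart_self 𝓘(ℝ, ℝ) (0 : ℝ) (1 : ℝ)
  exact (h2.trans (congrArg (fderiv ℝ f 0) e)).trans hd.deriv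

end FrameDerivatives

theorem pullField_extChartAt {V H N : Type*} [NormedAddCommGroup V] [NormedSpace ℝ V]
    [TopologicalSpace H] (I : ModelWithCorners ℝ V H) [TopologicalSpace N] [ChartedSpace H N] {x₀ x : N}
    (hx : x ∈ (extChartAt I x₀).source) (X : Π x : N, TangentSpace I x) :
    pullField I x₀ X (extChartAt I x₀ x) = toChart I x₀ x (X x) := by
  rw [pullField, (extChartAt I x₀).left_inv hx]

theorem contMDiffAt_localSection {n : ℕ} {M : Type*} [TopologicalSpace M]
    [ChartedSpace (EuclideanSpace ℝ (Fin n)) M] {E : M → Type*} [∀ p, AddCommGroup (E p)]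
    [TopologicalSpace (TotalSpace Plane E)] [∀ p, TopologicalSpace (E p)] [FiberBundle Plane E]
    (p₀ : M) (u : Plane) :
    ContMDiffAt (𝓡 n) ((𝓡 n).prod 𝓘(ℝ, Plane)) ∞
      (fun q => TotalSpace.mk' Plane q ((trivializationAt Plane E p₀).symm q u)) p₀ := by
  let e := trivializationAt Plane E p₀
  refine Bundle.contMDiffAt_totalSpace.2 ⟨contMDiffAt_id, ?_⟩
  refine (contMDiffAt_const (c := u)).congr_of_eventuallyEq ?_
  filter_upwards [e.open_baseSet.mem_nhds (mem_baseSet_trivializationAt Plane E p₀)] with q hq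
  exact (congrArg Prod.snd (e.apply_mk_symm hq u) :)

/-! ### The soldering and connection forms in a chart of `B(E)` -/

section LocalCoframe

open scoped TensorProduct

variable {k : ℕ} {M : Type*} [TopologicalSpace M] [ChartedSpace (EuclideanSpace ℝ (Fin (k + 1))) M]
  {E : M → Type*} [∀ p, AddCommGroup (E p)] [∀ p, Module ℝ (E p)]
  [TopologicalSpace (TotalSpace Plane E)] [∀ p, TopologicalSpace (E p)]
  [FiberBundle Plane E] [VectorBundle ℝ Plane E]

variable [IsManifold (𝓡 (k + 1)) ∞ M] (S : GL2Structure k E)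

/-- The vector fields on `M` corresponding to the monomials in a local frame of `E`. -/
def GL2Structure.localField (p₀ : M) (i : Fin (k + 1)) (q : M) : TangentSpace (𝓡 (k + 1)) q :=
  S.iso q (symMonomial k ((trivializationAt Plane E p₀).symm q ![1, 0])
    ((trivializationAt Plane E p₀).symm q ![0, 1]) i)

theorem GL2Structure.contDiffAt_localField (p₀ : M) (i : Fin (k + 1)) :
    ContDiffAt ℝ ∞ (pullField (𝓡 (k + 1)) p₀ (S.localField p₀ i)) (extChartAt (𝓡 (k + 1)) p₀ p₀) := by
  refine contDiffAt_pullField (𝓡 (k + 1)) ?_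
  have h := S.smooth p₀ (fun a q => if (a : ℕ) < k - i then (trivializationAt Plane E p₀).symm q ![1, 0]
    else (trivializationAt Plane E p₀).symm q ![0, 1]) (fun a => by
      by_cases ha : (a : ℕ) < k - i
      · simp only [ha, if_true]
        exact contMDiffAt_localSection p₀ _
      · simp only [ha, if_false]
        exact contMDiffAt_localSection p₀ _)
  exact h

/-- The dependence on the frame is isolated in `substMap`, which is smooth in the frame coordinates.
What remains are fixed vector fields on `M`. -/
theorem GL2Structure.frameMap_local (χ : FrameBundle E) (p₀ : M)
    (hχ : χ.1.proj ∈ (trivializationAt Plane E p₀).baseSet) (P : Poly k) :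
    S.frameMap χ P =
      ∑ i, substMap k (frameCoords (trivializationAt Plane E p₀) χ) P i • S.localField p₀ i χ.1.proj := by
  let e := trivializationAt Plane E p₀
  have h : ∀ v : E χ.1.proj, v = e.continuousLinearMapAt ℝ χ.1.proj v 0 • e.symm χ.1.proj ![1, 0] +
      e.continuousLinearMapAt ℝ χ.1.proj v 1 • e.symm χ.1.proj ![0, 1] := by
    intro v
    conv_lhs => rw [← e.symmL_continuousLinearMapAt (R := ℝ) hχ v]
    rw [← e.symmL_apply (R := ℝ) hχ, ← e.symmL_apply (R := ℝ) hχ, ← map_smul, ← map_smul, ← map_add]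
    congr 1
    ext i; fin_cases i <;> simp
  have h2 := symCombination_substMap (k := k) (e.symm χ.1.proj ![1, 0]) (e.symm χ.1.proj ![0, 1])
    (frameCoords e χ) P
  have h3 : symCombination k χ.1.2.1 χ.1.2.2 P = symCombination k (e.symm χ.1.proj ![1, 0])
      (e.symm χ.1.proj ![0, 1]) (substMap k (frameCoords e χ) P) := by
    rw [← h2]
    congr 2
    · exact h _
    · exact h _
  rw [S.frameMap_apply, h3, symCombination_apply, map_sum]
  simp only [map_smul]
  rfl

/-- The soldering form in the preferred chart at `χ₀`. -/
def GL2Structure.pullSolder (χ₀ : FrameBundle E) (y : EuclideanSpace ℝ (Fin (k + 1)) × (Plane × Plane)) :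
    EuclideanSpace ℝ (Fin (k + 1)) × (Plane × Plane) →L[ℝ] Poly k :=
  pullForm (frameModel k) χ₀ S.solder y

/-- The linear isomorphism given by a frame, in the preferred chart at `χ₀`. -/
def GL2Structure.pullFrame (χ₀ : FrameBundle E) (y : EuclideanSpace ℝ (Fin (k + 1)) × (Plane × Plane)) :
    Poly k →L[ℝ] EuclideanSpace ℝ (Fin (k + 1)) :=
  (toChart (𝓡 (k + 1)) χ₀.1.proj ((extChartAt (frameModel k) χ₀).symm y).1.proj).comp
    (S.frameMap ((extChartAt (frameModel k) χ₀).symm y))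

theorem GL2Structure.pullFrame_bijective {χ₀ : FrameBundle E}
    {y : EuclideanSpace ℝ (Fin (k + 1)) × (Plane × Plane)}
    (hy : y ∈ (extChartAt (frameModel k) χ₀).target) : Function.Bijective (S.pullFrame χ₀ y) := by
  have hχ := mem_frame_source.1 ((extChartAt (frameModel k) χ₀).map_target hy)
  exact (toChart_bijective (𝓡 (k + 1)) χ₀.1.proj (by rw [extChartAt_source]; exact hχ.1)).comp
    (S.frameMap_bijective _)

theorem GL2Structure.contDiffAt_pullFrame (χ₀ : FrameBundle E) :
    ContDiffAt ℝ ∞ (S.pullFrame χ₀) (extChartAt (frameModel k) χ₀ χ₀) := by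
  have h0 : extChartAt (frameModel k) χ₀ χ₀ = (extChartAt (𝓡 (k + 1)) χ₀.1.proj χ₀.1.proj, _) :=
    extChartAt_frame χ₀ χ₀ (mem_baseSet_trivializationAt Plane E χ₀.1.proj)
  have hG : ContDiffAt ℝ ∞ (fun m => ∑ i, (ContinuousLinearMap.proj (R := ℝ)
      (φ := fun _ : Fin (k + 1) => ℝ) i).smulRight
        (pullField (𝓡 (k + 1)) χ₀.1.proj (S.localField χ₀.1.proj i) m)) (extChartAt (frameModel k) χ₀ χ₀).1 := by
    refine ContDiffAt.sum fun i _ => ?_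
    have h1 := S.contDiffAt_localField χ₀.1.proj i
    rw [h0]
    exact ContDiffAt.smulRight contDiffAt_const h1
  have h1 := (hG.comp _ contDiffAt_fst).clm_comp
    ((contDiff_substMap k (n := ∞)).contDiffAt.comp (extChartAt (frameModel k) χ₀ χ₀) contDiffAt_snd)
  refine h1.congr_of_eventuallyEq ?_
  filter_upwards [extChartAt_target_mem_nhds (I := frameModel k) χ₀] with y hy
  obtain ⟨χ, hχ, rfl⟩ : ∃ χ ∈ (extChartAt (frameModel k) χ₀).source, y = extChartAt (frameModel k) χ₀ χ :=
    ⟨_, (extChartAt (frameModel k) χ₀).map_target hy, ((extChartAt (frameModel k) χ₀).right_inv hy).symm⟩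
  have hχ' := mem_frame_source.1 hχ
  rw [pullFrame, (extChartAt (frameModel k) χ₀).left_inv hχ]
  ext1 P
  rw [ContinuousLinearMap.comp_apply, S.frameMap_local χ χ₀.1.proj hχ'.2, map_sum,
    extChartAt_frame χ₀ χ hχ'.2]
  have hp := pullField_extChartAt (𝓡 (k + 1)) (x₀ := χ₀.1.proj) (x := χ.1.proj)
    (by rw [extChartAt_source]; exact hχ'.1)
  simp only [map_smul, ContinuousLinearMap.comp_apply, Function.comp_apply, _root_.sum_apply,
    ContinuousLinearMap.smulRight_apply, ContinuousLinearMap.proj_apply, hp]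

variable [ContMDiffVectorBundle ∞ Plane E (𝓡 (k + 1))]

/-- So `ω` is the inverse of the frame map applied to the base component. Both its vanishing on
vertical vectors and its smoothness are read off from this. -/
theorem GL2Structure.pullFrame_pullSolder {χ₀ : FrameBundle E}
    {y : EuclideanSpace ℝ (Fin (k + 1)) × (Plane × Plane)}
    (hy : y ∈ (extChartAt (frameModel k) χ₀).target)
    (u : EuclideanSpace ℝ (Fin (k + 1)) × (Plane × Plane)) :
    S.pullFrame χ₀ y (S.pullSolder χ₀ y u) = u.1 := by
  simp only [pullFrame, pullSolder, pullForm, ContinuousLinearMap.comp_apply]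
  rw [S.frameMap_solder, toChart_mfderiv_proj ((extChartAt (frameModel k) χ₀).map_target hy),
    toChart_fromChart _ _ hy]

theorem GL2Structure.pullSolder_vertical {χ₀ : FrameBundle E}
    {y : EuclideanSpace ℝ (Fin (k + 1)) × (Plane × Plane)}
    (hy : y ∈ (extChartAt (frameModel k) χ₀).target) (h : Plane × Plane) :
    S.pullSolder χ₀ y (0, h) = 0 :=
  (S.pullFrame_bijective hy).1 (by rw [S.pullFrame_pullSolder hy, map_zero])

/-- Inversion is smooth at invertible continuous linear maps, and `pullFrame` is smooth and
invertible throughout the chart. -/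
theorem GL2Structure.contDiffAt_pullSolder (χ₀ : FrameBundle E) :
    ContDiffAt ℝ ∞ (S.pullSolder χ₀) (extChartAt (frameModel k) χ₀ χ₀) := by
  have hinv : ∀ y ∈ (extChartAt (frameModel k) χ₀).target, (S.pullFrame χ₀ y).IsInvertible := by
    intro y hy
    exact ⟨(LinearEquiv.ofBijective (S.pullFrame χ₀ y).toLinearMap
      (S.pullFrame_bijective hy)).toContinuousLinearEquiv, by ext1 x; rfl⟩
  have h1 := ((hinv _ (mem_extChartAt_target χ₀)).contDiffAt_map_inverse (n := ∞)).comp _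
    (S.contDiffAt_pullFrame χ₀)
  refine (h1.clm_comp (contDiffAt_const (c := ContinuousLinearMap.fst ℝ
    (EuclideanSpace ℝ (Fin (k + 1))) (Plane × Plane)))).congr_of_eventuallyEq ?_
  filter_upwards [extChartAt_target_mem_nhds (I := frameModel k) χ₀] with y hy
  obtain ⟨e, he⟩ := hinv y hy
  refine ContinuousLinearMap.ext fun u => ?_
  apply (S.pullFrame_bijective hy).1
  rw [S.pullFrame_pullSolder hy]
  simp only [Function.comp_apply, ← he, ContinuousLinearMap.inverse_equiv]
  exact (e.apply_symm_apply _).symm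

theorem GL2Structure.pullSolder_act {χ₀ : FrameBundle E}
    {y : EuclideanSpace ℝ (Fin (k + 1)) × (Plane × Plane)}
    (hy : y ∈ (extChartAt (frameModel k) χ₀).target) (g : GL (Fin 2) ℝ)
    (u : EuclideanSpace ℝ (Fin (k + 1)) × (Plane × Plane)) :
    substMap k (columns g) (S.pullSolder χ₀ (actCoords (g : Matrix (Fin 2) (Fin 2) ℝ) y)
      (actCoords (g : Matrix (Fin 2) (Fin 2) ℝ) u)) = S.pullSolder χ₀ y u := by
  have hχ := (extChartAt (frameModel k) χ₀).map_target hy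
  conv_rhs => rw [pullSolder, pullForm, ContinuousLinearMap.comp_apply, S.solder_act _ g,
    apply_eq_pullForm (frameModel k) χ₀ S.solder (mem_frame_source_act g hχ),
    extChartAt_frame_act g hχ, toChart_mfderiv_act g hχ, toChart_fromChart _ _ hy,
    (extChartAt (frameModel k) χ₀).right_inv hy]
  rfl

variable (φ : GL2Connection k E)

/-- The connection form in the preferred chart at `χ₀`. -/
def GL2Connection.pullVal (χ₀ : FrameBundle E)
    (y u : EuclideanSpace ℝ (Fin (k + 1)) × (Plane × Plane)) : Matrix (Fin 2) (Fin 2) ℝ :=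
  Matrix.of fun i j => pullForm (frameModel k) χ₀ (φ.form i j) y u

theorem GL2Connection.val_eq_pullVal {χ₀ χ : FrameBundle E}
    (hχ : χ ∈ (extChartAt (frameModel k) χ₀).source) (v : TangentSpace (frameModel k) χ) :
    φ.val χ v = φ.pullVal χ₀ (extChartAt (frameModel k) χ₀ χ) (toChart (frameModel k) χ₀ χ v) := by
  ext i j
  exact apply_eq_pullForm (frameModel k) χ₀ (φ.form i j) hχ v

/-- Multiplied out by `g`, the equivariance contains no inverse; its derivative in `g` is then a
plain product rule. -/
theorem GL2Connection.pullVal_act {χ₀ : FrameBundle E}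
    {y : EuclideanSpace ℝ (Fin (k + 1)) × (Plane × Plane)}
    (hy : y ∈ (extChartAt (frameModel k) χ₀).target) (g : GL (Fin 2) ℝ)
    (u : EuclideanSpace ℝ (Fin (k + 1)) × (Plane × Plane)) :
    (g : Matrix (Fin 2) (Fin 2) ℝ) * φ.pullVal χ₀ (actCoords (g : Matrix (Fin 2) (Fin 2) ℝ) y)
      (actCoords (g : Matrix (Fin 2) (Fin 2) ℝ) u) = φ.pullVal χ₀ y u * (g : Matrix (Fin 2) (Fin 2) ℝ) := by
  have hχ := (extChartAt (frameModel k) χ₀).map_target hy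
  have h := φ.equivariant g _ (fromChart (frameModel k) χ₀ y u)
  have h1 := φ.val_eq_pullVal (mem_frame_source_act g hχ) (mfderiv (frameModel k) (frameModel k)
    (fun χ : FrameBundle E => χ.act g) _ (fromChart (frameModel k) χ₀ y u))
  rw [extChartAt_frame_act g hχ, toChart_mfderiv_act g hχ, toChart_fromChart _ _ hy,
    (extChartAt (frameModel k) χ₀).right_inv hy] at h1
  rw [← h1]
  refine (congrArg ((g : Matrix (Fin 2) (Fin 2) ℝ) * ·) h).trans ?_
  rw [← mul_assoc, ← mul_assoc, Units.mul_inv, one_mul]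
  rfl

theorem GL2Connection.pullVal_vertical {χ₀ : FrameBundle E}
    {y : EuclideanSpace ℝ (Fin (k + 1)) × (Plane × Plane)}
    (hy : y ∈ (extChartAt (frameModel k) χ₀).target) (A : Matrix (Fin 2) (Fin 2) ℝ) :
    φ.pullVal χ₀ y (0, pairMul y.2 A) = A := by
  have hχ := (extChartAt (frameModel k) χ₀).map_target hy
  have h := φ.vertical A ((extChartAt (frameModel k) χ₀).symm y)
  have h1 := φ.val_eq_pullVal (mem_frame_source_act (expGL ((0 : ℝ) • A)) hχ)
    (mfderiv 𝓘(ℝ, ℝ) (frameModel k) (fun t : ℝ =>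
      ((extChartAt (frameModel k) χ₀).symm y).act (expGL (t • A))) (0 : ℝ) (1 : ℝ))
  rw [toChart_vertical hχ, extChartAt_frame_act _ hχ, (extChartAt (frameModel k) χ₀).right_inv hy] at h1
  have h2 : actCoords (expGL ((0 : ℝ) • A) : Matrix (Fin 2) (Fin 2) ℝ) y = y := by
    rw [zero_smul, expGL_zero, actCoords_apply]
    simp [pairMul]
  rw [h2] at h1
  exact h1.symm.trans h

end LocalCoframe

/-! ### Derivatives along lines and along `1 + t A` -/

section DerivativeLemmas

variable {V F : Type*} [NormedAddCommGroup V] [NormedSpace ℝ V] [NormedAddCommGroup F] [NormedSpace ℝ F]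

theorem hasDerivAt_line (y n : V) : HasDerivAt (fun t : ℝ => y + t • n) n 0 := by
  simpa using ((hasDerivAt_id (0 : ℝ)).smul_const n).const_add y

theorem hasDerivAt_clm_line {L : V → V →L[ℝ] F} {y : V} (hL : DifferentiableAt ℝ L y) (n u m : V) :
    HasDerivAt (fun t : ℝ => L (y + t • n) (u + t • m)) (fderiv ℝ L y n u + L y m) 0 := by
  have h1 : HasFDerivAt L (fderiv ℝ L y) (y + (0 : ℝ) • n) := by
    rw [zero_smul, add_zero]; exact hL.hasFDerivAt
  have h2 : HasDerivAt (fun t : ℝ => L (y + t • n)) (fderiv ℝ L y n) 0 :=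
    h1.comp_hasDerivAt (0 : ℝ) (hasDerivAt_line y n)
  refine (h2.clm_apply (hasDerivAt_line u m)).congr_deriv ?_
  rw [zero_smul, zero_smul, add_zero, add_zero]

theorem dForm_swap (L : V → V →L[ℝ] F) (y u w : V) : dForm L y w u = -dForm L y u w := by
  simp [dForm]

/-- The action is linear in chart coordinates, so `1 + t A` moves points and tangent vectors along
straight lines. This replaces the flow of the fundamental field in first-order computations. -/
theorem actCoords_one_add (t : ℝ) (A : Matrix (Fin 2) (Fin 2) ℝ) (y : V × (Plane × Plane)) :
    actCoords (1 + t • A) y = y + t • (0, pairMul y.2 A) := by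
  rw [actCoords_apply]
  refine Prod.ext (by simp) (Prod.ext ?_ ?_)
  · simp [pairMul]; module
  · simp [pairMul]; module

theorem add_pairMul (c d : Plane × Plane) (A : Matrix (Fin 2) (Fin 2) ℝ) :
    pairMul (c + d) A = pairMul c A + pairMul d A := by
  refine Prod.ext ?_ ?_ <;> simp [pairMul] <;> module

theorem smul_pairMul (r : ℝ) (c : Plane × Plane) (A : Matrix (Fin 2) (Fin 2) ℝ) :
    pairMul (r • c) A = r • pairMul c A := by
  refine Prod.ext ?_ ?_ <;> simp [pairMul] <;> module

/-- Cramer's rule: every vertical vector at a frame is the value of a fundamental field. -/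
theorem exists_pairMul {c : Plane × Plane} (hc : c.1 0 * c.2 1 - c.1 1 * c.2 0 ≠ 0)
    (h : Plane × Plane) : ∃ A, pairMul c A = h := by
  set d := c.1 0 * c.2 1 - c.1 1 * c.2 0 with hd
  refine ⟨!![(h.1 0 * c.2 1 - h.1 1 * c.2 0) / d, (h.2 0 * c.2 1 - h.2 1 * c.2 0) / d;
    (c.1 0 * h.1 1 - c.1 1 * h.1 0) / d, (c.1 0 * h.2 1 - c.1 1 * h.2 0) / d], ?_⟩
  refine Prod.ext (funext fun i => ?_) (funext fun i => ?_) <;> fin_cases i <;>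
    simp [pairMul] <;> field_simp <;> rw [hd] <;> ring

/-- Small `t` are enough for a derivative at `0`, so invertibility of `1 + t A` is only needed
there. -/
theorem eventually_exists_GL (A : Matrix (Fin 2) (Fin 2) ℝ) :
    ∀ᶠ t : ℝ in 𝓝 0, ∃ g : GL (Fin 2) ℝ, (g : Matrix (Fin 2) (Fin 2) ℝ) = 1 + t • A := by
  have h : ContinuousAt (fun t : ℝ => (1 + t • A).det) 0 := by
    simp only [Matrix.det_fin_two]
    fun_prop
  have h0 : (1 + (0 : ℝ) • A).det ≠ 0 := by simp
  filter_upwards [h.eventually_ne h0] with t ht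
  exact ⟨Matrix.GeneralLinearGroup.mkOfDetNeZero _ ht, rfl⟩

end DerivativeLemmas

/-- The representation `rep`, as a continuous linear map. -/
def repCLM (k : ℕ) (A : Matrix (Fin 2) (Fin 2) ℝ) : Poly k →L[ℝ] Poly k :=
  LinearMap.toContinuousLinearMap (rep k A).mulVecLin

theorem repCLM_apply {k : ℕ} (A : Matrix (Fin 2) (Fin 2) ℝ) (P : Poly k) :
    repCLM k A P = (rep k A).mulVec P := rfl

theorem hasDerivAt_substMap_clm {k : ℕ} (A : Matrix (Fin 2) (Fin 2) ℝ) :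
    HasDerivAt (fun t : ℝ => substMap k (columns (1 + t • A))) (repCLM k A) 0 := by
  have hc : ContDiff ℝ 1 fun t : ℝ => columns (1 + t • A) := by
    have h : ∀ i j, ContDiff ℝ 1 fun t : ℝ => (1 + t • A) i j := fun i j => by
      simp only [Matrix.add_apply, Matrix.smul_apply, smul_eq_mul]
      fun_prop
    refine ContDiff.prodMk ?_ ?_ <;> rw [contDiff_pi] <;> intro i <;> fin_cases i
    · exact h 0 0
    · exact h 1 0
    · exact h 0 1
    · exact h 1 1
  have hd := (((contDiff_substMap k).comp hc).differentiable one_ne_zero 0).hasDerivAt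
  refine hd.congr_deriv (ContinuousLinearMap.ext fun P => ?_)
  have h1 := hd.clm_apply (hasDerivAt_const (0 : ℝ) P)
  simpa [repCLM_apply] using h1.unique (hasDerivAt_substMap A P)

/-! ### Exterior derivatives of `ω` and `φ` on vertical vectors -/

section StructureEquations

variable {k : ℕ} {M : Type*} [TopologicalSpace M] [ChartedSpace (EuclideanSpace ℝ (Fin (k + 1))) M]
  {E : M → Type*} [∀ p, AddCommGroup (E p)] [∀ p, Module ℝ (E p)]
  [TopologicalSpace (TotalSpace Plane E)] [∀ p, TopologicalSpace (E p)]
  [FiberBundle Plane E] [VectorBundle ℝ Plane E]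

theorem eventually_line_mem_target (χ : FrameBundle E)
    (u : EuclideanSpace ℝ (Fin (k + 1)) × (Plane × Plane)) :
    ∀ᶠ t : ℝ in 𝓝 0, extChartAt (frameModel k) χ χ + t • u ∈ (extChartAt (frameModel k) χ).target := by
  have hc : ContinuousAt (fun t : ℝ => extChartAt (frameModel k) χ χ + t • u) 0 :=
    (hasDerivAt_line _ _).continuousAt
  refine hc.preimage_mem_nhds ?_
  simpa using extChartAt_target_mem_nhds (I := frameModel k) χ

variable [IsManifold (𝓡 (k + 1)) ∞ M] [ContMDiffVectorBundle ∞ Plane E (𝓡 (k + 1))]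
  (S : GL2Structure k E) (φ : GL2Connection k E)

theorem GL2Structure.differentiableAt_pullSolder (χ : FrameBundle E) :
    DifferentiableAt ℝ (S.pullSolder χ) (extChartAt (frameModel k) χ χ) :=
  (S.contDiffAt_pullSolder χ).differentiableAt (by simp)

theorem GL2Connection.differentiableAt_pullForm (χ : FrameBundle E) (i j : Fin 2) :
    DifferentiableAt ℝ (pullForm (frameModel k) χ (φ.form i j)) (extChartAt (frameModel k) χ χ) :=
  (contDiffAt_pullForm (frameModel k) (φ.smooth i j) χ).differentiableAt (by simp)

/-- The vertical directions `(0, h)` are constant in the chart and killed by `ω` at every nearby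
point, so differentiating in any direction gives zero. -/
theorem GL2Structure.fderiv_pullSolder_vertical (χ : FrameBundle E)
    (u : EuclideanSpace ℝ (Fin (k + 1)) × (Plane × Plane)) (h : Plane × Plane) :
    fderiv ℝ (S.pullSolder χ) (extChartAt (frameModel k) χ χ) u (0, h) = 0 := by
  have h1 := hasDerivAt_clm_line (S.differentiableAt_pullSolder χ) u (0, h) 0
  have h2 : (fun t : ℝ => S.pullSolder χ (extChartAt (frameModel k) χ χ + t • u) ((0, h) + t • 0)) =ᶠ[𝓝 0]
      fun _ => 0 := by
    filter_upwards [eventually_line_mem_target χ u] with t ht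
    rw [smul_zero, add_zero, S.pullSolder_vertical ht]
  have h3 := (h1.congr_of_eventuallyEq h2.symm).unique (hasDerivAt_const (0 : ℝ) (0 : Poly k))
  simpa using h3

/-- The infinitesimal form of `pullSolder_act`, obtained by differentiating it along `1 + t A` at `t
= 0`. The value is exactly what `Φ ∧ ω` cancels, so the torsion is horizontal. -/
theorem GL2Structure.dForm_pullSolder_vertical (χ : FrameBundle E) (A : Matrix (Fin 2) (Fin 2) ℝ)
    (u : EuclideanSpace ℝ (Fin (k + 1)) × (Plane × Plane)) :
    dForm (S.pullSolder χ) (extChartAt (frameModel k) χ χ)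
      (0, pairMul (extChartAt (frameModel k) χ χ).2 A) u =
        -(rep k A).mulVec (S.pullSolder χ (extChartAt (frameModel k) χ χ) u) := by
  set y := extChartAt (frameModel k) χ χ with hy
  have hyt : y ∈ (extChartAt (frameModel k) χ).target := mem_extChartAt_target χ
  have h1 := hasDerivAt_clm_line (S.differentiableAt_pullSolder χ) (0, pairMul y.2 A) u (0, pairMul u.2 A)
  rw [← hy, S.pullSolder_vertical hyt, add_zero] at h1
  have h2 := (hasDerivAt_substMap_clm (k := k) A).clm_apply h1
  have h3 : (fun t : ℝ => substMap k (columns (1 + t • A)) (S.pullSolder χ (y + t • (0, pairMul y.2 A))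
      (u + t • (0, pairMul u.2 A)))) =ᶠ[𝓝 0] fun _ => S.pullSolder χ y u := by
    filter_upwards [eventually_exists_GL A] with t ht
    obtain ⟨g, hg⟩ := ht
    rw [← actCoords_one_add, ← actCoords_one_add, ← hg]
    exact S.pullSolder_act hyt g u
  have h4 := (h2.congr_of_eventuallyEq h3.symm).unique (hasDerivAt_const (0 : ℝ) (S.pullSolder χ y u))
  simp only [zero_smul, add_zero, substMap_columns_one, ContinuousLinearMap.id_apply, repCLM_apply] at h4
  rw [dForm, S.fderiv_pullSolder_vertical, sub_zero]
  exact eq_neg_of_add_eq_zero_right h4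

/-- Differentiating the equivariance along `1 + t A` gives the derivative in the vertical direction.
Differentiating the constant value `A` on the fundamental field gives the derivative in the
direction `u`. The value of `φ` on `(0, pairMul u.2 A)` occurs in both and cancels. The resulting
commutator is what `φ ∧ φ` cancels, so the curvature is horizontal. -/
theorem GL2Connection.dForm_pullForm_vertical (χ : FrameBundle E) (A : Matrix (Fin 2) (Fin 2) ℝ)
    (u : EuclideanSpace ℝ (Fin (k + 1)) × (Plane × Plane)) (i j : Fin 2) :
    dForm (pullForm (frameModel k) χ (φ.form i j)) (extChartAt (frameModel k) χ χ)
      (0, pairMul (extChartAt (frameModel k) χ χ).2 A) u =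
        (φ.pullVal χ (extChartAt (frameModel k) χ χ) u * A -
          A * φ.pullVal χ (extChartAt (frameModel k) χ χ) u) i j := by
  set y := extChartAt (frameModel k) χ χ with hy
  have hyt : y ∈ (extChartAt (frameModel k) χ).target := mem_extChartAt_target χ
  have h1 := fun l => hasDerivAt_clm_line (φ.differentiableAt_pullForm χ l j) (0, pairMul y.2 A) u
    (0, pairMul u.2 A)
  have h2 : ∀ l, HasDerivAt (fun t : ℝ => (1 + t • A) i l) (A i l) 0 := fun l => by
    simpa using ((hasDerivAt_id (0 : ℝ)).mul_const (A i l)).const_add ((1 : Matrix (Fin 2) (Fin 2) ℝ) i l)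
  have h3 : ∀ l, HasDerivAt (fun t : ℝ => (1 + t • A) l j) (A l j) 0 := fun l => by
    simpa using ((hasDerivAt_id (0 : ℝ)).mul_const (A l j)).const_add ((1 : Matrix (Fin 2) (Fin 2) ℝ) l j)
  have h4 := HasDerivAt.fun_sum (u := Finset.univ) fun l _ => (h2 l).mul (h1 l)
  have h5 := HasDerivAt.fun_sum (u := Finset.univ) fun l _ => (h3 l).const_mul (φ.pullVal χ y u i l)
  have h6 : (fun t : ℝ => ∑ l, (1 + t • A) i l * pullForm (frameModel k) χ (φ.form l j)
      (y + t • (0, pairMul y.2 A)) (u + t • (0, pairMul u.2 A))) =ᶠ[𝓝 0]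
        fun t => ∑ l, φ.pullVal χ y u i l * (1 + t • A) l j := by
    filter_upwards [eventually_exists_GL A] with t ht
    obtain ⟨g, hg⟩ := ht
    rw [← actCoords_one_add, ← actCoords_one_add, ← hg]
    exact congrFun (congrFun (φ.pullVal_act hyt g u) i) j
  have h7 := (h4.congr_of_eventuallyEq h6.symm).unique h5
  have h8 := hasDerivAt_clm_line (φ.differentiableAt_pullForm χ i j) u (0, pairMul y.2 A)
    (0, pairMul u.2 A)
  have h9 : (fun t : ℝ => pullForm (frameModel k) χ (φ.form i j) (y + t • u)
      ((0, pairMul y.2 A) + t • (0, pairMul u.2 A))) =ᶠ[𝓝 0] fun _ => A i j := by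
    filter_upwards [eventually_line_mem_target χ u] with t ht
    have h := congrFun (congrFun (φ.pullVal_vertical ht A) i) j
    refine Eq.trans ?_ h
    rw [GL2Connection.pullVal, Matrix.of_apply]
    congr 1
    refine Prod.ext (by simp) ?_
    simp [add_pairMul, smul_pairMul, y]
  have h10 := (h8.congr_of_eventuallyEq h9.symm).unique (hasDerivAt_const (0 : ℝ) (A i j))
  have h11 : ∀ l, pullForm (frameModel k) χ (φ.form l j) y u = φ.pullVal χ y u l j := fun _ => rfl
  rw [dForm, Matrix.sub_apply, Matrix.mul_apply, Matrix.mul_apply]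
  simp only [zero_smul, add_zero, ← hy, h11] at h7
  rw [Finset.sum_add_distrib] at h7
  have h12 : ∑ l, (1 : Matrix (Fin 2) (Fin 2) ℝ) i l * (fderiv ℝ (pullForm (frameModel k) χ (φ.form l j)) y
      (0, pairMul y.2 A) u + pullForm (frameModel k) χ (φ.form l j) y (0, pairMul u.2 A)) =
      fderiv ℝ (pullForm (frameModel k) χ (φ.form i j)) y
      (0, pairMul y.2 A) u + pullForm (frameModel k) χ (φ.form i j) y (0, pairMul u.2 A) := by
    simp [Matrix.one_apply]
  rw [h12] at h7
  linear_combination h7 - h10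

end StructureEquations

/-! ### Torsion and curvature as horizontal bilinear forms -/

theorem zetaMap_add (A B : Matrix (Fin 2) (Fin 2) ℝ) : zetaMap (A + B) = zetaMap A + zetaMap B := by
  simp [zetaMap]; ring

theorem zetaMap_smul (r : ℝ) (A : Matrix (Fin 2) (Fin 2) ℝ) : zetaMap (r • A) = r • zetaMap A := by
  simp [zetaMap]; ring

theorem rep_add (k : ℕ) (A B : Matrix (Fin 2) (Fin 2) ℝ) : rep k (A + B) = rep k A + rep k B := by
  ext i j
  simp only [rep, Matrix.of_apply, Matrix.add_apply]
  split_ifs <;> ring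

theorem rep_smul (k : ℕ) (r : ℝ) (A : Matrix (Fin 2) (Fin 2) ℝ) : rep k (r • A) = r • rep k A := by
  ext i j
  simp only [rep, Matrix.of_apply, Matrix.smul_apply, smul_eq_mul]
  split_ifs <;> ring

section Horizontal

variable {k : ℕ} {M : Type*} [TopologicalSpace M] [ChartedSpace (EuclideanSpace ℝ (Fin (k + 1))) M]
  {E : M → Type*} [∀ p, AddCommGroup (E p)] [∀ p, Module ℝ (E p)]
  [TopologicalSpace (TotalSpace Plane E)] [∀ p, TopologicalSpace (E p)]
  [FiberBundle Plane E] [VectorBundle ℝ Plane E]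
  [IsManifold (𝓡 (k + 1)) ∞ M] [ContMDiffVectorBundle ∞ Plane E (𝓡 (k + 1))]
  (S : GL2Structure k E) (φ : GL2Connection k E)

theorem GL2Structure.solder_eq_pullSolder {χ₀ χ : FrameBundle E}
    (hχ : χ ∈ (extChartAt (frameModel k) χ₀).source) (v : TangentSpace (frameModel k) χ) :
    S.solder χ v = S.pullSolder χ₀ (extChartAt (frameModel k) χ₀ χ) (toChart (frameModel k) χ₀ χ v) :=
  apply_eq_pullForm (frameModel k) χ₀ S.solder hχ v

namespace GL2Connection

theorem torsion_eq (χ : FrameBundle E) (v w : TangentSpace (frameModel k) χ) :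
    φ.torsion S χ v w = dForm (S.pullSolder χ) (extChartAt (frameModel k) χ χ)
        (toChart (frameModel k) χ χ v) (toChart (frameModel k) χ χ w) +
      ((rep k (φ.val χ v)).mulVec (S.solder χ w) - (rep k (φ.val χ w)).mulVec (S.solder χ v)) := by
  funext i
  have hd := S.differentiableAt_pullSolder χ
  let l : (EuclideanSpace ℝ (Fin (k + 1)) × (Plane × Plane) →L[ℝ] Poly k) →L[ℝ]
      (EuclideanSpace ℝ (Fin (k + 1)) × (Plane × Plane) →L[ℝ] ℝ) :=
    ContinuousLinearMap.compL ℝ _ (Poly k) ℝ (ContinuousLinearMap.proj i)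
  have h1 : HasFDerivAt (pullForm (frameModel k) χ (S.solderForm i)) _ (extChartAt (frameModel k) χ χ) :=
    l.hasFDerivAt.comp _ hd.hasFDerivAt
  simp only [torsion, Pi.add_apply, Pi.sub_apply]
  rw [extDerivOne_eq (frameModel k) h1.differentiableAt]
  simp only [dForm, h1.fderiv]
  rfl

theorem curvature_eq (χ : FrameBundle E) (v w : TangentSpace (frameModel k) χ) (i j : Fin 2) :
    φ.curvature χ v w i j = dForm (pullForm (frameModel k) χ (φ.form i j)) (extChartAt (frameModel k) χ χ)
        (toChart (frameModel k) χ χ v) (toChart (frameModel k) χ χ w) +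
      (φ.val χ v * φ.val χ w - φ.val χ w * φ.val χ v) i j := by
  simp only [curvature, Matrix.add_apply, Matrix.of_apply]
  rw [extDerivOne_eq (frameModel k) (φ.differentiableAt_pullForm χ i j)]

theorem val_add (χ : FrameBundle E) (v w : TangentSpace (frameModel k) χ) :
    φ.val χ (v + w) = φ.val χ v + φ.val χ w := by
  ext i j; simp [val]

theorem val_smul (χ : FrameBundle E) (r : ℝ) (v : TangentSpace (frameModel k) χ) :
    φ.val χ (r • v) = r • φ.val χ v := by
  ext i j; simp [val]

theorem torsion_swap (χ : FrameBundle E) (v w : TangentSpace (frameModel k) χ) :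
    φ.torsion S χ w v = -φ.torsion S χ v w := by
  rw [torsion_eq, torsion_eq, dForm_swap]
  abel

theorem curvature_swap (χ : FrameBundle E) (v w : TangentSpace (frameModel k) χ) :
    φ.curvature χ w v = -φ.curvature χ v w := by
  ext i j
  rw [Matrix.neg_apply, curvature_eq, curvature_eq, dForm_swap]
  simp only [Matrix.sub_apply]
  ring

theorem torsion_add_left (χ : FrameBundle E) (v v' w : TangentSpace (frameModel k) χ) :
    φ.torsion S χ (v + v') w = φ.torsion S χ v w + φ.torsion S χ v' w := by
  simp only [torsion_eq, val_add, rep_add, map_add, dForm, _root_.add_apply, Matrix.add_mulVec,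
    Matrix.mulVec_add]
  abel

theorem torsion_smul_left (χ : FrameBundle E) (r : ℝ) (v w : TangentSpace (frameModel k) χ) :
    φ.torsion S χ (r • v) w = r • φ.torsion S χ v w := by
  simp only [torsion_eq, val_smul, rep_smul, map_smul, dForm, _root_.smul_apply, Matrix.smul_mulVec,
    Matrix.mulVec_smul]
  module

theorem curvature_add_left (χ : FrameBundle E) (v v' w : TangentSpace (frameModel k) χ) :
    φ.curvature χ (v + v') w = φ.curvature χ v w + φ.curvature χ v' w := by
  ext i j
  simp only [Matrix.add_apply, curvature_eq, val_add, map_add, dForm, _root_.add_apply, add_mul, mul_add,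
    Matrix.sub_apply]
  ring

theorem curvature_smul_left (χ : FrameBundle E) (r : ℝ) (v w : TangentSpace (frameModel k) χ) :
    φ.curvature χ (r • v) w = r • φ.curvature χ v w := by
  ext i j
  simp only [Matrix.smul_apply, curvature_eq, val_smul, map_smul, dForm, _root_.smul_apply,
    smul_mul_assoc, mul_smul_comm, Matrix.sub_apply, smul_eq_mul]
  ring

/-- A vector killed by `ω` has no base component, so it belongs to a fundamental field, and `φ`
reads off the matrix. -/
theorem exists_eq_vertical {χ : FrameBundle E} {v : TangentSpace (frameModel k) χ}
    (hv : S.solder χ v = 0) : toChart (frameModel k) χ χ v =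
      (0, pairMul (extChartAt (frameModel k) χ χ).2 (φ.val χ v)) := by
  have hy := mem_extChartAt_target (I := frameModel k) χ
  have hs := mem_extChartAt_source (I := frameModel k) χ
  have h1 : (toChart (frameModel k) χ χ v).1 = 0 := by
    rw [← S.pullFrame_pullSolder hy, ← S.solder_eq_pullSolder hs, hv, map_zero]
  have hb := mem_baseSet_trivializationAt Plane E χ.1.proj
  have hc : (extChartAt (frameModel k) χ χ).2 = frameCoords (trivializationAt Plane E χ.1.proj) χ := by
    rw [extChartAt_frame χ χ hb]
  obtain ⟨A, hA⟩ := exists_pairMul (c := (extChartAt (frameModel k) χ χ).2)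
    (by rw [hc]; exact FrameBundle.det_ne _ χ hb) (toChart (frameModel k) χ χ v).2
  have h2 : toChart (frameModel k) χ χ v = (0, pairMul (extChartAt (frameModel k) χ χ).2 A) :=
    Prod.ext h1 hA.symm
  have h3 : φ.val χ v = A := by
    rw [φ.val_eq_pullVal hs, h2, φ.pullVal_vertical hy]
  rw [h3, h2]

theorem torsion_eq_zero_of_vertical {χ : FrameBundle E} {v : TangentSpace (frameModel k) χ}
    (hv : S.solder χ v = 0) (w : TangentSpace (frameModel k) χ) : φ.torsion S χ v w = 0 := by
  rw [torsion_eq, φ.exists_eq_vertical S hv, S.dForm_pullSolder_vertical, hv,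
    ← S.solder_eq_pullSolder (mem_extChartAt_source χ), Matrix.mulVec_zero]
  abel

theorem curvature_eq_zero_of_vertical {χ : FrameBundle E} {v : TangentSpace (frameModel k) χ}
    (hv : S.solder χ v = 0) (w : TangentSpace (frameModel k) χ) : φ.curvature χ v w = 0 := by
  ext i j
  rw [curvature_eq, φ.exists_eq_vertical S hv, φ.dForm_pullForm_vertical,
    ← φ.val_eq_pullVal (mem_extChartAt_source χ)]
  simp only [Matrix.sub_apply, Matrix.zero_apply]
  ring

theorem val_of_coframe {χ : FrameBundle E} {v : TangentSpace (frameModel k) χ} (h : (φ.coframe S χ v).2 = 0) :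
    φ.val χ v = 0 := by
  ext i j
  exact congrFun (congrFun h i) j

/-- A vector killed by `ω` is the fundamental vector of its `φ`-value, hence zero if that vanishes
too. Both spaces have dimension `k + 5`. -/
theorem coframe_bijective (χ : FrameBundle E) : Function.Bijective (φ.coframe S χ) := by
  have : FiniteDimensional ℝ (TangentSpace (frameModel k) χ) :=
    inferInstanceAs (FiniteDimensional ℝ (EuclideanSpace ℝ (Fin (k + 1)) × (Plane × Plane)))
  have hd : Module.finrank ℝ (TangentSpace (frameModel k) χ) =
      Module.finrank ℝ (Poly k × (Fin 2 → Fin 2 → ℝ)) := by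
    change Module.finrank ℝ (EuclideanSpace ℝ (Fin (k + 1)) × (Plane × Plane)) = _
    simp [Module.finrank_pi_fintype]
  have hinj : Function.Injective (φ.coframe S χ) := by
    rw [injective_iff_map_eq_zero]
    intro v hv
    have h1 : S.solder χ v = 0 := congrArg Prod.fst hv
    have h2 := φ.exists_eq_vertical S h1
    rw [φ.val_of_coframe S (congrArg Prod.snd hv)] at h2
    apply (toChart_bijective (frameModel k) χ (mem_extChartAt_source χ)).1
    rw [h2, map_zero]
    simp [pairMul]
  exact ⟨hinj, (LinearMap.injective_iff_surjective_of_finrank_eq_finrank hd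
    (f := (φ.coframe S χ).toLinearMap)).1 hinj⟩

theorem coframe_horizontalLift (χ : FrameBundle E) (P : Poly k) :
    φ.coframe S χ (φ.horizontalLift S χ P) = (P, 0) := by
  have : FiniteDimensional ℝ (TangentSpace (frameModel k) χ) :=
    inferInstanceAs (FiniteDimensional ℝ (EuclideanSpace ℝ (Fin (k + 1)) × (Plane × Plane)))
  have : T2Space (TangentSpace (frameModel k) χ) :=
    inferInstanceAs (T2Space (EuclideanSpace ℝ (Fin (k + 1)) × (Plane × Plane)))
  obtain ⟨e, he⟩ : (φ.coframe S χ).IsInvertible :=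
    ⟨(LinearEquiv.ofBijective (φ.coframe S χ).toLinearMap (φ.coframe_bijective S χ)).toContinuousLinearEquiv,
      by ext1 x; rfl⟩
  rw [horizontalLift, ← he, ContinuousLinearMap.inverse_equiv]
  exact e.apply_symm_apply _

theorem solder_horizontalLift (χ : FrameBundle E) (P : Poly k) :
    S.solder χ (φ.horizontalLift S χ P) = P := congrArg Prod.fst (φ.coframe_horizontalLift S χ P)

theorem solder_sub_horizontalLift (χ : FrameBundle E) (v : TangentSpace (frameModel k) χ) :
    S.solder χ (v - φ.horizontalLift S χ (S.solder χ v)) = 0 := by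
  rw [map_sub, solder_horizontalLift, sub_self]

/-- A vector differs from the horizontal lift of its `ω`-value by a vertical one, which the torsion
ignores; antisymmetry carries this over to the second argument. -/
theorem torsion_horizontalLift (χ : FrameBundle E) (v w : TangentSpace (frameModel k) χ) :
    φ.torsion S χ v w = φ.torsion S χ (φ.horizontalLift S χ (S.solder χ v))
      (φ.horizontalLift S χ (S.solder χ w)) := by
  have h : ∀ v w, φ.torsion S χ v w = φ.torsion S χ (φ.horizontalLift S χ (S.solder χ v)) w := by
    intro v w
    conv_lhs => rw [← sub_add_cancel v (φ.horizontalLift S χ (S.solder χ v)), torsion_add_left,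
      φ.torsion_eq_zero_of_vertical S (φ.solder_sub_horizontalLift S χ v), zero_add]
  rw [h, torsion_swap, h, ← torsion_swap]

theorem curvature_horizontalLift (χ : FrameBundle E) (v w : TangentSpace (frameModel k) χ) :
    φ.curvature χ v w = φ.curvature χ (φ.horizontalLift S χ (S.solder χ v))
      (φ.horizontalLift S χ (S.solder χ w)) := by
  have h : ∀ v w, φ.curvature χ v w = φ.curvature χ (φ.horizontalLift S χ (S.solder χ v)) w := by
    intro v w
    conv_lhs => rw [← sub_add_cancel v (φ.horizontalLift S χ (S.solder χ v)), curvature_add_left,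
      φ.curvature_eq_zero_of_vertical S (φ.solder_sub_horizontalLift S χ v), zero_add]
  rw [h, curvature_swap, h, ← curvature_swap]

theorem horizontalLift_add (χ : FrameBundle E) (P Q : Poly k) :
    φ.horizontalLift S χ (P + Q) = φ.horizontalLift S χ P + φ.horizontalLift S χ Q := by
  rw [horizontalLift, horizontalLift, horizontalLift, ← map_add]
  simp

theorem horizontalLift_smul (χ : FrameBundle E) (r : ℝ) (P : Poly k) :
    φ.horizontalLift S χ (r • P) = r • φ.horizontalLift S χ P := by
  rw [horizontalLift, horizontalLift, ← map_smul]
  simp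

/-- The component `ξ^{k,j}(Θ)` of the torsion, as a bilinear form in the coordinates `ξ`. -/
def torsionForm (χ : FrameBundle E) (j : Idx k) : (Idx k → ℂ) →ₗ[ℝ] (Idx k → ℂ) →ₗ[ℝ] ℂ :=
  LinearMap.mk₂ ℝ (fun c d => xiMap k (φ.torsion S χ (φ.horizontalLift S χ (realCombination k c))
      (φ.horizontalLift S χ (realCombination k d))) j)
    (fun c c' d => by simp only [map_add, horizontalLift_add, torsion_add_left, Pi.add_apply])
    (fun r c d => by simp only [map_smul, horizontalLift_smul, torsion_smul_left, Pi.smul_apply])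
    (fun c d d' => by
      rw [torsion_swap, φ.torsion_swap S χ _ (φ.horizontalLift S χ (realCombination k c)),
        φ.torsion_swap S χ _ (φ.horizontalLift S χ (realCombination k c))]
      simp only [map_add, map_neg, horizontalLift_add, torsion_add_left, Pi.add_apply, Pi.neg_apply,
        neg_add])
    (fun r c d => by
      rw [torsion_swap, φ.torsion_swap S χ _ (φ.horizontalLift S χ (realCombination k c))]
      simp only [map_smul, map_neg, horizontalLift_smul, torsion_smul_left, Pi.smul_apply, Pi.neg_apply,
        smul_neg])

/-- The component `(Ω^1_2 + Ω^2_1) + i (Ω^2_2 - Ω^1_1)` of the curvature, as a bilinear form in the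
coordinates `ξ`. -/
def curvatureForm (χ : FrameBundle E) : (Idx k → ℂ) →ₗ[ℝ] (Idx k → ℂ) →ₗ[ℝ] ℂ :=
  LinearMap.mk₂ ℝ (fun c d => zetaMap (φ.curvature χ (φ.horizontalLift S χ (realCombination k c))
      (φ.horizontalLift S χ (realCombination k d))))
    (fun c c' d => by simp only [map_add, horizontalLift_add, curvature_add_left, zetaMap_add])
    (fun r c d => by simp only [map_smul, horizontalLift_smul, curvature_smul_left, zetaMap_smul])
    (fun c d d' => by
      rw [curvature_swap, φ.curvature_swap χ _ (φ.horizontalLift S χ (realCombination k c)),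
        φ.curvature_swap χ _ (φ.horizontalLift S χ (realCombination k c))]
      simp only [map_add, horizontalLift_add, curvature_add_left, ← zetaMap_add, neg_add])
    (fun r c d => by
      rw [curvature_swap, φ.curvature_swap χ _ (φ.horizontalLift S χ (realCombination k c))]
      simp only [map_smul, horizontalLift_smul, curvature_smul_left, ← zetaMap_smul, smul_neg])

/-- For odd `k` the coordinates `ξ` determine `ω`, and by horizontality `ω` determines the torsion.
-/
theorem torsionForm_xi (hk : Odd k) (χ : FrameBundle E) (j : Idx k)
    (v w : TangentSpace (frameModel k) χ) :
    φ.torsionForm S χ j (S.xi χ v) (S.xi χ w) = xiMap k (φ.torsion S χ v w) j := by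
  have h : ∀ v, realCombination k (S.xi χ v) = S.solder χ v := fun v => realCombination_xiMap hk _
  rw [φ.torsion_horizontalLift S χ v w, ← h, ← h]
  rfl

theorem curvatureForm_xi (hk : Odd k) (χ : FrameBundle E) (v w : TangentSpace (frameModel k) χ) :
    φ.curvatureForm S χ (S.xi χ v) (S.xi χ w) = zetaMap (φ.curvature χ v w) := by
  have h : ∀ v, realCombination k (S.xi χ v) = S.solder χ v := fun v => realCombination_xiMap hk _
  rw [φ.curvature_horizontalLift S χ v w, ← h, ← h]
  rfl

theorem realCombination_single_one (a : Idx k) :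
    realCombination k (Pi.single a 1) = monomialCoords k (Veven k a) := by
  rw [realCombination_apply, Finset.sum_eq_single a]
  · simp
  · intro b _ hb
    simp [hb]
  · simp

theorem realCombination_single_I (a : Idx k) :
    realCombination k (Pi.single a Complex.I) = monomialCoords k (Vodd k a) := by
  rw [realCombination_apply, Finset.sum_eq_single a]
  · simp
  · intro b _ hb
    simp [hb]
  · simp

/-- The unit vectors `1` and `i` in slot `a` correspond to `V_{k,a}^even` and `V_{k,a}^odd`. The
factor `1 / 4` of `coeff02` does not affect vanishing. -/
theorem part02_torsionForm_iff (χ : FrameBundle E) (j : Idx k) :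
    (∀ c d, part02 (fun c => Complex.I • c) (fun c d => φ.torsionForm S χ j c d) c d = 0) ↔
      ∀ a b, φ.torsion02 S χ j a b = 0 := by
  rw [part02_eq_zero_iff]
  refine forall_congr' fun a => forall_congr' fun b => ?_
  simp only [torsion02, coeff02, torsionForm, LinearMap.mk₂_apply, realCombination_single_one,
    realCombination_single_I]
  simp

theorem part02_curvatureForm_iff (χ : FrameBundle E) :
    (∀ c d, part02 (fun c => Complex.I • c) (fun c d => φ.curvatureForm S χ c d) c d = 0) ↔
      ∀ a b, φ.curvature02 S χ a b = 0 := by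
  rw [part02_eq_zero_iff]
  refine forall_congr' fun a => forall_congr' fun b => ?_
  simp only [curvature02, coeff02, curvatureForm, LinearMap.mk₂_apply, realCombination_single_one,
    realCombination_single_I]
  simp

end GL2Connection

end Horizontal

/-! ### The projection to the quotient in coordinates, with an affine section -/

section Slope

variable {V : Type*} [NormedAddCommGroup V] [NormedSpace ℝ V]

/-- The projection `B(E) → B(E)/CO(2)` in coordinates. -/
def slopeCoords (y : V × (Plane × Plane)) : V × ℂ := (y.1, frameSlope y.2.1 y.2.2)

/-- The linear part of `slopeSection`. -/
def slopeSectionLin (V : Type*) [NormedAddCommGroup V] [NormedSpace ℝ V] (c : Plane × Plane) :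
    V × ℂ →L[ℝ] V × (Plane × Plane) :=
  (ContinuousLinearMap.fst ℝ V ℂ).prod
    (((Complex.reCLM.comp ((ContinuousLinearMap.mul ℝ ℂ (c.1 0 + c.2 0 * Complex.I)).comp
        (ContinuousLinearMap.snd ℝ V ℂ))).smulRight (![0, 1] : Plane)).prod
      ((Complex.imCLM.comp ((ContinuousLinearMap.mul ℝ ℂ (c.1 0 + c.2 0 * Complex.I)).comp
        (ContinuousLinearMap.snd ℝ V ℂ))).smulRight (![0, 1] : Plane)))

/-- The affine section of `slopeCoords` whose bases have the same first component `a₀ + i b₀` as `c`. -/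
def slopeSection (c : Plane × Plane) (x : V × ℂ) : V × (Plane × Plane) :=
  (0, (![c.1 0, 0], ![c.2 0, 0])) + slopeSectionLin V c x

/-- The section freezes `z₀` and puts `z₁ = z₀ w`. This is affine in `w`, so its derivative is
constant. -/
theorem slopeSection_eq (c : Plane × Plane) (x : V × ℂ) : slopeSection c x =
    (x.1, (![c.1 0, ((c.1 0 + c.2 0 * Complex.I) * x.2).re], ![c.2 0, ((c.1 0 + c.2 0 * Complex.I) * x.2).im])) := by
  refine Prod.ext ?_ (Prod.ext ?_ ?_)
  · simp [slopeSection, slopeSectionLin]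
  · ext i; fin_cases i <;> simp [slopeSection, slopeSectionLin, sub_eq_add_neg]
  · ext i; fin_cases i <;> simp [slopeSection, slopeSectionLin]

theorem slopeCoords_slopeSection {c : Plane × Plane} (hc : (c.1 0 + c.2 0 * Complex.I : ℂ) ≠ 0)
    (x : V × ℂ) : slopeCoords (slopeSection c x) = x := by
  rw [slopeSection_eq, slopeCoords]
  refine Prod.ext rfl ?_
  simp only [frameSlope, Matrix.cons_val_zero, Matrix.cons_val_one, Complex.re_add_im]
  rw [mul_div_cancel_left₀ _ hc]

theorem slopeSection_slopeCoords {y : V × (Plane × Plane)}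
    (hc : y.2.1 0 * y.2.2 1 - y.2.1 1 * y.2.2 0 ≠ 0) : slopeSection y.2 (slopeCoords y) = y := by
  rw [slopeSection_eq]
  have h : (y.2.1 0 + y.2.2 0 * Complex.I) * (slopeCoords y).2 = y.2.1 1 + y.2.2 1 * Complex.I :=
    mul_div_cancel₀ _ (frameSlope_den_ne hc)
  rw [h]
  refine Prod.ext rfl (Prod.ext ?_ ?_) <;> ext i <;> fin_cases i <;> simp

theorem hasFDerivAt_slopeSection (c : Plane × Plane) (x : V × ℂ) :
    HasFDerivAt (slopeSection c : V × ℂ → V × (Plane × Plane)) (slopeSectionLin V c) x :=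
  (slopeSectionLin V c).hasFDerivAt.const_add _

theorem differentiableAt_slopeCoords {y : V × (Plane × Plane)}
    (hc : y.2.1 0 * y.2.2 1 - y.2.1 1 * y.2.2 0 ≠ 0) : DifferentiableAt ℝ slopeCoords y := by
  have h := ((contDiffAt_frameSlope (n := 1) hc).differentiableAt one_ne_zero).comp y
    (differentiableAt_snd (𝕜 := ℝ) (E := V) (F := Plane × Plane))
  exact differentiableAt_fst.prodMk h

theorem fderiv_slopeCoords_slopeSectionLin {c : Plane × Plane} {x : V × ℂ}
    (hc : (c.1 0 + c.2 0 * Complex.I : ℂ) ≠ 0)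
    (hx : (slopeSection c x).2.1 0 * (slopeSection c x).2.2 1 -
      (slopeSection c x).2.1 1 * (slopeSection c x).2.2 0 ≠ 0) (u : V × ℂ) :
    fderiv ℝ slopeCoords (slopeSection c x) (slopeSectionLin V c u) = u := by
  have h1 := (differentiableAt_slopeCoords hx).hasFDerivAt.comp x (hasFDerivAt_slopeSection c x)
  have h2 : (slopeCoords ∘ slopeSection c : V × ℂ → V × ℂ) = id :=
    funext fun x => slopeCoords_slopeSection hc x
  rw [h2] at h1
  exact DFunLike.congr_fun (h1.unique (hasFDerivAt_id x)) u

theorem fderiv_slopeCoords_fst {y : V × (Plane × Plane)}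
    (hc : y.2.1 0 * y.2.2 1 - y.2.1 1 * y.2.2 0 ≠ 0) (u : V × (Plane × Plane)) :
    (fderiv ℝ slopeCoords y u).1 = u.1 := by
  have h1 := (differentiableAt_slopeCoords hc).hasFDerivAt.fst
  exact DFunLike.congr_fun (h1.unique hasFDerivAt_fst) u

/-- A fundamental vector field that is tangent to the fibres of `B(E) → B(E)/CO(2)` comes from the
Lie algebra of `CO(2)`. -/
theorem zetaMap_eq_zero_of_fderiv_slopeCoords {y : V × (Plane × Plane)}
    (hc : y.2.1 0 * y.2.2 1 - y.2.1 1 * y.2.2 0 ≠ 0) {A : Matrix (Fin 2) (Fin 2) ℝ}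
    (hA : fderiv ℝ slopeCoords y (0, pairMul y.2 A) = 0) : zetaMap A = 0 := by
  have hz := frameSlope_den_ne hc
  set z₀ : ℂ := y.2.1 0 + y.2.2 0 * Complex.I with hz₀
  set z₁ : ℂ := y.2.1 1 + y.2.2 1 * Complex.I with hz₁
  have h1 : HasFDerivAt slopeCoords (fderiv ℝ slopeCoords y) (y + (0 : ℝ) • (0, pairMul y.2 A)) := by
    rw [zero_smul, add_zero]; exact (differentiableAt_slopeCoords hc).hasFDerivAt
  have h2 := (ContinuousLinearMap.snd ℝ V ℂ).hasFDerivAt.comp_hasDerivAt (0 : ℝ)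
    (h1.comp_hasDerivAt (0 : ℝ) (hasDerivAt_line y (0, pairMul y.2 A)))
  rw [hA] at h2
  have hl : HasDerivAt (fun t : ℝ => (t : ℂ)) 1 0 := (hasDerivAt_id (0 : ℝ)).ofReal_comp
  have h3 : ∀ z w : ℂ, HasDerivAt (fun t : ℝ => z + t * w) w 0 := fun z w => by
    simpa using (hl.mul_const w).const_add z
  have h4 := (h3 z₁ (linCoeff A * z₁ + antiCoeff A * starRingEnd ℂ z₁)).fun_div
    (h3 z₀ (linCoeff A * z₀ + antiCoeff A * starRingEnd ℂ z₀)) (by simpa using hz)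
  have h5 : (ContinuousLinearMap.snd ℝ V ℂ ∘ slopeCoords ∘ fun t : ℝ => y + t • ((0 : V), pairMul y.2 A)) = fun t : ℝ =>
      (z₁ + t * (linCoeff A * z₁ + antiCoeff A * starRingEnd ℂ z₁)) /
        (z₀ + t * (linCoeff A * z₀ + antiCoeff A * starRingEnd ℂ z₀)) := by
    funext t
    rw [hz₀, hz₁, ← linCoeff_antiCoeff, ← linCoeff_antiCoeff]
    simp only [Function.comp_apply, ContinuousLinearMap.coe_snd', slopeCoords, frameSlope, pairMul, Prod.snd_add, Prod.smul_snd,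
      Prod.fst_add, Prod.smul_fst, Pi.add_apply, Pi.smul_apply, smul_eq_mul]
    push_cast
    congr 1 <;> ring
  have h6 := h4.unique (h5 ▸ h2)
  simp only [Complex.ofReal_zero, zero_mul, add_zero, map_zero] at h6
  rw [div_eq_zero_iff] at h6
  have h7 := h6.resolve_right (pow_ne_zero 2 hz)
  -- In the derivative of `z₁ / z₀` the complex linear part of `A` cancels. What is left is
  -- `antiCoeff A` times `-2i` times the determinant of the frame, divided by `z₀²`.
  have h8 : antiCoeff A * (starRingEnd ℂ z₁ * z₀ - z₁ * starRingEnd ℂ z₀) = 0 := by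
    linear_combination h7
  have h9 : starRingEnd ℂ z₁ * z₀ - z₁ * starRingEnd ℂ z₀ ≠ 0 := by
    intro h
    have := congrArg Complex.im h
    simp [hz₀, hz₁] at this
    exact hc (by linear_combination (-1 / 2 : ℝ) * this)
  have h10 := (mul_eq_zero.1 h8).resolve_right h9
  rw [antiCoeff, mul_eq_zero] at h10
  exact h10.resolve_left (by simp)

end Slope

/-! ### The forms `(ξ, ζ)` and their pullback along the section -/

section ComplexCoframe

variable {k : ℕ} {M : Type*} [TopologicalSpace M] [ChartedSpace (EuclideanSpace ℝ (Fin (k + 1))) M]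
  {E : M → Type*} [∀ p, AddCommGroup (E p)] [∀ p, Module ℝ (E p)]
  [TopologicalSpace (TotalSpace Plane E)] [∀ p, TopologicalSpace (E p)]
  [FiberBundle Plane E] [VectorBundle ℝ Plane E]

theorem det_ne_of_mem_source {χ₀ χ : FrameBundle E} (hχ : χ ∈ (extChartAt (frameModel k) χ₀).source) :
    (extChartAt (frameModel k) χ₀ χ).2.1 0 * (extChartAt (frameModel k) χ₀ χ).2.2 1 -
      (extChartAt (frameModel k) χ₀ χ).2.1 1 * (extChartAt (frameModel k) χ₀ χ).2.2 0 ≠ 0 := by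
  have hχ' := (mem_frame_source.1 hχ).2
  rw [extChartAt_frame χ₀ χ hχ']
  exact FrameBundle.det_ne _ χ hχ'

theorem mk_mem_source {χ₀ χ : FrameBundle E} (hχ : χ ∈ (extChartAt (frameModel k) χ₀).source) :
    COQuotient.mk χ ∈ (extChartAt (quotientModel k) (COQuotient.mk χ₀)).source :=
  mem_quotient_source.2 (mem_frame_source.1 hχ)

theorem extChartAt_mk {χ₀ χ : FrameBundle E} (hχ : χ ∈ (extChartAt (frameModel k) χ₀).source) :
    extChartAt (quotientModel k) (COQuotient.mk χ₀) (COQuotient.mk χ) =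
      slopeCoords (extChartAt (frameModel k) χ₀ χ) := by
  rw [extChartAt_quotient, extChartAt_frame χ₀ χ (mem_frame_source.1 hχ).2]
  rfl

theorem slopeSection_extChartAt_mk (χ₀ : FrameBundle E) :
    slopeSection (extChartAt (frameModel k) χ₀ χ₀).2
      (extChartAt (quotientModel k) (COQuotient.mk χ₀) (COQuotient.mk χ₀)) =
        extChartAt (frameModel k) χ₀ χ₀ := by
  have hs := mem_extChartAt_source (I := frameModel k) χ₀
  rw [extChartAt_mk hs, slopeSection_slopeCoords (det_ne_of_mem_source hs)]

variable [IsManifold (𝓡 (k + 1)) ∞ M] [ContMDiffVectorBundle ∞ Plane E (𝓡 (k + 1))]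

theorem toChart_mfderiv_mk {χ₀ χ : FrameBundle E} (hχ : χ ∈ (extChartAt (frameModel k) χ₀).source)
    (v : TangentSpace (frameModel k) χ) :
    toChart (quotientModel k) (COQuotient.mk χ₀) (COQuotient.mk χ)
      (mfderiv (frameModel k) (quotientModel k) COQuotient.mk χ v) =
        fderiv ℝ slopeCoords (extChartAt (frameModel k) χ₀ χ) (toChart (frameModel k) χ₀ χ v) := by
  refine toChart_mfderiv (frameModel k) (quotientModel k) hχ (mk_mem_source hχ)
    ((COQuotient.contMDiff_mk _ χ).mdifferentiableAt (by simp))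
    (differentiableAt_slopeCoords (det_ne_of_mem_source hχ)) ?_ v
  filter_upwards [(isOpen_extChartAt_source (I := frameModel k) χ₀).mem_nhds hχ] with χ' hχ'
  exact extChartAt_mk hχ'

variable (S : GL2Structure k E) (φ : GL2Connection k E)

namespace GL2Connection

/-- The forms `(ξ, ζ)` on `B(E)`. -/
def complexCoframe (χ : FrameBundle E) : TangentSpace (frameModel k) χ →L[ℝ] (Idx k → ℂ) × ℂ :=
  ((xiMap k).comp (S.solder χ)).prod
    (Complex.ofRealCLM.comp (φ.form 1 0 χ + φ.form 0 1 χ) +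
      (φ.form 1 1 χ - φ.form 0 0 χ).smulRight Complex.I)

theorem complexCoframe_apply (χ : FrameBundle E) (v : TangentSpace (frameModel k) χ) :
    φ.complexCoframe S χ v = (S.xi χ v, φ.zeta χ v) := by
  simp [complexCoframe, zeta, zetaMap, val]
  rfl

theorem complexCoframe_surjective (hk : Odd k) (χ : FrameBundle E) :
    Function.Surjective (φ.complexCoframe S χ) := by
  rintro ⟨c, d⟩
  -- The matrix with first row zero and second row `(Re d, Im d)` has `ζ`-component `d`.
  obtain ⟨v, hv⟩ := (φ.coframe_bijective S χ).2 (realCombination k c, ![![0, 0], ![d.re, d.im]])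
  refine ⟨v, ?_⟩
  have h1 : S.solder χ v = realCombination k c := congrArg Prod.fst hv
  have h2 : ∀ i j, φ.form i j χ v = (![![0, 0], ![d.re, d.im]] : Fin 2 → Fin 2 → ℝ) i j := fun i j =>
    congrFun (congrFun (congrArg Prod.snd hv) i) j
  rw [complexCoframe_apply]
  refine Prod.ext ?_ ?_
  · change xiMap k (S.solder χ v) = c
    rw [h1, xiMap_realCombination hk]
  · simp [zeta, zetaMap, val, h2, Complex.re_add_im]

/-- The forms `(ξ, ζ)` in the preferred chart at `χ₀`. -/
def pullComplex (χ₀ : FrameBundle E) (y : EuclideanSpace ℝ (Fin (k + 1)) × (Plane × Plane)) :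
    EuclideanSpace ℝ (Fin (k + 1)) × (Plane × Plane) →L[ℝ] (Idx k → ℂ) × ℂ :=
  pullForm (frameModel k) χ₀ (φ.complexCoframe S) y

theorem pullComplex_apply (χ₀ : FrameBundle E) (y u : EuclideanSpace ℝ (Fin (k + 1)) × (Plane × Plane)) :
    φ.pullComplex S χ₀ y u = (xiMap k (S.pullSolder χ₀ y u), zetaMap (φ.pullVal χ₀ y u)) := by
  simp only [pullComplex, pullForm, ContinuousLinearMap.comp_apply]
  exact φ.complexCoframe_apply S _ _

theorem contDiffAt_pullComplex (χ₀ : FrameBundle E) :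
    ContDiffAt ℝ ∞ (φ.pullComplex S χ₀) (extChartAt (frameModel k) χ₀ χ₀) := by
  have h := fun i j => contDiffAt_pullForm (frameModel k) (φ.smooth i j) χ₀
  have h1 : φ.pullComplex S χ₀ = fun y =>
      (ContinuousLinearMap.inl ℝ (Idx k → ℂ) ℂ).comp ((xiMap k).comp (S.pullSolder χ₀ y)) +
      (ContinuousLinearMap.inr ℝ (Idx k → ℂ) ℂ).comp
        (Complex.ofRealCLM.comp (pullForm (frameModel k) χ₀ (φ.form 1 0) y +
          pullForm (frameModel k) χ₀ (φ.form 0 1) y) +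
        (pullForm (frameModel k) χ₀ (φ.form 1 1) y -
          pullForm (frameModel k) χ₀ (φ.form 0 0) y).smulRight Complex.I) := by
    funext y
    refine ContinuousLinearMap.ext fun u => ?_
    refine Prod.ext (add_zero _).symm (zero_add _).symm
  rw [h1]
  refine (contDiffAt_const.clm_comp (contDiffAt_const.clm_comp (S.contDiffAt_pullSolder χ₀))).add
    (contDiffAt_const.clm_comp ?_)
  exact (contDiffAt_const.clm_comp ((h 1 0).add (h 0 1))).add
    (((h 1 1).sub (h 0 0)).smulRight contDiffAt_const)

/-- The forms `ξ` and `ζ` vanish on the fibres of `B(E) → B(E)/CO(2)`. -/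
theorem pullComplex_eq_zero {χ₀ : FrameBundle E} {y u : EuclideanSpace ℝ (Fin (k + 1)) × (Plane × Plane)}
    (hy : y ∈ (extChartAt (frameModel k) χ₀).target) (hu : fderiv ℝ slopeCoords y u = 0) :
    φ.pullComplex S χ₀ y u = 0 := by
  have hc := det_ne_of_mem_source ((extChartAt (frameModel k) χ₀).map_target hy)
  rw [(extChartAt (frameModel k) χ₀).right_inv hy] at hc
  have h1 : u.1 = 0 := by rw [← fderiv_slopeCoords_fst hc, hu]; rfl
  obtain ⟨A, hA⟩ := exists_pairMul hc u.2
  have h2 : u = (0, pairMul y.2 A) := Prod.ext h1 hA.symm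
  rw [h2] at hu ⊢
  rw [pullComplex_apply, S.pullSolder_vertical hy, φ.pullVal_vertical hy,
    zetaMap_eq_zero_of_fderiv_slopeCoords hc hu, map_zero]
  rfl

/-- The forms `(ξ, ζ)`, pulled back to `B(E)/CO(2)` by a local section through `χ₀`, in the preferred
chart. -/
def pullQuotient (χ₀ : FrameBundle E) (x : EuclideanSpace ℝ (Fin (k + 1)) × ℂ) :
    EuclideanSpace ℝ (Fin (k + 1)) × ℂ →L[ℝ] (Idx k → ℂ) × ℂ :=
  (φ.pullComplex S χ₀ (slopeSection (extChartAt (frameModel k) χ₀ χ₀).2 x)).comp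
    (slopeSectionLin _ (extChartAt (frameModel k) χ₀ χ₀).2)

/-- A vector at a point of the section and the lift of its projection along the section differ by a
vector tangent to the `CO(2)`-orbit, on which `ξ` and `ζ` vanish. -/
theorem pullQuotient_mfderiv_mk {χ₀ χ : FrameBundle E} {x : EuclideanSpace ℝ (Fin (k + 1)) × ℂ}
    (hχ : χ ∈ (extChartAt (frameModel k) χ₀).source)
    (hx : slopeSection (extChartAt (frameModel k) χ₀ χ₀).2 x = extChartAt (frameModel k) χ₀ χ)
    (v : TangentSpace (frameModel k) χ) :
    φ.pullQuotient S χ₀ x (toChart (quotientModel k) (COQuotient.mk χ₀) (COQuotient.mk χ)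
      (mfderiv (frameModel k) (quotientModel k) COQuotient.mk χ v)) = φ.complexCoframe S χ v := by
  have hz := frameSlope_den_ne (det_ne_of_mem_source (mem_extChartAt_source (I := frameModel k) χ₀))
  have hc := det_ne_of_mem_source hχ
  have hy := (extChartAt (frameModel k) χ₀).map_source hχ
  rw [toChart_mfderiv_mk hχ, apply_eq_pullForm (frameModel k) χ₀ (φ.complexCoframe S) hχ, ← hx] at *
  change φ.pullComplex S χ₀ _ _ = φ.pullComplex S χ₀ _ _
  rw [← sub_eq_zero, ← map_sub]
  apply φ.pullComplex_eq_zero S hy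
  rw [map_sub]
  exact sub_eq_zero.2 (fderiv_slopeCoords_slopeSectionLin hz hc _)

end GL2Connection

end ComplexCoframe

/-! ### The almost-complex structure on `B(E)/CO(2)` -/

section QuotientCoframe

variable {k : ℕ} {M : Type*} [TopologicalSpace M] [ChartedSpace (EuclideanSpace ℝ (Fin (k + 1))) M]
  {E : M → Type*} [∀ p, AddCommGroup (E p)] [∀ p, Module ℝ (E p)]
  [TopologicalSpace (TotalSpace Plane E)] [∀ p, TopologicalSpace (E p)]
  [FiberBundle Plane E] [VectorBundle ℝ Plane E]

theorem COQuotient.mk_surjective : Function.Surjective (COQuotient.mk (E := E)) := Quotient.mk_surjective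

theorem COQuotient.mk_act (χ : FrameBundle E) {g : GL (Fin 2) ℝ} (hg : g ∈ CO2) :
    COQuotient.mk (χ.act g) = COQuotient.mk χ :=
  (Quotient.sound (s := coSetoid E) ⟨g, hg, rfl⟩).symm

/-- The section stays in the chart domain near its centre, so nearby points of the quotient are
classes of frames lying on it. -/
theorem eventually_exists_frame (χ₀ : FrameBundle E) :
    ∀ᶠ x in 𝓝 (extChartAt (quotientModel k) (COQuotient.mk χ₀) (COQuotient.mk χ₀)),
      ∃ χ ∈ (extChartAt (frameModel k) χ₀).source,
        slopeSection (extChartAt (frameModel k) χ₀ χ₀).2 x = extChartAt (frameModel k) χ₀ χ ∧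
        extChartAt (quotientModel k) (COQuotient.mk χ₀) (COQuotient.mk χ) = x := by
  have hz := frameSlope_den_ne (det_ne_of_mem_source (mem_extChartAt_source (I := frameModel k) χ₀))
  have hc : ContinuousAt (slopeSection (V := EuclideanSpace ℝ (Fin (k + 1))) (extChartAt (frameModel k) χ₀ χ₀).2)
      (extChartAt (quotientModel k) (COQuotient.mk χ₀) (COQuotient.mk χ₀)) :=
    (hasFDerivAt_slopeSection _ _).continuousAt
  have hm : (extChartAt (frameModel k) χ₀).target ∈ 𝓝 (slopeSection (extChartAt (frameModel k) χ₀ χ₀).2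
      (extChartAt (quotientModel k) (COQuotient.mk χ₀) (COQuotient.mk χ₀))) := by
    rw [slopeSection_extChartAt_mk]
    exact extChartAt_target_mem_nhds χ₀
  filter_upwards [hc.preimage_mem_nhds hm] with x hx
  refine ⟨(extChartAt (frameModel k) χ₀).symm _, (extChartAt (frameModel k) χ₀).map_target hx,
    ((extChartAt (frameModel k) χ₀).right_inv hx).symm, ?_⟩
  rw [extChartAt_mk ((extChartAt (frameModel k) χ₀).map_target hx),
    (extChartAt (frameModel k) χ₀).right_inv hx, slopeCoords_slopeSection hz]

variable [IsManifold (𝓡 (k + 1)) ∞ M] [ContMDiffVectorBundle ∞ Plane E (𝓡 (k + 1))]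

/-- The differential of `B(E) → B(E)/CO(2)`, with values in the model space. -/
def mfderivMk (χ : FrameBundle E) :
    TangentSpace (frameModel k) χ →L[ℝ] EuclideanSpace ℝ (Fin (k + 1)) × ℂ :=
  mfderiv (frameModel k) (quotientModel k) COQuotient.mk χ

theorem mfderivMk_act (χ : FrameBundle E) {g : GL (Fin 2) ℝ} (hg : g ∈ CO2)
    (v : TangentSpace (frameModel k) χ) :
    mfderivMk (χ.act g) (mfderiv (frameModel k) (frameModel k) (fun χ : FrameBundle E => χ.act g) χ v) =
      mfderivMk χ v := by
  have h1 : mfderiv (frameModel k) (quotientModel k)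
      (COQuotient.mk ∘ fun χ : FrameBundle E => χ.act g) χ = _ :=
    mfderiv_comp χ ((COQuotient.contMDiff_mk _ (χ.act g)).mdifferentiableAt (by simp))
      ((contMDiff_act g χ).mdifferentiableAt (by simp))
  have h2 : (COQuotient.mk ∘ fun χ : FrameBundle E => χ.act g) = COQuotient.mk :=
    funext fun χ => COQuotient.mk_act χ hg
  -- The tangent space in which `mfderiv` takes its values depends on `f χ`. Stating the equality in
  -- the model spaces for an arbitrary `f` allows the equation between the maps to be substituted.
  have h3 : ∀ f : FrameBundle E → COQuotient E, f = COQuotient.mk →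
      (mfderiv (frameModel k) (quotientModel k) f χ :
        EuclideanSpace ℝ (Fin (k + 1)) × (Plane × Plane) →L[ℝ] EuclideanSpace ℝ (Fin (k + 1)) × ℂ) =
      mfderiv (frameModel k) (quotientModel k) COQuotient.mk χ := by
    rintro _ rfl
    rfl
  exact (DFunLike.congr_fun h1 v).symm.trans (DFunLike.congr_fun (h3 (COQuotient.mk ∘ fun χ : FrameBundle E => χ.act g) h2) v)

theorem mfderivMk_surjective (χ : FrameBundle E) : Function.Surjective (mfderivMk (k := k) χ) := by
  intro u
  have hs := mem_extChartAt_source (I := frameModel k) χ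
  have hc := det_ne_of_mem_source hs
  obtain ⟨v, hv⟩ := (toChart_bijective (frameModel k) χ hs).2
    (slopeSectionLin _ (extChartAt (frameModel k) χ χ).2 u)
  refine ⟨v, ?_⟩
  have h := toChart_mfderiv_mk hs v
  rw [toChart_self] at h
  refine h.trans ?_
  rw [hv]
  have h1 := slopeSection_extChartAt_mk (k := k) χ
  have h2 := fderiv_slopeCoords_slopeSectionLin (frameSlope_den_ne hc)
    (x := extChartAt (quotientModel k) (COQuotient.mk χ) (COQuotient.mk χ)) (by rw [h1]; exact hc) u
  rwa [h1] at h2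

variable (S : GL2Structure k E) (φ : GL2Connection k E)

namespace GL2Connection

/-- The linear isomorphism from the tangent space of `B(E)/CO(2)` whose pullback to `B(E)` at `χ` is
`(ξ, ζ)`. -/
def quotientCoframe (χ : FrameBundle E) : EuclideanSpace ℝ (Fin (k + 1)) × ℂ →L[ℝ] (Idx k → ℂ) × ℂ :=
  φ.pullQuotient S χ (extChartAt (quotientModel k) (COQuotient.mk χ) (COQuotient.mk χ))

theorem quotientCoframe_mfderivMk (χ : FrameBundle E) (v : TangentSpace (frameModel k) χ) :
    φ.quotientCoframe S χ (mfderivMk χ v) = φ.complexCoframe S χ v := by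
  have h := φ.pullQuotient_mfderiv_mk S (mem_extChartAt_source χ) (slopeSection_extChartAt_mk χ) v
  rw [toChart_self] at h
  exact h

/-- The smooth local coframe, at a point of the chart other than the centre, is the pointwise
coframe of the frame on the section over that point. -/
theorem pullQuotient_toChart {χ₀ χ : FrameBundle E} {x : EuclideanSpace ℝ (Fin (k + 1)) × ℂ}
    (hχ : χ ∈ (extChartAt (frameModel k) χ₀).source)
    (hx : slopeSection (extChartAt (frameModel k) χ₀ χ₀).2 x = extChartAt (frameModel k) χ₀ χ)
    (u : TangentSpace (quotientModel k) (COQuotient.mk χ)) :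
    φ.pullQuotient S χ₀ x (toChart (quotientModel k) (COQuotient.mk χ₀) (COQuotient.mk χ) u) =
      φ.quotientCoframe S χ u := by
  obtain ⟨v, rfl⟩ := mfderivMk_surjective χ u
  rw [quotientCoframe_mfderivMk]
  exact φ.pullQuotient_mfderiv_mk S hχ hx v

/-- Surjectivity is inherited from `(ξ, ζ)`; for odd `k` both sides have real dimension `k + 3`. -/
theorem quotientCoframe_bijective (hk : Odd k) (χ : FrameBundle E) :
    Function.Bijective (φ.quotientCoframe S χ) := by
  have hs : Function.Surjective (φ.quotientCoframe S χ) := by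
    intro c
    obtain ⟨v, hv⟩ := φ.complexCoframe_surjective S hk χ c
    exact ⟨mfderivMk χ v, by rw [quotientCoframe_mfderivMk, hv]⟩
  have hd : Module.finrank ℝ (EuclideanSpace ℝ (Fin (k + 1)) × ℂ) = Module.finrank ℝ ((Idx k → ℂ) × ℂ) := by
    rw [Module.finrank_prod, Module.finrank_prod, finrank_idx hk]
    simp
  exact ⟨(LinearMap.injective_iff_surjective_of_finrank_eq_finrank hd
    (f := (φ.quotientCoframe S χ).toLinearMap)).2 hs, hs⟩

theorem quotientCoframe_invertible (hk : Odd k) (χ : FrameBundle E) :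
    (φ.quotientCoframe S χ).IsInvertible :=
  ⟨(LinearEquiv.ofBijective (φ.quotientCoframe S χ).toLinearMap
    (φ.quotientCoframe_bijective S hk χ)).toContinuousLinearEquiv, by
      refine ContinuousLinearMap.ext fun u => rfl⟩

theorem contDiffAt_pullQuotient (χ₀ : FrameBundle E) :
    ContDiffAt ℝ ∞ (φ.pullQuotient S χ₀)
      (extChartAt (quotientModel k) (COQuotient.mk χ₀) (COQuotient.mk χ₀)) := by
  have h1 := φ.contDiffAt_pullComplex S χ₀
  rw [← slopeSection_extChartAt_mk χ₀] at h1
  exact (h1.comp _ (contDiffAt_const.add (ContinuousLinearMap.contDiff _).contDiffAt)).clm_comp contDiffAt_const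

/-- Along a `CO(2)`-orbit each `ξ^{k,j}` changes by the nonzero factor `zMonomial k j (a + b i)` and
`ζ` by a complex factor. Complex scalars commute with `i`, so multiplication by `i` does not depend
on the frame chosen in the orbit. -/
theorem quotientCoframe_act (hk : Odd k) (χ : FrameBundle E) {g : GL (Fin 2) ℝ} (hg : g ∈ CO2)
    {u u' : EuclideanSpace ℝ (Fin (k + 1)) × ℂ}
    (h : φ.quotientCoframe S χ u' = Complex.I • φ.quotientCoframe S χ u) :
    φ.quotientCoframe S (χ.act g) u' = Complex.I • φ.quotientCoframe S (χ.act g) u := by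
  obtain ⟨v, rfl⟩ := mfderivMk_surjective χ u
  obtain ⟨v', rfl⟩ := mfderivMk_surjective χ u'
  rw [quotientCoframe_mfderivMk, quotientCoframe_mfderivMk, complexCoframe_apply, complexCoframe_apply,
    Prod.smul_mk, Prod.mk_inj] at h
  rw [← mfderivMk_act χ hg, ← mfderivMk_act χ hg, quotientCoframe_mfderivMk, quotientCoframe_mfderivMk,
    complexCoframe_apply, complexCoframe_apply, Prod.smul_mk, Prod.mk_inj]
  obtain ⟨a, b, hab⟩ := hg
  have hdet := g.det_ne_zero
  rw [hab, Matrix.det_fin_two] at hdet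
  have hz : (a + b * Complex.I : ℂ) ≠ 0 := by
    intro h0
    have h1 := congrArg Complex.re h0
    have h2 := congrArg Complex.im h0
    simp at h1 h2
    exact hdet (by simp [h1, h2])
  have hxi : ∀ (v : TangentSpace (frameModel k) χ) (j : Idx k), S.xi χ v j =
      zMonomial k j (a + b * Complex.I) * S.xi (χ.act g)
        (mfderiv (frameModel k) (frameModel k) (fun χ : FrameBundle E => χ.act g) χ v) j := by
    intro v j
    rw [GL2Structure.xi, S.solder_act χ g v, ← realCombination_xiMap hk (S.solder (χ.act g) _), hab,
      substMap_co_realCombination, xiMap_realCombination hk]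
    rfl
  obtain ⟨μ, hμ⟩ := zetaMap_co_conj a b
  have hzeta : ∀ v : TangentSpace (frameModel k) χ, φ.zeta (χ.act g)
      (mfderiv (frameModel k) (frameModel k) (fun χ : FrameBundle E => χ.act g) χ v) = μ * φ.zeta χ v := by
    intro v
    rw [zeta, zeta, ← hμ, ← hab, ← Matrix.coe_units_inv]
    exact congrArg zetaMap (φ.equivariant g χ v)
  constructor
  · funext j
    have hne : zMonomial k j (a + b * Complex.I) ≠ 0 :=
      mul_ne_zero (pow_ne_zero _ hz) (pow_ne_zero _ ((map_ne_zero _).2 hz))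
    have h1 := congrFun h.1 j
    rw [Pi.smul_apply, hxi, hxi, smul_eq_mul] at h1
    rw [Pi.smul_apply, smul_eq_mul]
    refine mul_left_cancel₀ hne ?_
    rw [h1]
    ring
  · rw [hzeta, hzeta, h.2, smul_eq_mul, smul_eq_mul]
    ring

/-- Multiplication by `i` in the complex coordinates `(ξ, ζ)` at `χ`. -/
def complexEnd (χ : FrameBundle E) :
    EuclideanSpace ℝ (Fin (k + 1)) × ℂ →L[ℝ] EuclideanSpace ℝ (Fin (k + 1)) × ℂ :=
  (φ.quotientCoframe S χ).inverse.comp (Complex.I • φ.quotientCoframe S χ)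

theorem quotientCoframe_complexEnd (hk : Odd k) (χ : FrameBundle E)
    (u : EuclideanSpace ℝ (Fin (k + 1)) × ℂ) :
    φ.quotientCoframe S χ (φ.complexEnd S χ u) = Complex.I • φ.quotientCoframe S χ u := by
  obtain ⟨e, he⟩ := φ.quotientCoframe_invertible S hk χ
  rw [complexEnd, ← he, ContinuousLinearMap.inverse_equiv]
  exact e.apply_symm_apply _

theorem complexEnd_act (hk : Odd k) (χ : FrameBundle E) {g : GL (Fin 2) ℝ} (hg : g ∈ CO2) :
    φ.complexEnd S (χ.act g) = φ.complexEnd S χ := by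
  refine ContinuousLinearMap.ext fun u => (φ.quotientCoframe_bijective S hk (χ.act g)).1 ?_
  rw [φ.quotientCoframe_complexEnd S hk]
  exact (φ.quotientCoframe_act S hk χ hg (φ.quotientCoframe_complexEnd S hk χ u)).symm

/-- The field of endomorphisms of the tangent spaces of `B(E)/CO(2)` defined by `complexEnd`. -/
def quotientEnd (hk : Odd k) (q : COQuotient E) :
    TangentSpace (quotientModel k) q →L[ℝ] TangentSpace (quotientModel k) q :=
  Quotient.lift (s := coSetoid E) (φ.complexEnd S)
    (by rintro χ _ ⟨g, hg, rfl⟩; exact (φ.complexEnd_act S hk χ hg).symm) q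

theorem pullQuotient_pullEnd {J : Π q : COQuotient E, TangentSpace (quotientModel k) q →L[ℝ]
      TangentSpace (quotientModel k) q}
    (hJ : ∀ (χ : FrameBundle E) (u : TangentSpace (quotientModel k) (COQuotient.mk χ)),
      φ.quotientCoframe S χ (J (COQuotient.mk χ) u) = Complex.I • φ.quotientCoframe S χ u)
    (χ₀ : FrameBundle E) :
    ∀ᶠ x in 𝓝 (extChartAt (quotientModel k) (COQuotient.mk χ₀) (COQuotient.mk χ₀)), ∀ u,
      φ.pullQuotient S χ₀ x (pullEnd (quotientModel k) (COQuotient.mk χ₀) J x u) =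
        Complex.I • φ.pullQuotient S χ₀ x u := by
  filter_upwards [eventually_exists_frame χ₀] with x hx u
  obtain ⟨χ, hχ, h1, h2⟩ := hx
  obtain ⟨w, rfl⟩ := (toChart_bijective (quotientModel k) (COQuotient.mk χ₀) (mk_mem_source hχ)).2 u
  have h3 := toChart_end (quotientModel k) (COQuotient.mk χ₀) J (mk_mem_source hχ) w
  rw [h2] at h3
  rw [← h3, φ.pullQuotient_toChart S hχ h1, φ.pullQuotient_toChart S hχ h1]
  exact hJ χ w

/-- The almost-complex structure on `B(E)/CO(2)` for which `ξ` and `ζ` are of type `(1,0)`. -/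
def canonicalStructure (hk : Odd k) : AlmostComplexStructure (quotientModel k) (COQuotient E) where
  toFun := φ.quotientEnd S hk
  smooth q := by
    obtain ⟨χ₀, rfl⟩ := COQuotient.mk_surjective q
    refine contMDiffAt_of_pullEnd (quotientModel k) ?_
    have hL := φ.contDiffAt_pullQuotient S χ₀
    have hinv : (φ.pullQuotient S χ₀ (extChartAt (quotientModel k) (COQuotient.mk χ₀)
        (COQuotient.mk χ₀))).IsInvertible := φ.quotientCoframe_invertible S hk χ₀
    have h1 := (hinv.contDiffAt_map_inverse (n := ∞)).comp _ hL
    -- In the chart the structure is `L⁻¹ ∘ (i L)` with `L` the smooth local coframe. It is enough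
    -- that this holds near the centre, where `L` remains invertible because invertibility is an
    -- open condition.
    refine (h1.clm_comp (hL.const_smul Complex.I)).congr_of_eventuallyEq ?_
    have hinv' : ∀ᶠ x in 𝓝 (extChartAt (quotientModel k) (COQuotient.mk χ₀) (COQuotient.mk χ₀)),
        (φ.pullQuotient S χ₀ x).IsInvertible := by
      obtain ⟨e, he⟩ := hinv
      have := hL.continuousAt.preimage_mem_nhds (he ▸ ContinuousLinearEquiv.nhds e)
      filter_upwards [this] with x hx
      obtain ⟨e', he'⟩ := hx
      exact ⟨e', he'⟩
    filter_upwards [hinv', φ.pullQuotient_pullEnd S (J := φ.quotientEnd S hk)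
      (fun χ u => φ.quotientCoframe_complexEnd S hk χ u) χ₀] with x hx h
    obtain ⟨e, he⟩ := hx
    refine ContinuousLinearMap.ext fun u => e.injective ?_
    have h2 := h u
    rw [← he] at h2
    refine h2.trans ?_
    simp only [Function.comp_apply, ← he, ContinuousLinearMap.inverse_equiv]
    exact (e.apply_symm_apply _).symm
  sq q v := by
    obtain ⟨χ, rfl⟩ := COQuotient.mk_surjective q
    apply (φ.quotientCoframe_bijective S hk χ).1
    refine (φ.quotientCoframe_complexEnd S hk χ _).trans ?_
    refine (congrArg (Complex.I • ·) (φ.quotientCoframe_complexEnd S hk χ v)).trans ?_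
    rw [smul_smul, Complex.I_mul_I, neg_one_smul]
    exact (map_neg _ _).symm

/-- The projection is a submersion, so a form on the quotient is determined by its pullback. The
prescribed forms are thus the complex linear functionals of `quotientCoframe`. Testing its
components gives one direction; the other holds because a real-linear functional commuting with `i`
is complex linear. -/
theorem isCanonical_iff (hk : Odd k) (J : AlmostComplexStructure (quotientModel k) (COQuotient E)) :
    φ.IsCanonical S J ↔ ∀ (χ : FrameBundle E) (u : TangentSpace (quotientModel k) (COQuotient.mk χ)),
      φ.quotientCoframe S χ (J.toFun (COQuotient.mk χ) u) = Complex.I • φ.quotientCoframe S χ u := by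
  have hΞ : ∀ (χ : FrameBundle E) (v : TangentSpace (frameModel k) χ),
      φ.quotientCoframe S χ (mfderiv (frameModel k) (quotientModel k) COQuotient.mk χ v) =
        (S.xi χ v, φ.zeta χ v) := fun χ v =>
    (φ.quotientCoframe_mfderivMk S χ v).trans (φ.complexCoframe_apply S χ v)
  constructor
  · intro hJ χ u
    have key : ∀ ℓ : (Idx k → ℂ) × ℂ →L[ℝ] ℂ, (∃ (c : Idx k → ℂ) (d : ℂ), ∀ w, ℓ w = ∑ j, c j * w.1 j + d * w.2) →
        ℓ (φ.quotientCoframe S χ (J.toFun (COQuotient.mk χ) u)) =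
          Complex.I * ℓ (φ.quotientCoframe S χ u) := by
      rintro ℓ ⟨c, d, hℓ⟩
      refine (hJ χ (ℓ.comp (φ.quotientCoframe S χ))).2 ⟨c, d, fun v => ?_⟩ u
      exact (congrArg ℓ (hΞ χ v)).trans (hℓ _)
    refine Prod.ext (funext fun j => ?_) ?_
    · exact key ((ContinuousLinearMap.proj j).comp (ContinuousLinearMap.fst ℝ _ _))
        ⟨Pi.single j 1, 0, fun w => by simp [Pi.single_apply]⟩
    · exact key (ContinuousLinearMap.snd ℝ _ _) ⟨0, 1, fun w => by simp⟩
  · intro hJ χ α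
    constructor
    · intro hα
      obtain ⟨e, he⟩ := φ.quotientCoframe_invertible S hk χ
      let α' : EuclideanSpace ℝ (Fin (k + 1)) × ℂ →L[ℝ] ℂ := α
      let β : (Idx k → ℂ) × ℂ →ₗ[ℝ] ℂ := (α'.comp
        (e.symm : (Idx k → ℂ) × ℂ →L[ℝ] EuclideanSpace ℝ (Fin (k + 1)) × ℂ)).toLinearMap
      have hβα : ∀ u, α u = β (φ.quotientCoframe S χ u) := fun u => by
        rw [← he]
        exact congrArg α' (e.symm_apply_apply u).symm
      have hβ : ∀ w, β (Complex.I • w) = Complex.I * β w := by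
        intro w
        obtain ⟨u, rfl⟩ := (φ.quotientCoframe_bijective S hk χ).2 w
        exact (congrArg β (hJ χ u).symm).trans ((hβα _).symm.trans
          ((hα u).trans (congrArg (Complex.I * ·) (hβα u))))
      have hβ' : ∀ (a : ℂ) w, β (a • w) = a * β w := by
        intro a w
        have h : a • w = a.re • w + a.im • Complex.I • w := by
          conv_lhs => rw [← Complex.re_add_im a, add_smul, mul_smul]
          rfl
        rw [h, map_add, map_smul, map_smul, hβ]
        conv_rhs => rw [← Complex.re_add_im a]
        simp only [Complex.real_smul]
        ring
      refine ⟨fun j => β (Pi.single j 1, 0), β (0, 1), fun v => ?_⟩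
      rw [hβα, hΞ]
      have h : (S.xi χ v, φ.zeta χ v) = ∑ j, S.xi χ v j • ((Pi.single j 1, 0) : (Idx k → ℂ) × ℂ) +
          φ.zeta χ v • ((0, 1) : (Idx k → ℂ) × ℂ) := by
        refine Prod.ext (funext fun i => ?_) ?_
        · simp [Prod.fst_sum, Finset.sum_apply, Pi.single_apply]
        · simp [Prod.snd_sum]
      rw [h, map_add, map_sum, hβ']
      simp only [hβ', mul_comm]
    · rintro ⟨c, d, h⟩ u
      let γ : (Idx k → ℂ) × ℂ → ℂ := fun w => ∑ j, c j * w.1 j + d * w.2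
      have hγ : ∀ u, α u = γ (φ.quotientCoframe S χ u) := by
        intro u
        obtain ⟨v, rfl⟩ := mfderivMk_surjective χ u
        exact (h v).trans (congrArg γ (hΞ χ v)).symm
      rw [hγ, hγ]
      refine (congrArg γ (hJ χ u)).trans ?_
      simp only [γ, Prod.smul_fst, Prod.smul_snd, Pi.smul_apply, smul_eq_mul, mul_add, Finset.mul_sum]
      congr 1
      · exact Finset.sum_congr rfl fun j _ => by ring
      · ring

theorem existsUnique_isCanonical (hk : Odd k) :
    ∃! J : AlmostComplexStructure (quotientModel k) (COQuotient E), φ.IsCanonical S J := by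
  refine ⟨φ.canonicalStructure S hk, ?_, ?_⟩
  · exact (φ.isCanonical_iff S hk _).2 fun χ u => φ.quotientCoframe_complexEnd S hk χ u
  · intro J hJ
    rw [isCanonical_iff S φ hk] at hJ
    have h : J.toFun = (φ.canonicalStructure S hk).toFun := by
      funext q
      obtain ⟨χ, rfl⟩ := COQuotient.mk_surjective q
      refine ContinuousLinearMap.ext fun u => (φ.quotientCoframe_bijective S hk χ).1 ?_
      exact (hJ χ u).trans (φ.quotientCoframe_complexEnd S hk χ u).symm
    cases J
    cases h
    rfl

end GL2Connection

end QuotientCoframe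

/-! ### The integrability criterion -/

section Integrability

variable {k : ℕ} {M : Type*} [TopologicalSpace M] [ChartedSpace (EuclideanSpace ℝ (Fin (k + 1))) M]
  {E : M → Type*} [∀ p, AddCommGroup (E p)] [∀ p, Module ℝ (E p)]
  [TopologicalSpace (TotalSpace Plane E)] [∀ p, TopologicalSpace (E p)]
  [FiberBundle Plane E] [VectorBundle ℝ Plane E]
  [IsManifold (𝓡 (k + 1)) ∞ M] [ContMDiffVectorBundle ∞ Plane E (𝓡 (k + 1))]
  (S : GL2Structure k E) (φ : GL2Connection k E)

namespace GL2Connection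

/-- As the section is affine, its linear part is constant and contributes no derivative of its own.
-/
theorem fderiv_pullQuotient (χ : FrameBundle E) (u w : EuclideanSpace ℝ (Fin (k + 1)) × ℂ) :
    fderiv ℝ (φ.pullQuotient S χ) (extChartAt (quotientModel k) (COQuotient.mk χ) (COQuotient.mk χ)) u w =
      fderiv ℝ (φ.pullComplex S χ) (extChartAt (frameModel k) χ χ)
        (slopeSectionLin _ (extChartAt (frameModel k) χ χ).2 u)
        (slopeSectionLin _ (extChartAt (frameModel k) χ χ).2 w) := by
  have h1 : HasFDerivAt (φ.pullComplex S χ)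
      (fderiv ℝ (φ.pullComplex S χ) (extChartAt (frameModel k) χ χ))
      (slopeSection (extChartAt (frameModel k) χ χ).2
        (extChartAt (quotientModel k) (COQuotient.mk χ) (COQuotient.mk χ))) := by
    rw [slopeSection_extChartAt_mk]
    exact ((φ.contDiffAt_pullComplex S χ).differentiableAt (by simp)).hasFDerivAt
  have h2 := (h1.comp _ (hasFDerivAt_slopeSection _ _)).clm_comp
    (hasFDerivAt_const (slopeSectionLin (EuclideanSpace ℝ (Fin (k + 1))) (extChartAt (frameModel k) χ χ).2)
      (extChartAt (quotientModel k) (COQuotient.mk χ) (COQuotient.mk χ)))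
  have h3 := h2.fderiv
  change fderiv ℝ (φ.pullQuotient S χ) _ = _ at h3
  rw [h3]
  simp

/-- The structure equations `dω = Θ - Φ ∧ ω` and `dφ = Ω - φ ∧ φ`, projected to `ξ` and `ζ`, with
torsion and curvature written as forms in `ξ`. -/
theorem dForm_pullComplex (hk : Odd k) (χ : FrameBundle E) (v w : TangentSpace (frameModel k) χ) :
    dForm (φ.pullComplex S χ) (extChartAt (frameModel k) χ χ) (toChart (frameModel k) χ χ v)
        (toChart (frameModel k) χ χ w) =
      (fun j => φ.torsionForm S χ j (S.xi χ v) (S.xi χ w) - xiMap k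
          ((rep k (φ.val χ v)).mulVec (S.solder χ w) - (rep k (φ.val χ w)).mulVec (S.solder χ v)) j,
        φ.curvatureForm S χ (S.xi χ v) (S.xi χ w) -
          zetaMap (φ.val χ v * φ.val χ w - φ.val χ w * φ.val χ v)) := by
  set y := extChartAt (frameModel k) χ χ with hy
  set v' := toChart (frameModel k) χ χ v with hv'
  set w' := toChart (frameModel k) χ χ w with hw'
  have hd := (φ.contDiffAt_pullComplex S χ).differentiableAt (by simp)
  rw [← hy] at hd
  -- A constant linear map commutes with the exterior derivative. It is used for the projections to
  -- `ξ`, to the real part of `ζ` and to its imaginary part.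
  have hl : ∀ (F : Type) [NormedAddCommGroup F] [NormedSpace ℝ F] (ℓ : (Idx k → ℂ) × ℂ →L[ℝ] F)
      (L : EuclideanSpace ℝ (Fin (k + 1)) × (Plane × Plane) →
        EuclideanSpace ℝ (Fin (k + 1)) × (Plane × Plane) →L[ℝ] F),
      (∀ x, L x = ℓ.comp (φ.pullComplex S χ x)) →
        ℓ (dForm (φ.pullComplex S χ) y v' w') = dForm L y v' w' := by
    intro F _ _ ℓ L hL
    have h1 : L = fun x => ℓ.comp (φ.pullComplex S χ x) := funext hL
    have h2 := (hasFDerivAt_const ℓ y).clm_comp hd.hasFDerivAt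
    rw [h1, dForm, dForm, h2.fderiv]
    simp
  refine Prod.ext ?_ ?_
  · have h1 := hl _ (ContinuousLinearMap.fst ℝ (Idx k → ℂ) ℂ) (fun x => (xiMap k).comp (S.pullSolder χ x))
      fun x => rfl
    have h2 := (hasFDerivAt_const (xiMap k) y).clm_comp (S.differentiableAt_pullSolder χ).hasFDerivAt
    have h3 : dForm (fun x => (xiMap k).comp (S.pullSolder χ x)) y v' w' =
        xiMap k (dForm (S.pullSolder χ) y v' w') := by
      rw [dForm, dForm, h2.fderiv]
      simp [hy]
    refine h1.trans (h3.trans ?_)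
    have h4 := eq_sub_of_add_eq (φ.torsion_eq S χ v w).symm
    funext j
    simp only [φ.torsionForm_xi S hk]
    rw [hy, hv', hw', h4, map_sub]
    rfl
  · have h1 : ∀ i j, dForm (pullForm (frameModel k) χ (φ.form i j)) y v' w' =
        φ.curvature χ v w i j - (φ.val χ v * φ.val χ w - φ.val χ w * φ.val χ v) i j := fun i j => by
      rw [φ.curvature_eq]; simp only [hy, hv', hw']; ring
    have hre := hl _ (Complex.reCLM.comp (ContinuousLinearMap.snd ℝ (Idx k → ℂ) ℂ)) (fun x =>
      pullForm (frameModel k) χ (φ.form 1 0) x + pullForm (frameModel k) χ (φ.form 0 1) x) fun x => by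
        refine ContinuousLinearMap.ext fun u => ?_
        simp [pullComplex_apply, zetaMap, pullVal]
    have him := hl _ (Complex.imCLM.comp (ContinuousLinearMap.snd ℝ (Idx k → ℂ) ℂ)) (fun x =>
      pullForm (frameModel k) χ (φ.form 1 1) x - pullForm (frameModel k) χ (φ.form 0 0) x) fun x => by
        refine ContinuousLinearMap.ext fun u => ?_
        simp [pullComplex_apply, zetaMap, pullVal]
    have hdf := fun i j => (φ.differentiableAt_pullForm χ i j).hasFDerivAt
    have e1 : dForm (fun x => pullForm (frameModel k) χ (φ.form 1 0) x +
        pullForm (frameModel k) χ (φ.form 0 1) x) y v' w' =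
        dForm (pullForm (frameModel k) χ (φ.form 1 0)) y v' w' +
        dForm (pullForm (frameModel k) χ (φ.form 0 1)) y v' w' := by
      rw [dForm, ((hdf 1 0).fun_add (hdf 0 1)).fderiv, dForm, dForm]
      simp [hy]; ring
    have e2 : dForm (fun x => pullForm (frameModel k) χ (φ.form 1 1) x -
        pullForm (frameModel k) χ (φ.form 0 0) x) y v' w' =
        dForm (pullForm (frameModel k) χ (φ.form 1 1)) y v' w' -
        dForm (pullForm (frameModel k) χ (φ.form 0 0)) y v' w' := by
      rw [dForm, ((hdf 1 1).fun_sub (hdf 0 0)).fderiv, dForm, dForm]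
      simp [hy]; ring
    rw [e1, h1, h1] at hre
    rw [e2, h1, h1] at him
    simp only [φ.curvatureForm_xi S hk]
    apply Complex.ext
    · refine hre.trans ?_
      simp [zetaMap]; ring
    · refine him.trans ?_
      simp [zetaMap]; ring

theorem isIntegrable_iff (hk : Odd k) {J : AlmostComplexStructure (quotientModel k) (COQuotient E)}
    (hJ : φ.IsCanonical S J) : J.IsIntegrable ↔
      (∀ (χ : FrameBundle E) (j a b : Idx k), φ.torsion02 S χ j a b = 0) ∧
        (∀ (χ : FrameBundle E) (a b : Idx k), φ.curvature02 S χ a b = 0) := by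
  rw [isCanonical_iff S φ hk] at hJ
  have key : ∀ χ : FrameBundle E, (∀ X Y : Π q : COQuotient E, TangentSpace (quotientModel k) q,
      ContMDiffAt (quotientModel k) (quotientModel k).tangent ∞
        (fun q => (⟨q, X q⟩ : TangentBundle (quotientModel k) (COQuotient E))) (COQuotient.mk χ) →
      ContMDiffAt (quotientModel k) (quotientModel k).tangent ∞
        (fun q => (⟨q, Y q⟩ : TangentBundle (quotientModel k) (COQuotient E))) (COQuotient.mk χ) →
      J.nijenhuis X Y (COQuotient.mk χ) = 0) ↔
      (∀ j a b : Idx k, φ.torsion02 S χ j a b = 0) ∧ ∀ a b : Idx k, φ.curvature02 S χ a b = 0 := by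
    intro χ
    have hJ' := φ.pullQuotient_pullEnd S hJ χ
    rw [nijenhuis_eq_zero_iff (quotientModel k) J (COQuotient.mk χ)
      ((φ.contDiffAt_pullQuotient S χ).differentiableAt (by simp))
      (φ.quotientCoframe_bijective S hk χ).1 hJ']
    set x := extChartAt (quotientModel k) (COQuotient.mk χ) (COQuotient.mk χ) with hx
    set T := pullEnd (quotientModel k) (COQuotient.mk χ) J.toFun x
    have hT := hJ'.self_of_nhds
    have hlift : ∀ u : EuclideanSpace ℝ (Fin (k + 1)) × ℂ, ∃ v : TangentSpace (frameModel k) χ,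
        toChart (frameModel k) χ χ v = slopeSectionLin _ (extChartAt (frameModel k) χ χ).2 u := fun u =>
      (toChart_bijective (frameModel k) χ (mem_extChartAt_source χ)).2 _
    -- The lift `s` follows the section. Only the values of `ξ` and `ζ` on it matter: there `T` acts
    -- as multiplication by `i`, as required by `part02_rep` and `part02_commutator`.
    choose s hs using hlift
    have hΞ : ∀ u, φ.pullQuotient S χ x u = (S.xi χ (s u), φ.zeta χ (s u)) := by
      intro u
      rw [← complexCoframe_apply, apply_eq_pullForm (frameModel k) χ (φ.complexCoframe S)
        (mem_extChartAt_source χ), hs, pullQuotient, hx, slopeSection_extChartAt_mk]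
      rfl
    have hxi : ∀ u, S.xi χ (s (T u)) = Complex.I • S.xi χ (s u) := fun u => by
      have := congrArg Prod.fst (hT u)
      rwa [hΞ, hΞ] at this
    have hzeta : ∀ u, zetaMap (φ.val χ (s (T u))) = Complex.I * zetaMap (φ.val χ (s u)) := fun u => by
      have := congrArg Prod.snd (hT u)
      rwa [hΞ, hΞ] at this
    -- Any value of `ξ` is attained on a lift, since the coframe is onto and `ζ` may be taken zero.
    -- The `(0,2)`-parts can therefore be tested on arbitrary coordinate vectors.
    have hsurj : ∀ c : Idx k → ℂ, ∃ u, S.xi χ (s u) = c := fun c => by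
      obtain ⟨u, hu⟩ := (φ.quotientCoframe_bijective S hk χ).2 (c, 0)
      exact ⟨u, congrArg Prod.fst ((hΞ u).symm.trans hu)⟩
    have hd : ∀ u w, dForm (φ.pullQuotient S χ) x u w =
        (fun j => φ.torsionForm S χ j (S.xi χ (s u)) (S.xi χ (s w)) - xiMap k
          ((rep k (φ.val χ (s u))).mulVec (S.solder χ (s w)) -
            (rep k (φ.val χ (s w))).mulVec (S.solder χ (s u))) j,
        φ.curvatureForm S χ (S.xi χ (s u)) (S.xi χ (s w)) -
          zetaMap (φ.val χ (s u) * φ.val χ (s w) - φ.val χ (s w) * φ.val χ (s u))) := by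
      intro u w
      rw [← φ.dForm_pullComplex S hk, hs, hs, dForm, dForm, fderiv_pullQuotient, fderiv_pullQuotient]
    -- The connection terms have no `(0,2)`-part, so `hpart` retains only torsion and curvature.
    have hrep := part02_rep hk (J := T) (P := fun u => S.solder χ (s u)) (A := fun u => φ.val χ (s u)) hxi hzeta
    have hcomm := part02_commutator (J := T) (A := fun u => φ.val χ (s u)) hzeta
    have hpart : ∀ u w, part02 T (dForm (φ.pullQuotient S χ) x) u w =
        (fun j => part02 (fun c => Complex.I • c) (fun c d => φ.torsionForm S χ j c d) (S.xi χ (s u)) (S.xi χ (s w)),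
          part02 (fun c => Complex.I • c) (fun c d => φ.curvatureForm S χ c d) (S.xi χ (s u)) (S.xi χ (s w))) := by
      intro u w
      refine Prod.ext (funext fun j => ?_) ?_
      · have h1 := congrFun (hrep u w) j
        simp only [part02, Pi.add_apply, Pi.sub_apply, Pi.smul_apply, Pi.zero_apply, smul_eq_mul] at h1
        simp only [part02, hd, hxi, Prod.fst_add, Prod.fst_sub, Prod.smul_fst, Pi.add_apply, Pi.sub_apply,
          Pi.smul_apply, smul_eq_mul]
        linear_combination -h1
      · have h1 := hcomm u w
        simp only [part02, smul_eq_mul] at h1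
        simp only [part02, hd, hxi, Prod.snd_add, Prod.snd_sub, Prod.smul_snd, smul_eq_mul]
        linear_combination -h1
    rw [← φ.part02_curvatureForm_iff S χ]
    simp only [← φ.part02_torsionForm_iff S χ, hpart]
    constructor
    · intro h
      refine ⟨fun j c d => ?_, fun c d => ?_⟩ <;> obtain ⟨u, rfl⟩ := hsurj c <;> obtain ⟨w, rfl⟩ := hsurj d
      · exact congrFun (congrArg Prod.fst (h u w)) j
      · exact congrArg Prod.snd (h u w)
    · rintro ⟨h1, h2⟩ u w
      exact Prod.ext (funext fun j => h1 j _ _) (h2 _ _)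
  constructor
  · intro h
    exact ⟨fun χ => ((key χ).1 (h (COQuotient.mk χ))).1, fun χ => ((key χ).1 (h (COQuotient.mk χ))).2⟩
  · rintro ⟨h1, h2⟩ q
    obtain ⟨χ, rfl⟩ := COQuotient.mk_surjective q
    exact (key χ).2 ⟨h1 χ, h2 χ⟩

end GL2Connection

end Integrability

end
end GL2Geometry

theorem theorem2 (k : ℕ) (hk : Odd k) {M : Type*} [TopologicalSpace M]
    [ChartedSpace (EuclideanSpace ℝ (Fin (k + 1))) M] [IsManifold (𝓡 (k + 1)) ∞ M]
    (E : M → Type*) [∀ p, AddCommGroup (E p)] [∀ p, Module ℝ (E p)]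
    [TopologicalSpace (TotalSpace Plane E)] [∀ p, TopologicalSpace (E p)]
    [FiberBundle Plane E] [VectorBundle ℝ Plane E] [ContMDiffVectorBundle ∞ Plane E (𝓡 (k + 1))]
    (S : GL2Structure k E) (φ : GL2Connection k E) :
    (∃! J : AlmostComplexStructure (quotientModel k) (COQuotient E), φ.IsCanonical S J) ∧
    ∀ J : AlmostComplexStructure (quotientModel k) (COQuotient E), φ.IsCanonical S J →
      (J.IsIntegrable ↔
        (∀ (χ : FrameBundle E) (j a b : Idx k), φ.torsion02 S χ j a b = 0) ∧
        (∀ (χ : FrameBundle E) (a b : Idx k), φ.curvature02 S χ a b = 0)) := by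
  exact ⟨φ.existsUnique_isCanonical S hk, fun J hJ => φ.isIntegrable_iff S hk hJ⟩
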